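/- Let $K$ be a field of characteristic different from $3$ containing a primitive cube root of unity $\zeta$, let $\lambda\in K$ with $\lambda^3+27\neq 0$, and let $E$ be the elliptic curve $X^3+Y^3+Z^3+\lambda XYZ=0$ in $\mathbb P^2$ with origin $O=(1:-1:0)$. Put $S=(1:-\zeta:0)$ and $T=(1:0:-1)$, and define the rational functions $$f_S=(\lambda^3+27)\,\frac{3\zeta^2X+3\zeta Y-\lambda Z}{3X+3Y-\lambda Z},\qquad f_T=(\lambda^2-3\lambda+9)\,\frac{3X-\lambda Y+3Z}{3X+3Y-\lambda Z}$$ on $E$. Then: 1. $(S,T)$ is an $\mathbb F_3$-basis of $E[3](\overline K)$. 2. The lines $3X+3Y-\lambda Z=0$, $3\zeta^2X+3\zeta Y-\lambda Z=0$ and $3X-\lambda Y+3Z=0$ are the tangent lines to $E$ at $O$, $S$ and $T$, and $\operatorname{div}(f_S)=3(S)-3(O)$, $\operatorname{div}(f_T)=3(T)-3(O)$. 3. With respect to any local parameter $t\in K(E)$ at $O$ one has $f_S=a\,t^{-3}+\cdots$ and $f_T=b\,t^{-3}+\cdots$, where $a$ and $b$ are nonzero cubes in $K$. Moreover $f_S\circ[3]=g_S^3$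 and $f_T\circ[3]=g_T^3$ for some $g_S,g_T\in K(E)$. 4. $f_S$ has a value in $K^*$ at every point of $E(K)\setminus\{O,S\}$, and $f_T$ at every point of $E(K)\setminus\{O,T\}$. There is exactly one homomorphism $$\Phi: E(K)/3E(K)\to K^*/K^{*3}\times K^*/K^{*3}$$ whose first component at the class of $P$ is the class of $f_S(P)$ for $P\neq O,S$, and whose second component is the class of $f_T(P)$ for $P\ne O,T$. It is injective, and it is the connecting map $E(K)/3E(K)\to H^1(K,E[3])$ followed by the identification $H^1(K,E[3])\cong K^*/K^{*3}\times K^*/K^{*3}$ given by the Weil pairing with $S$ and $T$. That is, every $P\in E(K)$ is $3Q$ for some $Q\in E(\overline K)$, and for every such $Q$ and all $a,b\in K^*$ representing $\Phi(P)$ there are cube roots $\alpha,\beta\in\overline K$ of $a,b$ with $e_3(\sigma Q-Q,S)=\sigma(\alpha)/\alpha$ and $e_3(\sigma Q-Q,T)=\sigma(\beta)/\beta$ for all $\sigma\in\operatorname{Aut}(\overline K/K)$. Here $e_3(A,B)=g(X+A)/g(X)$, where $\operatorname{div}(f)=3(B)-3(O)$ and $f\circ[3]=g^3$. -/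

import Mathlib

open scoped LinearAlgebra.Projectivization

/-- The data of a smooth Hessian cubic `X³ + Y³ + Z³ + lam·XYZ = 0` over a field of characteristic
different from `3`. The cubic is smooth exactly when `lam³ + 27 ≠ 0`. -/
structure HesseCubic (L : Type*) [Field L] where
  lam : L
  three_ne_zero : (3 : L) ≠ 0
  smooth : lam ^ 3 + 27 ≠ 0

namespace HesseCubic

noncomputable section

variable {L : Type*} [Field L] (E : HesseCubic L)

/-- The same cubic, regarded over a larger field. -/
def baseChange {K : Type*} [Field K] (E : HesseCubic K) (M : Type*) [Field M] [Algebra K M] :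
    HesseCubic M where
  lam := algebraMap K M E.lam
  three_ne_zero := by
    have h := (map_ne_zero (algebraMap K M)).2 E.three_ne_zero
    rwa [map_ofNat] at h
  smooth := by
    have h := (map_ne_zero (algebraMap K M)).2 E.smooth
    rwa [map_add, map_pow, map_ofNat] at h

/-! ### Points -/

/-- The homogeneous polynomial `X³ + Y³ + Z³ + lam·XYZ`. -/
def poly : MvPolynomial (Fin 3) L :=
  .X 0 ^ 3 + .X 1 ^ 3 + .X 2 ^ 3 + .C E.lam * .X 0 * .X 1 * .X 2

lemma eval_poly (v : Fin 3 → L) : MvPolynomial.eval v E.poly =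
    v 0 ^ 3 + v 1 ^ 3 + v 2 ^ 3 + E.lam * v 0 * v 1 * v 2 := by
  simp [poly]

/-- The points of the cubic with coordinates in the base field. -/
def Point : Type _ := {P : ℙ L (Fin 3 → L) // MvPolynomial.eval P.rep E.poly = 0}

lemma eval_rep_mk {v : Fin 3 → L} (hv : v ≠ 0) :
    MvPolynomial.eval (Projectivization.mk L v hv).rep E.poly = 0 ↔
      MvPolynomial.eval v E.poly = 0 := by
  obtain ⟨a, ha⟩ := Projectivization.exists_smul_eq_mk_rep L v hv
  have : MvPolynomial.eval (Projectivization.mk L v hv).rep E.poly =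
      (a : L) ^ 3 * MvPolynomial.eval v E.poly := by
    rw [← ha, eval_poly, eval_poly]
    simp only [Pi.smul_apply, Units.smul_def, smul_eq_mul]
    ring
  rw [this]
  simp

namespace Point

variable {E}

/-- The point of the cubic with given homogeneous coordinates. -/
def mk (v : Fin 3 → L) (hv : v ≠ 0)
    (h : v 0 ^ 3 + v 1 ^ 3 + v 2 ^ 3 + E.lam * v 0 * v 1 * v 2 = 0) : E.Point :=
  ⟨Projectivization.mk L v hv, (E.eval_rep_mk hv).2 (by rw [eval_poly]; exact h)⟩

/-- Homogeneous coordinates of a point. -/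
def coords (P : E.Point) : Fin 3 → L := P.1.rep

/-- Apply a field homomorphism to the coordinates of a point. -/
def map {M : Type*} [Field M] {E' : HesseCubic M} (φ : L →+* M) (h : φ E.lam = E'.lam)
    (P : E.Point) : E'.Point :=
  mk (fun i => φ (P.coords i))
    (fun h0 => P.1.rep_nonzero (funext fun i => (map_eq_zero φ).1 (congrFun h0 i)))
    (by
      have hP := congrArg φ ((E.eval_poly _).symm.trans P.2)
      simp only [map_add, map_mul, map_pow, map_zero, h] at hP
      exact hP)

end Point

/-- The origin `(1 : -1 : 0)`. -/
def pointO : E.Point :=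
  Point.mk ![1, -1, 0] (fun h => one_ne_zero (congrFun h 0)) (by simp; ring)

/-- The point `S = (1 : -ζ : 0)`, where `ζ` is a cube root of unity. -/
def pointS (ζ : L) (hζ : ζ ^ 3 = 1) : E.Point :=
  Point.mk ![1, -ζ, 0] (fun h => one_ne_zero (congrFun h 0)) (by
    simp only [Matrix.cons_val]; linear_combination -hζ)

/-- The point `T = (1 : 0 : -1)`. -/
def pointT : E.Point :=
  Point.mk ![1, 0, -1] (fun h => one_ne_zero (congrFun h 0)) (by simp; ring)

/-! ### The group law

With `k = (lam³ + 27) / 27`, the linear change of coordinates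
`(X : Y : Z) ↦ (x : y : w) = (-k Z : k Y : 3 X + 3 Y - lam Z)`
maps the cubic to a Weierstrass cubic, and the flex `(1 : -1 : 0)` to the point at infinity
`(0 : 1 : 0)`. Being linear it respects collinearity, so the chord-tangent group law with origin
`(1 : -1 : 0)` is obtained by transport from the group law of the Weierstrass curve. -/

/-- The constant `(lam³ + 27) / 27`. -/
def k : L := (E.lam ^ 3 + 27) / 27

lemma ne27 (E : HesseCubic L) : (27 : L) ≠ 0 := by
  have h := pow_ne_zero 3 E.three_ne_zero
  norm_num at h
  exact h

lemma k_ne_zero : E.k ≠ 0 := div_ne_zero E.smooth E.ne27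

lemma k_spec : 27 * E.k = E.lam ^ 3 + 27 := mul_div_cancel₀ _ E.ne27

/-- The Weierstrass curve
`y² + (lam/3) x y - (k/3) y = x³ - (lam²/9) x² + (k lam/9) x - k²/27`. -/
def weierstrass : WeierstrassCurve.Affine L where
  a₁ := E.lam / 3
  a₂ := -E.lam ^ 2 / 9
  a₃ := -E.k / 3
  a₄ := E.k * E.lam / 9
  a₆ := -E.k ^ 2 / 27

lemma weierstrass_disc : E.weierstrass.Δ ≠ 0 := by
  have h3 := E.three_ne_zero
  have h9 : (9 : L) ≠ 0 := by
    have h := pow_ne_zero 2 h3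
    norm_num at h
    exact h
  have h27 := E.ne27
  have : E.weierstrass.Δ = -E.k ^ 3 / 27 := by
    simp only [WeierstrassCurve.Δ, WeierstrassCurve.b₂, WeierstrassCurve.b₄,
      WeierstrassCurve.b₆, WeierstrassCurve.b₈, weierstrass, k]
    rw [show (27 : L) = 3 ^ 3 by norm_num, show (9 : L) = 3 ^ 2 by norm_num]
    field_simp
    ring
  rw [this]
  exact div_ne_zero (neg_ne_zero.2 (pow_ne_zero 3 E.k_ne_zero)) h27

/-- The inverse change of coordinates on affine points: `w = 1`, `Z = -x/k`, `Y = y/k` and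
`X = (w + lam Z)/3 - Y`. -/
def affineCoords (x y : L) : Fin 3 → L :=
  ![(1 - E.lam * x / E.k) / 3 - y / E.k, y / E.k, -x / E.k]

lemma affineCoords_line (x y : L) : 3 * E.affineCoords x y 0 + 3 * E.affineCoords x y 1 -
    E.lam * E.affineCoords x y 2 = 1 := by
  have h3 := E.three_ne_zero
  have hk := E.k_ne_zero
  simp only [affineCoords, Matrix.cons_val]
  field_simp
  ring

lemma affineCoords_ne_zero (x y : L) : E.affineCoords x y ≠ 0 := by
  intro h
  have := E.affineCoords_line x y
  simp [h] at this

lemma affineCoords_eq {v : Fin 3 → L} (hv : 3 * v 0 + 3 * v 1 - E.lam * v 2 = 1) :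
    E.affineCoords (-E.k * v 2) (E.k * v 1) = v := by
  have h3 := E.three_ne_zero
  have hk := E.k_ne_zero
  have h0 : E.affineCoords (-E.k * v 2) (E.k * v 1) 0 = v 0 := by
    simp only [affineCoords, Matrix.cons_val]
    field_simp
    linear_combination -hv
  funext i
  fin_cases i
  · exact h0
  · simp [affineCoords, hk]
  · simp [affineCoords, hk]

lemma equation_iff (x y : L) : E.weierstrass.Equation x y ↔
    E.affineCoords x y 0 ^ 3 + E.affineCoords x y 1 ^ 3 + E.affineCoords x y 2 ^ 3 +
      E.lam * E.affineCoords x y 0 * E.affineCoords x y 1 * E.affineCoords x y 2 = 0 := by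
  have h3 := E.three_ne_zero
  have hk := E.k_ne_zero
  have hs := E.k_spec
  have key : E.k ^ 2 * (E.affineCoords x y 0 ^ 3 + E.affineCoords x y 1 ^ 3 +
      E.affineCoords x y 2 ^ 3 +
      E.lam * E.affineCoords x y 0 * E.affineCoords x y 1 * E.affineCoords x y 2) =
      y ^ 2 + E.lam / 3 * x * y + -E.k / 3 * y -
        (x ^ 3 + -E.lam ^ 2 / 9 * x ^ 2 + E.k * E.lam / 9 * x + -E.k ^ 2 / 27) := by
    simp only [affineCoords, Matrix.cons_val]
    rw [show (27 : L) = 3 ^ 3 by norm_num, show (9 : L) = 3 ^ 2 by norm_num]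
    field_simp
    linear_combination (x ^ 3) * hs
  rw [WeierstrassCurve.Affine.equation_iff, ← sub_eq_zero]
  simp only [weierstrass]
  rw [← key, mul_eq_zero, or_iff_right (pow_ne_zero 2 hk)]

/-- The inverse change of coordinates, from the Weierstrass curve to the Hessian cubic. -/
def ofWeierstrass : E.weierstrass.Point → E.Point
  | .zero => E.pointO
  | .some x y h => Point.mk (E.affineCoords x y) (E.affineCoords_ne_zero x y)
      ((E.equation_iff x y).1 h.1)

lemma ofWeierstrass_bijective : Function.Bijective E.ofWeierstrass := by
  have h3 := E.three_ne_zero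
  have hk := E.k_ne_zero
  have hO : ∀ x y h, E.pointO ≠ E.ofWeierstrass (.some x y h) := by
    intro x y h heq
    obtain ⟨a, ha⟩ := (Projectivization.mk_eq_mk_iff' _ _ _ _ _).1 (congrArg Subtype.val heq)
    have h1 := E.affineCoords_line x y
    have hz : a * (3 * E.affineCoords x y 0 + 3 * E.affineCoords x y 1 -
        E.lam * E.affineCoords x y 2) = 0 := by
      have e0 := congrFun ha 0
      have e1 := congrFun ha 1
      have e2 := congrFun ha 2
      simp only [Pi.smul_apply, smul_eq_mul, Matrix.cons_val] at e0 e1 e2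
      linear_combination 3 * e0 + 3 * e1 - E.lam * e2
    rw [h1, mul_one] at hz
    rw [hz, zero_smul] at ha
    exact one_ne_zero (congrFun ha 0).symm
  constructor
  · rintro (_ | ⟨x, y, h⟩) (_ | ⟨x', y', h'⟩) heq
    · rfl
    · exact (hO _ _ _ heq).elim
    · exact (hO _ _ _ heq.symm).elim
    · obtain ⟨a, ha⟩ := (Projectivization.mk_eq_mk_iff' _ _ _ _ _).1 (congrArg Subtype.val heq)
      have h1 := E.affineCoords_line x y
      have h1' := E.affineCoords_line x' y'
      have ha1 : a = 1 := by
        have e0 := congrFun ha 0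
        have e1 := congrFun ha 1
        have e2 := congrFun ha 2
        simp only [Pi.smul_apply, smul_eq_mul] at e0 e1 e2
        linear_combination 3 * e0 + 3 * e1 - E.lam * e2 + h1 - a * h1'
      rw [ha1, one_smul] at ha
      have e1 := congrFun ha 1
      have e2 := congrFun ha 2
      simp only [affineCoords, Matrix.cons_val] at e1 e2
      field_simp at e1 e2
      obtain rfl : y = y' := e1.symm
      obtain rfl : x = x' := by linear_combination e2
      rfl
  · rintro ⟨P, hP⟩
    induction P using Projectivization.ind with
    | h v hv =>
      have hv' := (E.eval_rep_mk hv).1 hP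
      rw [eval_poly] at hv'
      by_cases hw : 3 * v 0 + 3 * v 1 - E.lam * v 2 = 0
      · refine ⟨.zero, Subtype.ext ?_⟩
        have hz : v 2 = 0 := by
          have hx : (E.lam ^ 3 + 27) * v 2 ^ 3 = 0 := by
            linear_combination 27 * hv' - (9 * v 0 ^ 2 - 9 * v 0 * v 1 + 9 * v 1 ^ 2
              + 3 * E.lam * v 2 * (v 0 + v 1) + E.lam ^ 2 * v 2 ^ 2) * hw
          exact pow_eq_zero_iff (by norm_num) |>.1 ((mul_eq_zero.1 hx).resolve_left E.smooth)
        have hxy : v 1 = -v 0 := by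
          rw [hz] at hw
          refine mul_left_cancel₀ h3 ?_
          linear_combination hw
        have hx0 : v 0 ≠ 0 := by
          intro h0
          refine hv (funext fun i => ?_)
          fin_cases i
          · exact h0
          · simpa [h0] using hxy
          · exact hz
        refine (Projectivization.mk_eq_mk_iff' _ _ _ _ _).2 ⟨(v 0)⁻¹, funext fun i => ?_⟩
        fin_cases i
        · simp [hx0]
        · simp [hx0, hxy]
        · simp [hz]
      · set w := 3 * v 0 + 3 * v 1 - E.lam * v 2 with hwdef
        set u : Fin 3 → L := w⁻¹ • v with hu
        have hu1 : 3 * u 0 + 3 * u 1 - E.lam * u 2 = 1 := by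
          have : w⁻¹ * w = 1 := inv_mul_cancel₀ hw
          simp only [hu, Pi.smul_apply, smul_eq_mul]
          linear_combination this + w⁻¹ * hwdef
        have huE : u 0 ^ 3 + u 1 ^ 3 + u 2 ^ 3 + E.lam * u 0 * u 1 * u 2 = 0 := by
          simp only [hu, Pi.smul_apply, smul_eq_mul]
          linear_combination (w⁻¹) ^ 3 * hv'
        have hc := E.affineCoords_eq hu1
        have heq : E.weierstrass.Equation (-E.k * u 2) (E.k * u 1) := by
          rw [equation_iff, hc]
          exact huE
        refine ⟨.some _ _ ((WeierstrassCurve.Affine.equation_iff_nonsingular_of_Δ_ne_zero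
          E.weierstrass_disc).1 heq), Subtype.ext ?_⟩
        refine (Projectivization.mk_eq_mk_iff' _ _ _ _ _).2 ⟨w⁻¹, ?_⟩
        exact hc.symm

/-- The linear change of coordinates as a bijection between the points of the two cubics. -/
def weierstrassEquiv : E.Point ≃ E.weierstrass.Point :=
  (Equiv.ofBijective E.ofWeierstrass E.ofWeierstrass_bijective).symm

open Classical in
/-- The chord-tangent group law with origin `(1 : -1 : 0)`. -/
instance : AddCommGroup E.Point := E.weierstrassEquiv.addCommGroup

lemma zero_eq : (0 : E.Point) = E.pointO := rfl

/-! ### Rational functions -/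

open Polynomial in
/-- The affine equation `1 + y³ + z³ + lam·y z` of the chart `X = 1`, as a polynomial in `z` whose
coefficients are polynomials in `y`. -/
def affinePoly : L[X][X] := X ^ 3 + C (C E.lam * X) * X + C (X ^ 3 + 1)

open Polynomial in
lemma affinePoly_monic : E.affinePoly.Monic := by
  unfold affinePoly
  monicity!

open Polynomial in
lemma affinePoly_natDegree : E.affinePoly.natDegree = 3 := by
  unfold affinePoly
  compute_degree!

open Polynomial in
lemma affinePoly_irreducible : Irreducible E.affinePoly := by
  rw [E.affinePoly_monic.irreducible_iff_roots_eq_zero_of_degree_le_three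
    (by rw [affinePoly_natDegree]; norm_num) (by rw [affinePoly_natDegree])]
  rw [Multiset.eq_zero_iff_forall_notMem]
  intro r hr
  have h : r ^ 3 + C E.lam * X * r + (X ^ 3 + 1) = 0 := by
    have h := (mem_roots'.1 hr).2
    simpa [affinePoly, IsRoot.def] using h
  have hdeg : r.natDegree ≤ 1 := by
    by_contra hd
    have hd : 2 ≤ r.natDegree := by omega
    have h1 : (r ^ 3).natDegree = 3 * r.natDegree := natDegree_pow r 3
    have h2 : (C E.lam * X * r + (X ^ 3 + 1)).natDegree ≤ max (1 + r.natDegree) 3 := by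
      refine (natDegree_add_le _ _).trans (max_le_max ?_ ?_)
      · refine natDegree_mul_le.trans ?_
        gcongr
        compute_degree
      · compute_degree
    have h3 : r ^ 3 = -(C E.lam * X * r + (X ^ 3 + 1)) := by linear_combination h
    rw [h3, natDegree_neg] at h1
    rw [h1] at h2
    rcases le_max_iff.1 h2 with h4 | h4 <;> omega
  obtain ⟨a, b, rfl⟩ := exists_eq_X_add_C_of_natDegree_le_one hdeg
  have hexp : C (a ^ 3 + 1) * X ^ 3 + C (3 * a ^ 2 * b + E.lam * a) * X ^ 2 +
      C (3 * a * b ^ 2 + E.lam * b) * X + C (b ^ 3 + 1) = 0 := by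
    simp only [C_add, C_mul, C_pow, C_1]
    rw [show (C (3 : L) : L[X]) = 3 from rfl]
    linear_combination h
  have c0 := congrArg (fun q => q.coeff 0) hexp
  have c1 := congrArg (fun q => q.coeff 1) hexp
  have c3 := congrArg (fun q => q.coeff 3) hexp
  simp only [coeff_add, coeff_C_mul, coeff_X_pow, coeff_X, coeff_C, coeff_zero] at c0 c1 c3
  norm_num at c0 c1 c3
  have hb : b ≠ 0 := by
    rintro rfl
    simp at c0
  have hab : E.lam = -3 * a * b := by
    refine mul_right_cancel₀ hb ?_
    linear_combination c1
  apply E.smooth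
  rw [hab]
  linear_combination (-27) * b ^ 3 * c3 + 27 * c0

/-- The coordinate ring of the affine chart `X = 1`. -/
abbrev CoordinateRing : Type _ := AdjoinRoot E.affinePoly

instance : IsDomain E.CoordinateRing :=
  AdjoinRoot.isDomain_of_prime E.affinePoly_irreducible.prime

/-- The field of rational functions on the cubic. -/
abbrev FunctionField : Type _ := FractionRing E.CoordinateRing

/-- The rational function `y = Y/X`. -/
def funY : E.FunctionField :=
  algebraMap E.CoordinateRing _ (AdjoinRoot.of E.affinePoly Polynomial.X)

/-- The rational function `z = Z/X`. -/
def funZ : E.FunctionField := algebraMap E.CoordinateRing _ (AdjoinRoot.root E.affinePoly)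

/-- The value of a polynomial in `X, Y, Z` at `(1, Y/X, Z/X)`. For forms `G` and `H` of equal degree,
`E.form G / E.form H` is the rational function `G/H`. -/
def form (G : MvPolynomial (Fin 3) L) : E.FunctionField :=
  MvPolynomial.aeval ![1, E.funY, E.funZ] G

variable {E}

/-- The rational function `f` is regular at `P`, with value `v`: it is a quotient `G/H` of two forms
of the same degree with `H(P) ≠ 0` and `v = G(P)/H(P)`. -/
def HasValue (f : E.FunctionField) (P : E.Point) (v : L) : Prop :=
  ∃ (d : ℕ) (G H : MvPolynomial (Fin 3) L), G.IsHomogeneous d ∧ H.IsHomogeneous d ∧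
    MvPolynomial.eval P.coords H ≠ 0 ∧ f = E.form G / E.form H ∧
    v = MvPolynomial.eval P.coords G / MvPolynomial.eval P.coords H

/-- `t` is a local parameter at `P`: it generates the maximal ideal of the local ring at `P`. -/
def IsParameter (t : E.FunctionField) (P : E.Point) : Prop :=
  HasValue t P 0 ∧ ∀ f, HasValue f P 0 → ∃ h v, HasValue h P v ∧ f = t * h

/-- With respect to the local parameter `t` at `P`, the expansion of `f` is `a tⁿ + ⋯`, where the
dots are higher order terms and `a ≠ 0`. -/
def HasLeadingTerm (f t : E.FunctionField) (P : E.Point) (n : ℤ) (a : L) : Prop :=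
  a ≠ 0 ∧ ∃ u, HasValue u P a ∧ f = t ^ n * u

/-- The order of vanishing of `f` at `P` is `n`. -/
def HasOrder (f : E.FunctionField) (P : E.Point) (n : ℤ) : Prop :=
  ∃ t a, IsParameter t P ∧ HasLeadingTerm f t P n a

/-- The divisor of `f` is `D`. To be used over an algebraically closed field. -/
def HasDivisor (f : E.FunctionField) (D : E.Point →₀ ℤ) : Prop :=
  ∀ P, HasOrder f P (D P)

/-- `f ∘ [3] = g³`, tested at the points where both sides are regular. To be used over an
algebraically closed field. -/
def CompThreeEqCube (f g : E.FunctionField) : Prop :=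
  ∀ (Q : E.Point) (v w : L), HasValue g Q v → HasValue f (3 • Q) w → w = v ^ 3

/-- `ξ` is the value `e₃(A, B) = g(X + A) / g(X)` of the Weil pairing on `3`-torsion points, where
`div f = 3 (B) - 3 (O)` and `f ∘ [3] = g³`. To be used over an algebraically closed field. -/
def IsWeilPairing (A B : E.Point) (ξ : L) : Prop :=
  3 • A = 0 ∧ 3 • B = 0 ∧ ∃ f g : E.FunctionField,
    HasDivisor f (Finsupp.single B 3 - Finsupp.single 0 3) ∧ CompThreeEqCube f g ∧
    ∀ (Q : E.Point) (v w : L), HasValue g Q v → HasValue g (Q + A) w → w = ξ * v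

variable (E)

/-! ### The descent functions -/

/-- The linear form `3X + 3Y - lam·Z`. -/
def lineO : MvPolynomial (Fin 3) L := .C 3 * .X 0 + .C 3 * .X 1 - .C E.lam * .X 2

/-- The linear form `3ζ²X + 3ζY - lam·Z`. -/
def lineS (ζ : L) : MvPolynomial (Fin 3) L :=
  .C (3 * ζ ^ 2) * .X 0 + .C (3 * ζ) * .X 1 - .C E.lam * .X 2

/-- The linear form `3X - lam·Y + 3Z`. -/
def lineT : MvPolynomial (Fin 3) L := .C 3 * .X 0 - .C E.lam * .X 1 + .C 3 * .X 2

/-- The linear form `l` defines the tangent line to the cubic at `P`: it is a nonzero multiple of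
the differential of the equation at `P`. -/
def IsTangentLine (l : MvPolynomial (Fin 3) L) (P : E.Point) : Prop :=
  ∃ c : L, c ≠ 0 ∧ l = ∑ i, .C (c * MvPolynomial.eval P.coords (MvPolynomial.pderiv i E.poly)) * .X i

/-- `f_S = (lam³ + 27) (3ζ²X + 3ζY - lam·Z) / (3X + 3Y - lam·Z)`. -/
def funS (ζ : L) : E.FunctionField :=
  algebraMap L _ (E.lam ^ 3 + 27) * (E.form (E.lineS ζ) / E.form E.lineO)

/-- `f_T = (lam² - 3 lam + 9) (3X - lam·Y + 3Z) / (3X + 3Y - lam·Z)`. -/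
def funT : E.FunctionField :=
  algebraMap L _ (E.lam ^ 2 - 3 * E.lam + 9) * (E.form E.lineT / E.form E.lineO)

end

end HesseCubic

/-! ### The descent map -/

section Descent

variable {K : Type*} [Field K]

/-- The group `K*/K*³`. -/
abbrev CubeClasses (K : Type*) [Field K] : Type _ := Kˣ ⧸ (powMonoidHom 3 : Kˣ →* Kˣ).range

/-- The class in `K*/K*³` of a nonzero element. -/
def cubeClass (a : Kˣ) : CubeClasses K := QuotientGroup.mk a

namespace HesseCubic

variable (E : HesseCubic K)

/-- The group `E(K)/3E(K)`. -/
noncomputable abbrev ModThree : Type _ := E.Point ⧸ (zsmulAddGroupHom 3 : E.Point →+ E.Point).range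

/-- The class of a point in `E(K)/3E(K)`. -/
noncomputable def modThree (P : E.Point) : E.ModThree := QuotientAddGroup.mk P

/-- The curve over an algebraic closure. -/
noncomputable abbrev geom : HesseCubic (AlgebraicClosure K) := E.baseChange (AlgebraicClosure K)

/-- The inclusion of `E(K)` in the set of geometric points. -/
noncomputable def toGeom (P : E.Point) : E.geom.Point :=
  P.map (algebraMap K (AlgebraicClosure K)) rfl

/-- The action of the Galois group on the geometric points. -/
noncomputable def galois (σ : AlgebraicClosure K ≃ₐ[K] AlgebraicClosure K) (Q : E.geom.Point) :
    E.geom.Point :=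
  Point.map (E := E.geom) (E' := E.geom) (RingHomClass.toRingHom σ) (σ.commutes E.lam) Q

/-- The rational function `g` on the curve over the algebraic closure is defined over `K`. -/
def IsDefinedOver (g : E.geom.FunctionField) : Prop :=
  ∃ (d : ℕ) (G H : MvPolynomial (Fin 3) K), G.IsHomogeneous d ∧ H.IsHomogeneous d ∧
    E.geom.form (H.map (algebraMap K (AlgebraicClosure K))) ≠ 0 ∧
    g = E.geom.form (G.map (algebraMap K (AlgebraicClosure K))) /
      E.geom.form (H.map (algebraMap K (AlgebraicClosure K)))

/-- The `3`-torsion cocycle `c` corresponds to `(a, b)` under the identification of `H¹(K, E[3])`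
with `K*/K*³ × K*/K*³` defined by the basis `S, T`: the Weil pairing with `S` maps `c` to the Kummer
cocycle `σ ↦ σ(α)/α` of a cube root `α` of `a`, and likewise for `T` and `b`. -/
def CocycleCorresponds (S T : E.geom.Point)
    (c : (AlgebraicClosure K ≃ₐ[K] AlgebraicClosure K) → E.geom.Point) (a b : Kˣ) : Prop :=
  ∃ α β : AlgebraicClosure K, α ^ 3 = algebraMap K _ (a : K) ∧ β ^ 3 = algebraMap K _ (b : K) ∧
    ∀ σ, IsWeilPairing (c σ) S (σ α / α) ∧ IsWeilPairing (c σ) T (σ β / β)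

/-- The homomorphism `Φ` from `E(K)/3E(K)` to `K*/K*³ × K*/K*³` is the one that `f_S` and `f_T`
define by evaluation: its components at `P` are the classes of `f_S(P)` and `f_T(P)` at all points
`P` where these functions have neither a zero nor a pole. -/
def IsEvaluation (ζ : K) (Φ : E.ModThree →+ Additive (CubeClasses K × CubeClasses K)) : Prop :=
  (∀ (P : E.Point) (u : Kˣ), HasValue (E.funS ζ) P u →
    (Φ (E.modThree P)).toMul.1 = cubeClass u) ∧
  (∀ (P : E.Point) (u : Kˣ), HasValue E.funT P u →
    (Φ (E.modThree P)).toMul.2 = cubeClass u)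

end HesseCubic

end Descent

/-!
The group law on `E` is transported from a Weierstrass curve by a linear change of coordinates, and
everything rests on explicit formulas for it in homogeneous coordinates. The chord formula gives an
addition law of bidegree `(2, 2)` (`IsCoord.add`), which fails only when the difference of the two
points lies on `Z = 0`. From it one reads off that translation by `T` permutes the coordinates
cyclically, that translation by `S` multiplies them by `1, ζ, ζ²`, and the triplication formula
`triVec`. The whole theorem comes from three identities for the triplication map: the pullbacks of
the tangents at `O`, `S` and `T` are, up to constants, the cubes of `XYZ`, of
`X³ + ζ²Y³ + ζZ³` and of `XY² + YZ² + ZX²` (`IsCoord.lineO_triVec`, `IsCoord.lineS_triVec`,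
`IsCoord.lineT_triVec`). The first identifies `E[3]` with the zeros of `XYZ`, hence with the group
generated by `S` and `T`; together they exhibit rational cube roots `g_S = N_S / XYZ` and
`g_T = N_T / XYZ` of `f_S ∘ [3]` and `f_T ∘ [3]`. The Weil pairings with `S` and `T` are then the
factors by which `g_S` and `g_T` change under translation, which are visible from the action of `S`
and `T` on the coordinates.

For the divisors, the product of the tangents at the three flexes on `Z = 0` is a constant times
`Z³` modulo the equation (`tangent_mul`), and likewise for `Y = 0`. This gives the orders at
`O`, `S` and `T`, with leading coefficients at `O` that are cubes for the parameter `Z/X`; for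
another parameter the leading coefficient of a triple pole changes by a cube.

For the descent, the relation `IsKummerClass N P a` says that for some `Q` with `3Q = P`, the
translation factors of `N / XYZ` under `σQ - Q` form the Kummer cocycle of a cube root of `a`. It is
independent of `Q` since `E[3]` is rational, it is multiplicative in `(P, a)`, it holds for
`a = f(P)` because `N / XYZ` takes at `Q` a cube root of `f(P)`, and `P` determines `a` up to cubes.
Hence it is the graph of a homomorphism to `K*/K*³`, and the two relations for `S` and `T` make up
`Φ`. If both cocycles of `P` are trivial, then `σQ = Q` for all `σ`; as `K` need not be perfect, a
further argument is needed to conclude that `Q` is rational (`exists_toGeom_eq_of_fixed`): its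
coordinates arise from those of `P` by extracting cube roots twice, and cube roots are separable
because the characteristic is not `3`.
-/

namespace HesseCubic

noncomputable section

section

variable {L : Type*} [Field L] {E : HesseCubic L} {ζ : L}

/-! ### Homogeneous coordinates -/

/-- `v` is a vector of homogeneous coordinates of `P`. -/
def IsCoord (P : E.Point) (v : Fin 3 → L) : Prop := ∃ c : L, c ≠ 0 ∧ v = c • P.coords

lemma isCoord_coords (P : E.Point) : IsCoord P P.coords := ⟨1, one_ne_zero, (one_smul _ _).symm⟩

lemma isCoord_mk {v : Fin 3 → L} (hv : v ≠ 0)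
    (h : v 0 ^ 3 + v 1 ^ 3 + v 2 ^ 3 + E.lam * v 0 * v 1 * v 2 = 0) :
    IsCoord (Point.mk v hv h) v := by
  obtain ⟨a, ha⟩ := Projectivization.exists_smul_eq_mk_rep L v hv
  refine ⟨(a⁻¹ : Lˣ), Units.ne_zero _, ?_⟩
  change v = (a⁻¹ : Lˣ) • (Projectivization.mk L v hv).rep
  rw [← ha, inv_smul_smul]

namespace IsCoord

variable {P Q : E.Point} {v w : Fin 3 → L}

lemma ne_zero (h : IsCoord P v) : v ≠ 0 := by
  obtain ⟨c, hc, rfl⟩ := h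
  exact smul_ne_zero hc P.1.rep_nonzero

lemma equation (h : IsCoord P v) :
    v 0 ^ 3 + v 1 ^ 3 + v 2 ^ 3 + E.lam * v 0 * v 1 * v 2 = 0 := by
  obtain ⟨c, hc, rfl⟩ := h
  have hP := (E.eval_poly _).symm.trans P.2
  simp only [Pi.smul_apply, smul_eq_mul, Point.coords]
  linear_combination c ^ 3 * hP

lemma exists_smul (h : IsCoord P v) (h' : IsCoord P w) : ∃ c : L, c ≠ 0 ∧ w = c • v := by
  obtain ⟨c, hc, rfl⟩ := h
  obtain ⟨d, hd, rfl⟩ := h'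
  exact ⟨d / c, div_ne_zero hd hc, by rw [smul_smul, div_mul_cancel₀ _ hc]⟩

lemma smul (h : IsCoord P v) {c : L} (hc : c ≠ 0) : IsCoord P (c • v) := by
  obtain ⟨d, hd, rfl⟩ := h
  exact ⟨c * d, mul_ne_zero hc hd, by rw [smul_smul]⟩

lemma of_smul {c : L} (hc : c ≠ 0) (h : IsCoord P (c • v)) : IsCoord P v := by
  have := h.smul (inv_ne_zero hc)
  rwa [inv_smul_smul₀ hc] at this

lemma mk_eq (h : IsCoord P v) : Point.mk v h.ne_zero h.equation = P := by
  refine Subtype.ext ?_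
  obtain ⟨c, hc, rfl⟩ := h
  change Projectivization.mk L _ _ = P.1
  conv_rhs => rw [← P.1.mk_rep]
  exact (Projectivization.mk_eq_mk_iff' _ _ _ _ _).2 ⟨c, rfl⟩

lemma eq (h : IsCoord P v) (h' : IsCoord Q v) : P = Q := by
  rw [← h.mk_eq, ← h'.mk_eq]

end IsCoord

lemma isCoord_zero : IsCoord (0 : E.Point) ![1, -1, 0] :=
  isCoord_mk (E := E) (fun h => one_ne_zero (congrFun h 0)) (by simp; ring)

lemma isCoord_pointS (ζ : L) (hζ : ζ ^ 3 = 1) : IsCoord (E.pointS ζ hζ) ![1, -ζ, 0] :=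
  isCoord_mk _ _

lemma isCoord_pointT : IsCoord E.pointT ![1, 0, -1] := isCoord_mk _ _

/-! ### The group law in homogeneous coordinates -/

lemma nine_ne_zero (E : HesseCubic L) : (9 : L) ≠ 0 := by
  have h := pow_ne_zero 2 E.three_ne_zero
  norm_num at h
  exact h

open Classical in
lemma ofWeierstrass_add (p q : E.weierstrass.Point) :
    E.ofWeierstrass (p + q) = E.ofWeierstrass p + E.ofWeierstrass q := by
  have h : ∀ p, E.weierstrassEquiv (E.ofWeierstrass p) = p :=
    fun p => E.weierstrassEquiv.apply_symm_apply p
  change _ = E.ofWeierstrass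
    (E.weierstrassEquiv (E.ofWeierstrass p) + E.weierstrassEquiv (E.ofWeierstrass q))
  rw [h, h]

lemma ofWeierstrass_neg (p : E.weierstrass.Point) :
    -E.ofWeierstrass p = E.ofWeierstrass (-p) := by
  classical
  refine neg_eq_of_add_eq_zero_right ?_
  rw [← ofWeierstrass_add, add_neg_cancel]
  rfl

/-- The coordinates `(1 : -1 : 0)` or `affineCoords x y` of the image of a Weierstrass point. -/
def weierstrassCoords (E : HesseCubic L) : E.weierstrass.Point → Fin 3 → L
  | .zero => ![1, -1, 0]
  | .some x y _ => E.affineCoords x y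

lemma isCoord_ofWeierstrass (p : E.weierstrass.Point) :
    IsCoord (E.ofWeierstrass p) (E.weierstrassCoords p) := by
  cases p
  · exact isCoord_zero
  · next h => exact isCoord_mk (E.affineCoords_ne_zero _ _) ((E.equation_iff _ _).1 h.1)

/-- A form of the addition law of bidegree `(2, 2)`. It fails, with all coordinates zero, when the
difference of the two points lies in the subgroup `Z = 0`. -/
def addVec (a b : Fin 3 → L) : Fin 3 → L :=
  ![a 1 ^ 2 * b 0 * b 2 - b 1 ^ 2 * a 0 * a 2, a 0 ^ 2 * b 1 * b 2 - b 0 ^ 2 * a 1 * a 2,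
    a 2 ^ 2 * b 0 * b 1 - b 2 ^ 2 * a 0 * a 1]

lemma addVec_smul (c d : L) (a b : Fin 3 → L) :
    addVec (c • a) (d • b) = (c * d) ^ 2 • addVec a b := by
  funext i
  fin_cases i <;> simp [addVec] <;> ring

/-- The chord through two points with coordinates normalised by `3X + 3Y - lam Z = 1`: the
abscissa that the slope formula gives is that of `addVec`. -/
lemma addVec_abscissa (E : HesseCubic L) {X Y Z X' Y' Z' s : L} (hX : 3 * X + 3 * Y - E.lam * Z = 1)
    (hX' : 3 * X' + 3 * Y' - E.lam * Z' = 1)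
    (hF : X ^ 3 + Y ^ 3 + Z ^ 3 + E.lam * X * Y * Z = 0)
    (hF' : X' ^ 3 + Y' ^ 3 + Z' ^ 3 + E.lam * X' * Y' * Z' = 0) (hZ : Z ≠ Z')
    (hs : s * (Z - Z') = -(Y - Y')) :
    (s ^ 2 + E.lam / 3 * s + E.lam ^ 2 / 9 + E.k * Z + E.k * Z') *
      (3 * (Y ^ 2 * X' * Z' - Y' ^ 2 * X * Z) + 3 * (X ^ 2 * Y' * Z' - X' ^ 2 * Y * Z) -
        E.lam * (Z ^ 2 * X' * Y' - Z' ^ 2 * X * Y)) =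
      -E.k * (Z ^ 2 * X' * Y' - Z' ^ 2 * X * Y) := by
  have h3 := E.three_ne_zero
  have h27 := E.ne27
  have h9 := E.nine_ne_zero
  refine mul_left_cancel₀ (mul_ne_zero h27 (pow_ne_zero 2 (sub_ne_zero.2 hZ))) ?_
  obtain rfl : X = (1 + E.lam * Z) / 3 - Y := by field_simp; linear_combination hX
  obtain rfl : X' = (1 + E.lam * Z') / 3 - Y' := by field_simp; linear_combination hX'
  have hk := E.k_spec
  set ell := 3 * (Y ^ 2 * ((1 + E.lam * Z') / 3 - Y') * Z' -
      Y' ^ 2 * ((1 + E.lam * Z) / 3 - Y) * Z) +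
    3 * (((1 + E.lam * Z) / 3 - Y) ^ 2 * Y' * Z' - ((1 + E.lam * Z') / 3 - Y') ^ 2 * Y * Z) -
    E.lam * (Z ^ 2 * ((1 + E.lam * Z') / 3 - Y') * Y' -
      Z' ^ 2 * ((1 + E.lam * Z) / 3 - Y) * Y) with hell
  set N := Z ^ 2 * ((1 + E.lam * Z') / 3 - Y') * Y' - Z' ^ 2 * ((1 + E.lam * Z) / 3 - Y) * Y with hN
  generalize E.lam = l at *
  generalize E.k = k at *
  -- the claim with `k` and the slope `s` eliminated
  have key : (27 * (Y - Y') ^ 2 - 9 * l * (Y - Y') * (Z - Z') +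
      (3 * l ^ 2 + (l ^ 3 + 27) * (Z + Z')) * (Z - Z') ^ 2) * ell +
      (l ^ 3 + 27) * N * (Z - Z') ^ 2 = 0 := by
    rw [hell, hN]
    linear_combination (norm := (field_simp; ring)) (27 * Y^2 * Z' + 54 * Y * Y' * Z +
      (-108) * Y * Y' * Z' + (-18) * Y * Z * Z' * l + (-9) * Y * Z + 18 * Y * Z'^2 * l +
      9 * Y * Z' + (-135) * Y'^2 * Z + 135 * Y'^2 * Z' + (-9) * Y' * Z^2 * l +
      63 * Y' * Z * Z' * l + 36 * Y' * Z + (-45) * Y' * Z'^2 * l + (-27) * Y' * Z' +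
      (-3) * Z * Z'^3 * l^3 + (-81) * Z * Z'^3 + (-9) * Z * Z'^2 * l^2 + (-9) * Z * Z' * l +
      (-3) * Z + 2 * Z'^4 * l^3 + 54 * Z'^4 + 6 * Z'^3 * l^2 + 6 * Z'^2 * l + 2 * Z') * hF +
      (108 * Y * Y' * Z + (-54) * Y * Y' * Z' + (-18) * Y * Z * Z' * l + (-18) * Y * Z +
      9 * Y * Z'^2 * l + 9 * Y * Z' + (-27) * Y'^2 * Z + (-18) * Y' * Z^2 * l +
      18 * Y' * Z * Z' * l + (-9) * Y' * Z + 9 * Y' * Z' + 3 * Z^4 * l^3 + 81 * Z^4 +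
      (-2) * Z^3 * Z' * l^3 + (-54) * Z^3 * Z' + 9 * Z^3 * l^2 + (-6) * Z^2 * Z' * l^2 +
      9 * Z^2 * l + (-6) * Z * Z' * l + 3 * Z + (-2) * Z') * hF'
  linear_combination (norm := (field_simp; ring)) key + ell * (27 * (s * (Z - Z') - (Y - Y')) +
    9 * l * (Z - Z')) * hs + (Z - Z') ^ 2 * ((Z + Z') * ell + N) * hk

open Classical in
/-- The addition law for two points with different abscissas on the Weierstrass curve. -/
lemma isCoord_ofWeierstrass_add {x₁ y₁ x₂ y₂ : L} (h₁ : E.weierstrass.Nonsingular x₁ y₁)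
    (h₂ : E.weierstrass.Nonsingular x₂ y₂) (hx : x₁ ≠ x₂)
    (hN : addVec (E.affineCoords x₁ y₁) (E.affineCoords x₂ y₂) ≠ 0) :
    IsCoord (E.ofWeierstrass (.some x₁ y₁ h₁ + .some x₂ y₂ h₂))
      (addVec (E.affineCoords x₁ y₁) (E.affineCoords x₂ y₂)) := by
  have h3 := E.three_ne_zero
  have hk := E.k_ne_zero
  have h9 := E.nine_ne_zero
  rw [WeierstrassCurve.Affine.Point.add_of_X_ne hx]
  generalize_proofs h₃
  revert h₃
  set s := E.weierstrass.slope x₁ x₂ y₁ y₂ with hs_def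
  have hs : s * (x₁ - x₂) = y₁ - y₂ := by
    rw [hs_def, WeierstrassCurve.Affine.slope_of_X_ne hx, div_mul_cancel₀ _ (sub_ne_zero.2 hx)]
  set a := E.affineCoords x₁ y₁ with ha
  set b := E.affineCoords x₂ y₂ with hb
  have ha1 : y₁ = E.k * a 1 := by simp [ha, affineCoords, mul_div_cancel₀ _ hk]
  have ha2 : x₁ = -E.k * a 2 := by simp [ha, affineCoords, mul_div_cancel₀ _ hk]
  have hb1 : y₂ = E.k * b 1 := by simp [hb, affineCoords, mul_div_cancel₀ _ hk]
  have hb2 : x₂ = -E.k * b 2 := by simp [hb, affineCoords, mul_div_cancel₀ _ hk]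
  have hal : 3 * a 0 + 3 * a 1 - E.lam * a 2 = 1 := E.affineCoords_line x₁ y₁
  have hbl : 3 * b 0 + 3 * b 1 - E.lam * b 2 = 1 := E.affineCoords_line x₂ y₂
  have hF : a 0 ^ 3 + a 1 ^ 3 + a 2 ^ 3 + E.lam * a 0 * a 1 * a 2 = 0 :=
    (E.equation_iff x₁ y₁).1 h₁.1
  have hF' : b 0 ^ 3 + b 1 ^ 3 + b 2 ^ 3 + E.lam * b 0 * b 1 * b 2 = 0 :=
    (E.equation_iff x₂ y₂).1 h₂.1
  have hZ : a 2 ≠ b 2 := fun h => hx (by rw [ha2, hb2, h])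
  have hs' : s * (a 2 - b 2) = -(a 1 - b 1) := by
    refine mul_left_cancel₀ hk ?_
    linear_combination -hs + s * ha2 - s * hb2 - ha1 + hb1
  clear_value a b s
  set x₃ := E.weierstrass.addX x₁ x₂ s with hx₃
  set y₃ := E.weierstrass.addY x₁ x₂ y₁ s with hy₃
  have hx₃' : x₃ = s ^ 2 + E.lam / 3 * s + E.lam ^ 2 / 9 + E.k * a 2 + E.k * b 2 := by
    rw [hx₃, WeierstrassCurve.Affine.addX]
    simp only [weierstrass, ha2, hb2]
    ring
  have hy₃' : y₃ = -(s * (x₃ - x₁) + y₁) - E.lam / 3 * x₃ + E.k / 3 := by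
    rw [hy₃, WeierstrassCurve.Affine.addY, WeierstrassCurve.Affine.negAddY,
      WeierstrassCurve.Affine.negY, ← hx₃]
    simp only [weierstrass]
    ring
  clear_value x₃ y₃
  intro h₃
  -- `m` is the value of `3X + 3Y - lam Z` at the sum
  set m := 3 * addVec a b 0 + 3 * addVec a b 1 - E.lam * addVec a b 2 with hm
  have e2 : x₃ * m = -E.k * addVec a b 2 := by
    rw [hm, hx₃']
    simp only [addVec, Matrix.cons_val]
    exact E.addVec_abscissa hal hbl hF hF' hZ hs'
  have e1 : y₃ * m = E.k * addVec a b 1 := by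
    refine mul_right_cancel₀ (sub_ne_zero.2 hZ) ?_
    -- the sum, reflected by exchanging `X` and `Y`, is collinear with the two points
    have hdet : (a 1 - b 1) * (a 2 * m - addVec a b 2) +
        (a 2 - b 2) * (addVec a b 0 - a 1 * m) = 0 := by
      have key : a 0 = (1 + E.lam * a 2) / 3 - a 1 := by field_simp; linear_combination hal
      have key' : b 0 = (1 + E.lam * b 2) / 3 - b 1 := by field_simp; linear_combination hbl
      rw [hm]
      simp only [addVec, Matrix.cons_val]
      rw [key, key']
      field_simp
      ring
    have h0 : addVec a b 0 = m / 3 + E.lam / 3 * addVec a b 2 - addVec a b 1 := by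
      field_simp
      linear_combination -hm
    rw [h0] at hdet
    rw [hy₃', ha1, ha2]
    linear_combination (-s * (a 2 - b 2) - E.lam / 3 * (a 2 - b 2)) * e2 +
      E.k * (addVec a b 2 - m * a 2) * hs' + E.k * hdet
  have hm0 : m ≠ 0 := by
    intro h0
    rw [h0, mul_zero] at e1 e2
    have z2 : addVec a b 2 = 0 := by
      have := e2.symm
      simpa [hk] using this
    have z1 : addVec a b 1 = 0 := by
      have := e1.symm
      simpa [hk] using this
    have z0 : addVec a b 0 = 0 := by
      rw [h0, z1, z2] at hm
      have : (3 : L) * addVec a b 0 = 0 := by linear_combination -hm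
      exact (mul_eq_zero.1 this).resolve_left h3
    refine hN (funext fun i => ?_)
    fin_cases i
    exacts [z0, z1, z2]
  have hfin : addVec a b = m • E.affineCoords x₃ y₃ := by
    have c0 := E.affineCoords_line x₃ y₃
    have c1 : E.affineCoords x₃ y₃ 1 = y₃ / E.k := rfl
    have c2 : E.affineCoords x₃ y₃ 2 = -x₃ / E.k := rfl
    have d1 : addVec a b 1 = m * E.affineCoords x₃ y₃ 1 := by
      rw [c1]; field_simp; linear_combination -e1
    have d2 : addVec a b 2 = m * E.affineCoords x₃ y₃ 2 := by
      rw [c2]; field_simp; linear_combination e2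
    have d0 : addVec a b 0 = m * E.affineCoords x₃ y₃ 0 := by
      refine mul_left_cancel₀ h3 ?_
      linear_combination -hm - m * c0 - 3 * d1 + E.lam * d2
    funext i
    fin_cases i
    exacts [d0, d1, d2]
  rw [hfin]
  exact IsCoord.smul (isCoord_ofWeierstrass (.some x₃ y₃ h₃)) hm0

open Classical in
/-- The addition law, wherever `addVec` gives a nonzero vector. -/
theorem IsCoord.add {P Q : E.Point} {a b : Fin 3 → L} (ha : IsCoord P a) (hb : IsCoord Q b)
    (hN : addVec a b ≠ 0) : IsCoord (P + Q) (addVec a b) := by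
  obtain ⟨p, rfl⟩ := E.ofWeierstrass_bijective.2 P
  obtain ⟨q, rfl⟩ := E.ofWeierstrass_bijective.2 Q
  obtain ⟨c, hc, rfl⟩ := (isCoord_ofWeierstrass p).exists_smul ha
  obtain ⟨d, hd, rfl⟩ := (isCoord_ofWeierstrass q).exists_smul hb
  rw [addVec_smul] at hN ⊢
  have hN := (smul_ne_zero_iff.1 hN).2
  refine IsCoord.smul ?_ (pow_ne_zero 2 (mul_ne_zero hc hd))
  rw [← ofWeierstrass_add]
  have hk := E.k_ne_zero
  have h3 := E.three_ne_zero
  rcases p with _ | ⟨x₁, y₁, h₁⟩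
  · have : addVec ![1, -1, 0] (E.weierstrassCoords q) =
        (E.weierstrassCoords q 2) • E.weierstrassCoords q := by
      funext i
      fin_cases i <;> simp [addVec] <;> ring
    rw [weierstrassCoords.eq_1, this] at hN ⊢
    rw [← WeierstrassCurve.Affine.Point.zero_def, zero_add]
    exact (isCoord_ofWeierstrass q).smul (smul_ne_zero_iff.1 hN).1
  rcases q with _ | ⟨x₂, y₂, h₂⟩
  · have : addVec (E.weierstrassCoords (.some x₁ y₁ h₁)) ![1, -1, 0] =
        (-E.weierstrassCoords (.some x₁ y₁ h₁) 2) • E.weierstrassCoords (.some x₁ y₁ h₁) := by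
      funext i
      fin_cases i <;> simp [addVec] <;> ring
    rw [weierstrassCoords.eq_1, this] at hN ⊢
    rw [← WeierstrassCurve.Affine.Point.zero_def, add_zero]
    exact (isCoord_ofWeierstrass _).smul (smul_ne_zero_iff.1 hN).1
  rw [weierstrassCoords.eq_2, weierstrassCoords.eq_2] at hN ⊢
  by_cases hx : x₁ = x₂
  · subst hx
    by_cases hy : y₁ = E.weierstrass.negY x₁ y₂
    · rw [WeierstrassCurve.Affine.Point.add_of_Y_eq rfl hy]
      set a := E.affineCoords x₁ y₁ with ha
      set b := E.affineCoords x₁ y₂ with hb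
      have e2 : a 2 = b 2 := rfl
      have e1 : a 1 = b 0 := by
        simp only [ha, hb, affineCoords, Matrix.cons_val, hy, WeierstrassCurve.Affine.negY,
          weierstrass]
        field_simp
        ring
      have e0 : a 0 = b 1 := by
        have h1 : 3 * a 0 + 3 * a 1 - E.lam * a 2 = 1 := E.affineCoords_line x₁ y₁
        have h2 : 3 * b 0 + 3 * b 1 - E.lam * b 2 = 1 := E.affineCoords_line x₁ y₂
        refine mul_left_cancel₀ h3 ?_
        linear_combination h1 - h2 - 3 * e1 + E.lam * e2
      have : addVec a b = (addVec a b 0) • ![1, -1, 0] := by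
        funext i
        fin_cases i
        · simp
        · simp [addVec, e0, e1, e2]
        · simp [addVec, e0, e1, e2]
          ring
      rw [this] at hN ⊢
      exact isCoord_zero.smul (smul_ne_zero_iff.1 hN).1
    · -- for equal points `addVec` is zero
      obtain rfl : y₁ = y₂ :=
        WeierstrassCurve.Affine.Y_eq_of_Y_ne h₁.1 h₂.1 rfl hy
      refine (hN ?_).elim
      funext i
      fin_cases i <;> simp [addVec]
  · exact isCoord_ofWeierstrass_add h₁ h₂ hx hN

theorem IsCoord.neg {P : E.Point} {a : Fin 3 → L} (ha : IsCoord P a) :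
    IsCoord (-P) ![a 1, a 0, a 2] := by
  classical
  have h3 := E.three_ne_zero
  have hk := E.k_ne_zero
  obtain ⟨p, rfl⟩ := E.ofWeierstrass_bijective.2 P
  rw [ofWeierstrass_neg]
  obtain ⟨c, hc, rfl⟩ := (isCoord_ofWeierstrass p).exists_smul ha
  have h := (isCoord_ofWeierstrass (-p))
  rcases p with _ | ⟨x, y, hxy⟩
  · convert h.smul (neg_ne_zero.2 hc) using 1
    funext i
    fin_cases i <;> simp [weierstrassCoords, ← WeierstrassCurve.Affine.Point.zero_def]
  · convert h.smul hc using 1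
    rw [WeierstrassCurve.Affine.Point.neg_some]
    simp only [weierstrassCoords]
    funext i
    fin_cases i
    · simp [affineCoords, WeierstrassCurve.Affine.negY, weierstrass]
      left
      field_simp
      ring
    · simp [affineCoords, WeierstrassCurve.Affine.negY, weierstrass]
      left
      field_simp
      ring
    · simp [affineCoords]

/-! ### Translations by 3-torsion points, and multiplication by 3 -/

lemma lam_add_three_ne_zero (E : HesseCubic L) : E.lam + 3 ≠ 0 := fun h =>
  E.smooth (by linear_combination (E.lam ^ 2 - 3 * E.lam + 9) * h)

open Classical in
/-- The tangent at the flex `T` meets the cubic only at `T`. This is the one duplication which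
`addVec` cannot reach, so it is read off from the Weierstrass model. -/
lemma pointT_add_self : E.pointT + E.pointT = -E.pointT := by
  have h3 := E.three_ne_zero
  have hl := E.lam_add_three_ne_zero
  have hk := E.k_ne_zero
  have hks := E.k_spec
  have h9 := E.nine_ne_zero
  obtain ⟨p, hp⟩ := E.ofWeierstrass_bijective.2 E.pointT
  have hc := isCoord_ofWeierstrass p
  rw [hp] at hc
  obtain ⟨c, hc0, hc⟩ := isCoord_pointT.exists_smul hc
  rw [← hp, ofWeierstrass_neg, ← ofWeierstrass_add]
  congr 1
  rcases p with _ | ⟨x, y, h⟩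
  · have := congrFun hc 1
    simp [weierstrassCoords] at this
  have l1 := E.affineCoords_line x y
  rw [weierstrassCoords] at hc
  have e0 := congrFun hc 0
  have e1 := congrFun hc 1
  have e2 := congrFun hc 2
  rw [e0, e1, e2] at l1
  obtain rfl : y = 0 := by simpa [affineCoords, hk] using e1
  have hx : x * (E.lam + 3) = E.k := by
    have e2' : x = E.k * c := by
      simp [affineCoords] at e2
      field_simp at e2
      linear_combination -e2
    simp at l1
    rw [e2']
    linear_combination E.k * l1
  have hx0 : x ≠ 0 := fun h => hk (by rw [← hx, h, zero_mul])
  have hx27 : 27 * x = E.lam ^ 2 - 3 * E.lam + 9 := by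
    refine mul_right_cancel₀ hl ?_
    linear_combination 27 * hx + hks
  have hnegY : E.weierstrass.negY x 0 = x := by
    simp only [WeierstrassCurve.Affine.negY, weierstrass]
    field_simp
    linear_combination -hx
  have hy : (0 : L) ≠ E.weierstrass.negY x 0 := by rw [hnegY]; exact hx0.symm
  have hs : E.weierstrass.slope x x 0 0 = -1 := by
    rw [WeierstrassCurve.Affine.slope_of_Y_ne rfl hy, hnegY]
    simp only [weierstrass]
    rw [div_eq_iff (by simpa using hx0)]
    refine mul_left_cancel₀ h9 ?_
    field_simp
    linear_combination -3 * E.lam * hx + 3 * x * hx27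
  have hX : E.weierstrass.addX x x (-1) = x := by
    simp only [WeierstrassCurve.Affine.addX, weierstrass]
    refine mul_left_cancel₀ h9 ?_
    field_simp
    linear_combination -3 * hx27
  rw [WeierstrassCurve.Affine.Point.add_of_Y_ne hy, WeierstrassCurve.Affine.Point.neg_some]
  have hY : E.weierstrass.addY x x 0 (-1) = E.weierstrass.negY x 0 := by
    rw [WeierstrassCurve.Affine.addY, WeierstrassCurve.Affine.negAddY, hX, sub_self, mul_zero,
      zero_add]
  congr 1
  · rw [hs, hX]
  · rw [hs, hY]

lemma isCoord_neg_pointT : IsCoord (-E.pointT) ![0, 1, -1] := by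
  simpa using isCoord_pointT.neg (E := E)

/-- Translation by `-T`, where `addVec` applies. -/
lemma IsCoord.add_neg_pointT_of_ne {P : E.Point} {a : Fin 3 → L} (ha : IsCoord P a)
    (h0 : a 0 ≠ 0) : IsCoord (P + -E.pointT) ![a 2, a 0, a 1] := by
  have e : addVec a ![0, 1, -1] = (-a 0) • ![a 2, a 0, a 1] := by
    funext i
    fin_cases i <;> simp [addVec] <;> ring
  have hne : ![a 2, a 0, a 1] ≠ 0 := fun h => h0 (congrFun h 1)
  have := ha.add isCoord_neg_pointT (e ▸ smul_ne_zero (neg_ne_zero.2 h0) hne)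
  rw [e] at this
  exact this.of_smul (neg_ne_zero.2 h0)

/-- If two coordinates of a point vanish, so does the third. -/
lemma IsCoord.eq_zero_of {P : E.Point} {a : Fin 3 → L} (ha : IsCoord P a) {i j : Fin 3}
    (hij : i ≠ j) (hi : a i = 0) (hj : a j = 0) : False := by
  have h := ha.equation
  refine ha.ne_zero (funext fun m => ?_)
  fin_cases i <;> fin_cases j <;> simp_all <;> fin_cases m <;> simp_all

/-- Translation by `T` permutes the coordinates cyclically. -/
theorem IsCoord.add_pointT {P : E.Point} {a : Fin 3 → L} (ha : IsCoord P a) :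
    IsCoord (P + E.pointT) ![a 1, a 2, a 0] := by
  by_cases h1 : a 1 = 0
  · -- here `addVec` fails, and `-2T` is added instead
    have h0 : a 0 ≠ 0 := fun h => ha.eq_zero_of (by decide : (0 : Fin 3) ≠ 1) h h1
    have h2 : a 2 ≠ 0 := fun h => ha.eq_zero_of (by decide : (2 : Fin 3) ≠ 1) h h1
    have e : P + E.pointT = P + -E.pointT + -E.pointT := by
      rw [add_assoc, ← neg_add, E.pointT_add_self, neg_neg]
    rw [e]
    exact (ha.add_neg_pointT_of_ne h0).add_neg_pointT_of_ne h2
  · have e : addVec a ![1, 0, -1] = (-a 1) • ![a 1, a 2, a 0] := by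
      funext i
      fin_cases i <;> simp [addVec] <;> ring
    have hne : ![a 1, a 2, a 0] ≠ 0 := fun h => h1 (congrFun h 0)
    have := ha.add isCoord_pointT (e ▸ smul_ne_zero (neg_ne_zero.2 h1) hne)
    rw [e] at this
    exact this.of_smul (neg_ne_zero.2 h1)

lemma three_nsmul_pointT : 3 • E.pointT = 0 := by
  have := E.pointT_add_self
  rw [show 3 • E.pointT = E.pointT + E.pointT + E.pointT by abel, this, neg_add_cancel]

lemma IsCoord.add_neg_pointT {P : E.Point} {a : Fin 3 → L} (ha : IsCoord P a) :
    IsCoord (P + -E.pointT) ![a 2, a 0, a 1] := by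
  have e : P + -E.pointT = P + E.pointT + E.pointT := by
    rw [add_assoc, E.pointT_add_self]
  rw [e]
  exact ha.add_pointT.add_pointT

/-- Translation by `S` multiplies the coordinates by `1, ζ, ζ²`. -/
theorem IsCoord.add_pointS {ζ : L} (hζ : ζ ^ 3 = 1) {P : E.Point} {a : Fin 3 → L}
    (ha : IsCoord P a) : IsCoord (P + E.pointS ζ hζ) ![a 0, ζ * a 1, ζ ^ 2 * a 2] := by
  have hζ0 : ζ ≠ 0 := by
    rintro rfl
    simp at hζ
  by_cases h2 : a 2 = 0
  · -- here `addVec` fails, and `(P + T) + (S - T)` is computed instead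
    have h0 : a 0 ≠ 0 := fun h => ha.eq_zero_of (by decide : (0 : Fin 3) ≠ 2) h h2
    have h1 : a 1 ≠ 0 := fun h => ha.eq_zero_of (by decide : (1 : Fin 3) ≠ 2) h h2
    have hne : ![a 0, ζ * a 1, ζ ^ 2 * a 2] ≠ 0 := fun h => h0 (congrFun h 0)
    have e : addVec ![a 1, a 2, a 0] ![0, 1, -ζ] = (-a 1) • ![a 0, ζ * a 1, ζ ^ 2 * a 2] := by
      funext i
      fin_cases i <;> simp [addVec, h2] <;> ring
    have hS := (isCoord_pointS (E := E) ζ hζ).add_neg_pointT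
    have := ha.add_pointT.add hS (by
      simpa using e ▸ smul_ne_zero (neg_ne_zero.2 h1) hne)
    rw [show P + E.pointT + (E.pointS ζ hζ + -E.pointT) = P + E.pointS ζ hζ by abel] at this
    simp only [Matrix.cons_val] at this
    rw [e] at this
    exact this.of_smul (neg_ne_zero.2 h1)
  · have e : addVec a ![1, -ζ, 0] = (-(ζ ^ 2 * a 2)) • ![a 0, ζ * a 1, ζ ^ 2 * a 2] := by
      funext i
      fin_cases i
      · simp [addVec]; ring
      · simp [addVec]; linear_combination -a 1 * a 2 * hζ
      · simp [addVec]; linear_combination -a 2 ^ 2 * ζ * hζ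
    have hc : -(ζ ^ 2 * a 2) ≠ 0 := neg_ne_zero.2 (mul_ne_zero (pow_ne_zero 2 hζ0) h2)
    have hne : ![a 0, ζ * a 1, ζ ^ 2 * a 2] ≠ 0 := fun h =>
      mul_ne_zero (pow_ne_zero 2 hζ0) h2 (congrFun h 2)
    have := ha.add (isCoord_pointS ζ hζ) (e ▸ smul_ne_zero hc hne)
    rw [e] at this
    exact this.of_smul hc

/-- The duplication formula. -/
def dblVec (a : Fin 3 → L) : Fin 3 → L :=
  ![a 1 * (a 2 ^ 3 - a 0 ^ 3), a 0 * (a 1 ^ 3 - a 2 ^ 3), a 2 * (a 0 ^ 3 - a 1 ^ 3)]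

lemma IsCoord.dblVec_ne_zero {P : E.Point} {a : Fin 3 → L} (ha : IsCoord P a) :
    dblVec a ≠ 0 := by
  intro h
  have hF := ha.equation
  have e0 : a 1 * (a 2 ^ 3 - a 0 ^ 3) = 0 := congrFun h 0
  have e1 : a 0 * (a 1 ^ 3 - a 2 ^ 3) = 0 := congrFun h 1
  have e2 : a 2 * (a 0 ^ 3 - a 1 ^ 3) = 0 := congrFun h 2
  have n01 := fun h h' => ha.eq_zero_of (by decide : (0 : Fin 3) ≠ 1) h h'
  have n02 := fun h h' => ha.eq_zero_of (by decide : (0 : Fin 3) ≠ 2) h h'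
  have n12 := fun h h' => ha.eq_zero_of (by decide : (1 : Fin 3) ≠ 2) h h'
  by_cases h0 : a 0 = 0
  · simp only [h0] at e0
    have : a 1 ≠ 0 := n01 h0
    have : a 2 ≠ 0 := n02 h0
    simp_all
  by_cases h1 : a 1 = 0
  · have : a 2 ≠ 0 := n12 h1
    simp_all
  by_cases h2 : a 2 = 0
  · simp_all
  have f0 := (mul_eq_zero.1 e0).resolve_left h1
  have f1 := (mul_eq_zero.1 e1).resolve_left h0
  -- `X³ = Y³ = Z³ = c` gives `3c = -lam XYZ`, so `27 c³ = -lam³ c³`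
  have : (E.lam ^ 3 + 27) * (a 0 ^ 3) ^ 3 = 0 := by
    have g1 : a 1 ^ 3 = a 0 ^ 3 := by linear_combination f0 + f1
    have g2 : a 2 ^ 3 = a 0 ^ 3 := by linear_combination f0
    have g : E.lam * a 0 * a 1 * a 2 = -3 * a 0 ^ 3 := by linear_combination hF - g1 - g2
    have g3 : (E.lam * a 0 * a 1 * a 2) ^ 3 = E.lam ^ 3 * (a 0 ^ 3) ^ 3 := by
      rw [show (E.lam * a 0 * a 1 * a 2) ^ 3 = E.lam ^ 3 * a 0 ^ 3 * a 1 ^ 3 * a 2 ^ 3 by ring,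
        g1, g2]
      ring
    rw [g] at g3
    linear_combination -g3
  exact (mul_ne_zero E.smooth (pow_ne_zero 3 (pow_ne_zero 3 h0))) this

/-- The double of `P` as `(P + T) + (P - T)`, since `addVec` fails for equal points. -/
theorem IsCoord.dbl {P : E.Point} {a : Fin 3 → L} (ha : IsCoord P a) :
    IsCoord (P + P) (dblVec a) := by
  have e : addVec ![a 1, a 2, a 0] ![a 2, a 0, a 1] = dblVec a := by
    funext i
    fin_cases i <;> simp [addVec, dblVec] <;> ring
  have := ha.add_pointT.add ha.add_neg_pointT (e ▸ ha.dblVec_ne_zero)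
  rwa [e, show P + E.pointT + (P + -E.pointT) = P + P by abel] at this

/-- The triplication formula. -/
def triVec (a : Fin 3 → L) : Fin 3 → L :=
  ![a 0 ^ 6 * a 1 ^ 3 + a 1 ^ 6 * a 2 ^ 3 + a 2 ^ 6 * a 0 ^ 3 - 3 * (a 0 * a 1 * a 2) ^ 3,
    a 0 ^ 6 * a 2 ^ 3 + a 1 ^ 6 * a 0 ^ 3 + a 2 ^ 6 * a 1 ^ 3 - 3 * (a 0 * a 1 * a 2) ^ 3,
    a 0 * a 1 * a 2 * (a 0 ^ 6 + a 1 ^ 6 + a 2 ^ 6 - a 0 ^ 3 * a 1 ^ 3 - a 1 ^ 3 * a 2 ^ 3 -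
      a 2 ^ 3 * a 0 ^ 3)]

/-- The tangent at the origin, pulled back by multiplication by `3`. -/
lemma IsCoord.lineO_triVec {P : E.Point} {a : Fin 3 → L} (ha : IsCoord P a) :
    3 * triVec a 0 + 3 * triVec a 1 - E.lam * triVec a 2 =
      -(E.lam ^ 3 + 27) * (a 0 * a 1 * a 2) ^ 3 := by
  have h := ha.equation
  simp only [triVec, Matrix.cons_val]
  linear_combination ((-1) * a 0 ^ 4 * a 1 * a 2 * E.lam + 3 * a 0 ^ 3 * a 1 ^ 3 +
    3 * a 0 ^ 3 * a 2 ^ 3 + a 0 ^ 2 * a 1 ^ 2 * a 2 ^ 2 * E.lam ^ 2 -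
    a 0 * a 1 ^ 4 * a 2 * E.lam - a 0 * a 1 * a 2 ^ 4 * E.lam + 3 * a 1 ^ 3 * a 2 ^ 3) * h

lemma IsCoord.triVec_ne_zero {P : E.Point} {a : Fin 3 → L} (ha : IsCoord P a) :
    triVec a ≠ 0 := by
  intro h
  have hO := ha.lineO_triVec
  rw [h] at hO
  have ht : a 0 * a 1 * a 2 = 0 := by
    refine pow_eq_zero_iff (n := 3) (by norm_num) |>.1 (mul_left_cancel₀ E.smooth ?_)
    simp only [Pi.zero_apply] at hO
    linear_combination hO
  have e0 : triVec a 0 = 0 := congrFun h 0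
  have n01 := fun h h' => ha.eq_zero_of (by decide : (0 : Fin 3) ≠ 1) h h'
  have n02 := fun h h' => ha.eq_zero_of (by decide : (0 : Fin 3) ≠ 2) h h'
  have n12 := fun h h' => ha.eq_zero_of (by decide : (1 : Fin 3) ≠ 2) h h'
  simp only [triVec, Matrix.cons_val] at e0
  rcases mul_eq_zero.1 ht with ht | h2
  · rcases mul_eq_zero.1 ht with h0 | h1
    · have : a 1 ≠ 0 := n01 h0
      have : a 2 ≠ 0 := n02 h0
      simp_all
    · have : a 2 ≠ 0 := n12 h1
      have : a 0 ≠ 0 := fun h => n01 h h1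
      simp_all
  · have : a 0 ≠ 0 := fun h => n02 h h2
    have : a 1 ≠ 0 := fun h => n12 h h2
    simp_all

/-- The triple of `P` as `2P + P` or, where `addVec` fails, as `(2P - T) + (P + T)`. -/
theorem IsCoord.three_nsmul {P : E.Point} {a : Fin 3 → L} (ha : IsCoord P a) :
    IsCoord (3 • P) (triVec a) := by
  have e0 : addVec (dblVec a) a = a 2 • triVec a := by
    funext i
    fin_cases i <;> simp [addVec, dblVec, triVec] <;> ring
  have e1 : addVec ![dblVec a 2, dblVec a 0, dblVec a 1] ![a 1, a 2, a 0] = a 0 • triVec a := by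
    funext i
    fin_cases i <;> simp [addVec, dblVec, triVec] <;> ring
  have hne := ha.triVec_ne_zero
  by_cases h2 : a 2 = 0
  · have h0 : a 0 ≠ 0 := fun h => ha.eq_zero_of (by decide : (0 : Fin 3) ≠ 2) h h2
    have := ha.dbl.add_neg_pointT.add ha.add_pointT (e1 ▸ smul_ne_zero h0 hne)
    rw [e1, show P + P + -E.pointT + (P + E.pointT) = 3 • P by abel] at this
    exact this.of_smul h0
  · have := ha.dbl.add ha (e0 ▸ smul_ne_zero h2 hne)
    rw [e0, show P + P + P = 3 • P by abel] at this
    exact this.of_smul h2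

/-! ### Triplication in terms of the tangent lines, and the 3-torsion -/

lemma sq_add_self_add_one (hζ : IsPrimitiveRoot ζ 3) : ζ ^ 2 + ζ + 1 = 0 := by
  refine mul_left_cancel₀ (sub_ne_zero.2 (hζ.ne_one (by norm_num))) ?_
  linear_combination hζ.pow_eq_one

/-- The tangent at `S`, pulled back by multiplication by `3`, is a cube. -/
lemma IsCoord.lineS_triVec (hζ : IsPrimitiveRoot ζ 3) {P : E.Point} {a : Fin 3 → L}
    (ha : IsCoord P a) :
    3 * ζ ^ 2 * triVec a 0 + 3 * ζ * triVec a 1 - E.lam * triVec a 2 =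
      (a 0 ^ 3 + ζ ^ 2 * a 1 ^ 3 + ζ * a 2 ^ 3) ^ 3 := by
  have h := ha.equation
  have hz := sq_add_self_add_one hζ
  simp only [triVec, Matrix.cons_val]
  linear_combination (-a 0 ^ 6 + a 0 ^ 3 * a 1 ^ 3 + a 0 ^ 3 * a 2 ^ 3 - a 1 ^ 6 +
    a 1 ^ 3 * a 2 ^ 3 - a 2 ^ 6) * h + (-3 * a 0 ^ 3 * a 1 ^ 6 * ζ ^ 2 +
    3 * a 0 ^ 3 * a 1 ^ 6 * ζ - 6 * a 0 ^ 3 * a 1 ^ 3 * a 2 ^ 3 * ζ -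
    3 * a 0 ^ 3 * a 1 ^ 3 * a 2 ^ 3 - a 1 ^ 9 * ζ ^ 4 + a 1 ^ 9 * ζ ^ 3 - a 1 ^ 9 * ζ + a 1 ^ 9 -
    3 * a 1 ^ 6 * a 2 ^ 3 * ζ ^ 3 + 3 * a 1 ^ 6 * a 2 ^ 3 * ζ ^ 2 -
    3 * a 1 ^ 3 * a 2 ^ 6 * ζ ^ 2 + 3 * a 1 ^ 3 * a 2 ^ 6 * ζ - a 2 ^ 9 * ζ + a 2 ^ 9) * hz

/-- The tangent at `T`, pulled back by multiplication by `3`, is a cube up to a constant. -/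
lemma IsCoord.lineT_triVec {P : E.Point} {a : Fin 3 → L} (ha : IsCoord P a) :
    3 * triVec a 0 - E.lam * triVec a 1 + 3 * triVec a 2 =
      -(E.lam + 3) * (a 1 ^ 2 * a 0 + a 2 ^ 2 * a 1 + a 0 ^ 2 * a 2) ^ 3 := by
  have h := ha.equation
  simp only [triVec, Matrix.cons_val]
  linear_combination (3 * a 0 ^ 4 * a 1 * a 2 + 3 * a 0 ^ 3 * a 1 ^ 3 + 3 * a 0 ^ 3 * a 2 ^ 3 +
    9 * a 0 ^ 2 * a 1 ^ 2 * a 2 ^ 2 + 3 * a 0 * a 1 ^ 4 * a 2 + 3 * a 0 * a 1 * a 2 ^ 4 +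
    3 * a 1 ^ 3 * a 2 ^ 3) * h

/-- The tangent at the flex `O` meets the cubic only at `O`. -/
lemma IsCoord.eq_zero_of_lineO {P : E.Point} {a : Fin 3 → L} (ha : IsCoord P a)
    (h : 3 * a 0 + 3 * a 1 - E.lam * a 2 = 0) : P = 0 := by
  have hF := ha.equation
  have h3 := E.three_ne_zero
  have hz : a 2 = 0 := by
    refine (pow_eq_zero_iff (n := 3) (by norm_num)).1 (mul_left_cancel₀ E.smooth ?_)
    linear_combination 27 * hF - (9 * a 0 ^ 2 - 9 * a 0 * a 1 + 9 * a 1 ^ 2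
      + 3 * E.lam * a 2 * (a 0 + a 1) + E.lam ^ 2 * a 2 ^ 2) * h
  have h1 : a 1 = -a 0 := by
    refine mul_left_cancel₀ h3 ?_
    linear_combination h + E.lam * hz
  have h0 : a 0 ≠ 0 := fun h0 => ha.eq_zero_of (by decide : (0 : Fin 3) ≠ 2) h0 hz
  have e : a = a 0 • ![1, -1, 0] := by
    funext i
    fin_cases i <;> simp [h1, hz]
  rw [e] at ha
  exact (ha.of_smul h0).eq isCoord_zero

lemma IsCoord.lineO_ne_zero {P : E.Point} {a : Fin 3 → L} (ha : IsCoord P a) (hP : P ≠ 0) :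
    3 * a 0 + 3 * a 1 - E.lam * a 2 ≠ 0 := fun h => hP (ha.eq_zero_of_lineO h)

lemma IsCoord.lineO_eq_zero {a : Fin 3 → L} (ha : IsCoord (0 : E.Point) a) :
    3 * a 0 + 3 * a 1 - E.lam * a 2 = 0 := by
  obtain ⟨c, -, rfl⟩ := isCoord_zero.exists_smul ha
  simp

theorem IsCoord.three_nsmul_eq_zero_iff {P : E.Point} {a : Fin 3 → L} (ha : IsCoord P a) :
    3 • P = 0 ↔ a 0 * a 1 * a 2 = 0 := by
  have h := ha.lineO_triVec
  constructor
  · intro h0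
    have h' := ha.three_nsmul
    rw [h0] at h'
    rw [h'.lineO_eq_zero] at h
    refine (pow_eq_zero_iff (n := 3) (by norm_num)).1 (mul_left_cancel₀ E.smooth ?_)
    linear_combination h
  · intro h0
    refine ha.three_nsmul.eq_zero_of_lineO ?_
    rw [h, h0]
    ring

lemma isCoord_nsmul_pointS (hζ : ζ ^ 3 = 1) (m : ℕ) :
    IsCoord (m • E.pointS ζ hζ) ![1, -ζ ^ m, 0] := by
  induction m with
  | zero => simpa using isCoord_zero
  | succ m ih =>
    have := ih.add_pointS hζ
    rw [succ_nsmul]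
    convert this using 1
    funext i
    fin_cases i <;> simp [pow_succ]; ring

lemma three_nsmul_pointS (hζ : ζ ^ 3 = 1) : 3 • E.pointS ζ hζ = 0 := by
  rw [(isCoord_pointS ζ hζ).three_nsmul_eq_zero_iff]
  simp

lemma IsCoord.eq_nsmul_pointS (hζ : IsPrimitiveRoot ζ 3) {P : E.Point} {a : Fin 3 → L}
    (ha : IsCoord P a) (h2 : a 2 = 0) : ∃ m < 3, P = m • E.pointS ζ hζ.pow_eq_one := by
  have hF := ha.equation
  have h0 : a 0 ≠ 0 := fun h => ha.eq_zero_of (by decide : (0 : Fin 3) ≠ 2) h h2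
  have : (-a 1 / a 0) ^ 3 = 1 := by
    field_simp
    rw [h2] at hF
    linear_combination -hF
  obtain ⟨m, hm, hm'⟩ := hζ.eq_pow_of_pow_eq_one this
  refine ⟨m, hm, ?_⟩
  have e : a = a 0 • ![1, -ζ ^ m, 0] := by
    rw [hm']
    funext i
    fin_cases i
    · simp
    · simp; field_simp
    · simp [h2]
  rw [e] at ha
  exact (ha.of_smul h0).eq (isCoord_nsmul_pointS _ m)

/-- The points `S` and `T` generate the `3`-torsion. -/
theorem exists_of_three_nsmul_eq_zero (hζ : IsPrimitiveRoot ζ 3) {A : E.Point} (hA : 3 • A = 0) :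
    ∃ m < 3, ∃ n < 3, A = m • E.pointS ζ hζ.pow_eq_one + n • E.pointT := by
  have ha := isCoord_coords A
  have h := (ha.three_nsmul_eq_zero_iff).1 hA
  have hT := E.pointT_add_self
  rcases mul_eq_zero.1 h with h | h2
  · rcases mul_eq_zero.1 h with h0 | h1
    · obtain ⟨m, hm, e⟩ := ha.add_pointT.eq_nsmul_pointS hζ h0
      refine ⟨m, hm, 2, by norm_num, ?_⟩
      rw [← e, two_nsmul, hT]
      abel
    · obtain ⟨m, hm, e⟩ := ha.add_neg_pointT.eq_nsmul_pointS hζ h1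
      refine ⟨m, hm, 1, by norm_num, ?_⟩
      rw [← e]
      abel
  · obtain ⟨m, hm, e⟩ := ha.eq_nsmul_pointS hζ h2
    exact ⟨m, hm, 0, by norm_num, by simpa using e⟩

/-! ### Divisibility by 3 over an algebraically closed field -/

/-- Cube roots of three elements whose product is a cube, with prescribed product. -/
lemma exists_cube_roots [IsAlgClosed L] {u v w t : L} (h : u * v * w = t ^ 3) :
    ∃ x y z : L, x ^ 3 = u ∧ y ^ 3 = v ∧ z ^ 3 = w ∧ x * y * z = t := by
  obtain ⟨x, rfl⟩ := IsAlgClosed.exists_pow_nat_eq u (n := 3) (by norm_num)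
  obtain ⟨y, rfl⟩ := IsAlgClosed.exists_pow_nat_eq v (n := 3) (by norm_num)
  by_cases hxy : x * y = 0
  · obtain ⟨z, rfl⟩ := IsAlgClosed.exists_pow_nat_eq w (n := 3) (by norm_num)
    refine ⟨x, y, z, rfl, rfl, rfl, ?_⟩
    rw [← mul_pow, hxy, zero_pow (by norm_num), zero_mul] at h
    rw [hxy, zero_mul, (pow_eq_zero_iff (by norm_num)).1 h.symm]
  · refine ⟨x, y, t / (x * y), rfl, rfl, ?_, mul_div_cancel₀ _ hxy⟩
    rw [div_pow, ← h, ← mul_pow, mul_div_cancel_left₀ _ (pow_ne_zero 3 hxy)]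

/-- Multiplication by `3` is surjective. It is inverted by taking cube roots twice, once for each
of the two `3`-isogenies into which it factors. -/
theorem exists_three_nsmul_eq [IsAlgClosed L] (hζ : IsPrimitiveRoot ζ 3) (P : E.Point) :
    ∃ Q : E.Point, 3 • Q = P := by
  have h3 := E.three_ne_zero
  have hz := sq_add_self_add_one hζ
  have hs := E.smooth
  have hp := isCoord_coords P
  have hF := hp.equation
  generalize P.coords = p at *
  set W := 3 * p 0 + 3 * p 1 - E.lam * p 2 with hW
  set U := 3 * ζ ^ 2 * p 0 + 3 * ζ * p 1 - E.lam * p 2 with hU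
  set V := 3 * ζ * p 0 + 3 * ζ ^ 2 * p 1 - E.lam * p 2 with hV
  have hUVW : U * V * W = -(E.lam ^ 3 + 27) * p 2 ^ 3 := by
    rw [hU, hV, hW]
    linear_combination 27 * hF + (27 * p 0 ^ 3 * ζ - 27 * p 0 ^ 3 + 27 * p 0 ^ 2 * p 1 * ζ ^ 2 -
      9 * p 0 ^ 2 * p 2 * E.lam * ζ + 27 * p 0 * p 1 ^ 2 * ζ ^ 2 -
      9 * p 0 * p 1 * p 2 * E.lam * ζ ^ 2 + 9 * p 0 * p 1 * p 2 * E.lam * ζ -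
      27 * p 0 * p 1 * p 2 * E.lam + 3 * p 0 * p 2 ^ 2 * E.lam ^ 2 + 27 * p 1 ^ 3 * ζ -
      27 * p 1 ^ 3 - 9 * p 1 ^ 2 * p 2 * E.lam * ζ + 3 * p 1 * p 2 ^ 2 * E.lam ^ 2) * hz
  -- `t`, `B` and `C` will be `xyz`, `x³ + ζ²y³ + ζz³` and `x³ + ζy³ + ζ²z³` for the coordinates
  -- `x, y, z` of the point sought
  obtain ⟨t, B, C, ht, hB, hC, htBC⟩ := exists_cube_roots
    (u := -W / (E.lam ^ 3 + 27)) (v := U) (w := V) (t := p 2) (by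
      field_simp
      linear_combination -hUVW)
  have hsum : W + U + V = -3 * E.lam * p 2 := by
    rw [hW, hU, hV]
    linear_combination 3 * (p 0 + p 1) * hz
  have ht' : W = -(E.lam ^ 3 + 27) * t ^ 3 := by
    rw [ht]
    field_simp
  obtain ⟨x, y, z, hx, hy, hz', hxyz⟩ := exists_cube_roots
    (u := (-E.lam * t + B + C) / 3) (v := (-E.lam * t + ζ * B + ζ ^ 2 * C) / 3)
    (w := (-E.lam * t + ζ ^ 2 * B + ζ * C) / 3) (t := t) (by
      have h27 : (-E.lam * t + B + C) * (-E.lam * t + ζ * B + ζ ^ 2 * C) *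
          (-E.lam * t + ζ ^ 2 * B + ζ * C) = 27 * t ^ 3 := by
        linear_combination (t ^ 2 * B * E.lam ^ 2 + t ^ 2 * C * E.lam ^ 2 - t * B ^ 2 * E.lam * ζ -
          t * B * C * E.lam * ζ ^ 2 + t * B * C * E.lam * ζ - 3 * t * B * C * E.lam -
          t * C ^ 2 * E.lam * ζ + B ^ 3 * ζ - B ^ 3 + B ^ 2 * C * ζ ^ 2 + B * C ^ 2 * ζ ^ 2 +
          C ^ 3 * ζ - C ^ 3) * hz + hB + hC + 3 * E.lam * htBC + hsum - ht'
      field_simp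
      linear_combination h27)
  have hu0 : -E.lam * t = x ^ 3 + y ^ 3 + z ^ 3 := by
    rw [hx, hy, hz']
    field_simp
    linear_combination -(B + C) * hz
  have hB' : B = x ^ 3 + ζ ^ 2 * y ^ 3 + ζ * z ^ 3 := by
    rw [hx, hy, hz']
    field_simp
    linear_combination -(-t * E.lam + 2 * B * ζ - 2 * B + C * ζ ^ 2 - C * ζ + C) * hz
  have hC' : C = x ^ 3 + ζ * y ^ 3 + ζ ^ 2 * z ^ 3 := by
    rw [hx, hy, hz']
    field_simp
    linear_combination -(-t * E.lam + B * ζ ^ 2 - B * ζ + B + 2 * C * ζ - 2 * C) * hz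
  have heq : x ^ 3 + y ^ 3 + z ^ 3 + E.lam * x * y * z = 0 := by
    linear_combination -hu0 + E.lam * hxyz
  have h1z : (1 - ζ : L) ≠ 0 := sub_ne_zero.2 (hζ.ne_one (by norm_num)).symm
  have hζ0 : ζ ≠ 0 := hζ.ne_zero (by norm_num)
  -- the three linear forms `W`, `U` and `Z` are independent
  have indep : ∀ a b c : L, 3 * a + 3 * b - E.lam * c = W →
      3 * ζ ^ 2 * a + 3 * ζ * b - E.lam * c = U → c = p 2 → a = p 0 ∧ b = p 1 := by
    rintro a b c h1 h2 rfl
    have e1 : a + b = p 0 + p 1 := mul_left_cancel₀ h3 (by linear_combination h1 + hW)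
    have e2 : ζ * a + b = ζ * p 0 + p 1 :=
      mul_left_cancel₀ (mul_ne_zero h3 hζ0) (by linear_combination h2 + hU)
    have e3 : a = p 0 := mul_left_cancel₀ h1z (by linear_combination e1 - e2)
    exact ⟨e3, by linear_combination e1 - e3⟩
  have key : ![x, y, z] ≠ 0 := by
    intro h
    obtain rfl : x = 0 := congrFun h 0
    obtain rfl : y = 0 := congrFun h 1
    obtain rfl : z = 0 := congrFun h 2
    have htz : t = 0 := by rw [← hxyz]; ring
    have hBz : B = 0 := by rw [hB']; ring
    have hp2 : p 2 = 0 := by rw [← htBC, htz]; ring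
    obtain ⟨h0, h1⟩ := indep 0 0 0 (by rw [ht', htz]; ring) (by rw [← hB, hBz]; ring) hp2.symm
    exact hp.ne_zero (funext fun i => by fin_cases i; exacts [h0.symm, h1.symm, hp2])
  refine ⟨Point.mk ![x, y, z] key heq, ?_⟩
  have hq : IsCoord (E := E) _ ![x, y, z] := isCoord_mk key heq
  have hO := hq.lineO_triVec
  have hS := hq.lineS_triVec hζ
  have hBC : B * C = x ^ 6 + y ^ 6 + z ^ 6 - x ^ 3 * y ^ 3 - y ^ 3 * z ^ 3 - z ^ 3 * x ^ 3 := by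
    rw [hB', hC']
    linear_combination (x ^ 3 * y ^ 3 + x ^ 3 * z ^ 3 + y ^ 6 * ζ - y ^ 6 + y ^ 3 * z ^ 3 * ζ ^ 2 -
      y ^ 3 * z ^ 3 * ζ + y ^ 3 * z ^ 3 + z ^ 6 * ζ - z ^ 6) * hz
  have h2 : triVec ![x, y, z] 2 = p 2 := by
    simp only [triVec, Matrix.cons_val]
    rw [← hBC, hxyz, ← htBC]
    ring
  simp only [Matrix.cons_val] at hO hS
  rw [hxyz, ← ht'] at hO
  rw [← hB', hB] at hS
  obtain ⟨h0, h1⟩ := indep _ _ _ hO hS h2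
  have e : triVec ![x, y, z] = p := funext fun i => by fin_cases i; exacts [h0, h1, h2]
  have h3q := hq.three_nsmul
  rw [e] at h3q
  exact h3q.eq hp

/-! ### Values of rational functions -/

/-- A homogeneous polynomial scales with its argument. -/
lemma _root_.MvPolynomial.IsHomogeneous.aeval_mul {σ R A : Type*} [CommSemiring R]
    [CommSemiring A] [Algebra R A] {G : MvPolynomial σ R} {d : ℕ} (hG : G.IsHomogeneous d)
    (c : A) (w : σ → A) :
    MvPolynomial.aeval (fun i => c * w i) G = c ^ d * MvPolynomial.aeval w G := by
  rw [MvPolynomial.aeval_def, MvPolynomial.aeval_def, MvPolynomial.eval₂_eq, MvPolynomial.eval₂_eq,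
    Finset.mul_sum]
  refine Finset.sum_congr rfl fun m hm => ?_
  simp only [mul_pow, Finset.prod_mul_distrib, Finset.prod_pow_eq_pow_sum]
  rw [← hG.degree_eq_sum_deg_support hm]
  ring

lemma IsCoord.eval_eq_zero_iff {P : E.Point} {a : Fin 3 → L} (ha : IsCoord P a)
    {G : MvPolynomial (Fin 3) L} {d : ℕ} (hG : G.IsHomogeneous d) :
    MvPolynomial.eval a G = 0 ↔ MvPolynomial.eval P.coords G = 0 := by
  obtain ⟨c, hc, rfl⟩ := ha
  have := hG.aeval_mul c P.coords
  simp only [MvPolynomial.aeval_eq_eval] at this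
  change MvPolynomial.eval (fun i => c * P.coords i) G = 0 ↔ _
  rw [this]
  simp [hc]

lemma IsCoord.eval_div_eval {P : E.Point} {a : Fin 3 → L} (ha : IsCoord P a)
    {G H : MvPolynomial (Fin 3) L} {d : ℕ} (hG : G.IsHomogeneous d) (hH : H.IsHomogeneous d) :
    MvPolynomial.eval a G / MvPolynomial.eval a H =
      MvPolynomial.eval P.coords G / MvPolynomial.eval P.coords H := by
  obtain ⟨c, hc, rfl⟩ := ha
  have h1 := hG.aeval_mul c P.coords
  have h2 := hH.aeval_mul c P.coords
  simp only [MvPolynomial.aeval_eq_eval] at h1 h2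
  change MvPolynomial.eval (fun i => c * P.coords i) G /
    MvPolynomial.eval (fun i => c * P.coords i) H = _
  rw [h1, h2, mul_div_mul_left _ _ (pow_ne_zero d hc)]

@[simp] lemma form_mul (G H : MvPolynomial (Fin 3) L) : E.form (G * H) = E.form G * E.form H :=
  map_mul _ _ _

@[simp] lemma form_add (G H : MvPolynomial (Fin 3) L) : E.form (G + H) = E.form G + E.form H :=
  map_add _ _ _

@[simp] lemma form_sub (G H : MvPolynomial (Fin 3) L) : E.form (G - H) = E.form G - E.form H :=
  map_sub _ _ _

@[simp] lemma form_pow (G : MvPolynomial (Fin 3) L) (n : ℕ) : E.form (G ^ n) = E.form G ^ n :=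
  map_pow _ _ _

@[simp] lemma form_C (c : L) : E.form (.C c) = algebraMap L _ c :=
  MvPolynomial.aeval_C _ _

lemma poly_isHomogeneous : E.poly.IsHomogeneous 3 := by
  have h := fun i => MvPolynomial.isHomogeneous_X L (i : Fin 3)
  exact ((((h 0).pow 3).add ((h 1).pow 3)).add ((h 2).pow 3)).add
    ((((MvPolynomial.isHomogeneous_C (Fin 3) E.lam).mul (h 0)).mul (h 1)).mul (h 2))

open MvPolynomial in
/-- Setting `X = 1`, with `y` and `z` as in `affinePoly`. -/
def dehom : MvPolynomial (Fin 3) L →ₐ[L] Polynomial (Polynomial L) :=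
  aeval ![1, Polynomial.C Polynomial.X, Polynomial.X]

lemma dehom_poly : dehom E.poly = E.affinePoly := by
  simp [dehom, poly, affinePoly]
  ring

open MvPolynomial in
lemma form_eq (G : MvPolynomial (Fin 3) L) : E.form G =
    algebraMap E.CoordinateRing _ (AdjoinRoot.mk E.affinePoly (dehom G)) := by
  induction G using MvPolynomial.induction_on with
  | C c =>
    rw [form_C, IsScalarTower.algebraMap_apply L E.CoordinateRing E.FunctionField]
    congr 1
    simp only [dehom, aeval_C]
    rfl
  | add p q hp hq => rw [form_add, hp, hq, map_add, map_add, map_add]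
  | mul_X p i hp =>
    rw [form_mul, hp, map_mul, map_mul, map_mul]
    congr 1
    rw [form, aeval_X]
    fin_cases i
    · simp [dehom]
    · simp only [dehom, aeval_X]
      rfl
    · simp only [dehom, aeval_X]
      rfl

lemma form_poly : E.form E.poly = 0 := by
  rw [form_eq, dehom_poly, AdjoinRoot.mk_self, map_zero]

open MvPolynomial in
/-- A form that is zero as a function on the cubic is a multiple of the equation of the cubic. -/
lemma poly_dvd_of_form_eq_zero {G : MvPolynomial (Fin 3) L} {d : ℕ} (hG : G.IsHomogeneous d)
    (h : E.form G = 0) : E.poly ∣ G := by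
  rw [form_eq] at h
  have hdvd : E.affinePoly ∣ dehom G := by
    rw [← AdjoinRoot.mk_eq_zero]
    exact (IsFractionRing.injective E.CoordinateRing E.FunctionField) (by rw [h, map_zero])
  obtain ⟨q, hq⟩ := hdvd
  -- homogenise by evaluating at `(y, z) = (Y/X, Z/X)` in the localisation at `X`
  let A := Localization.Away (X 0 : MvPolynomial (Fin 3) L)
  let x : A := algebraMap _ _ (X 0 : MvPolynomial (Fin 3) L)
  let x' : A := IsLocalization.Away.invSelf (X 0 : MvPolynomial (Fin 3) L)
  have hxx' : x * x' = 1 := IsLocalization.Away.mul_invSelf _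
  let y : A := algebraMap _ _ (X 1 : MvPolynomial (Fin 3) L)
  let z : A := algebraMap _ _ (X 2 : MvPolynomial (Fin 3) L)
  let ev : Polynomial (Polynomial L) →+* A :=
    Polynomial.eval₂RingHom (Polynomial.eval₂RingHom (algebraMap L A) (y * x')) (z * x')
  have hev' : ∀ H : MvPolynomial (Fin 3) L, ev (dehom H) = aeval ![1, y * x', z * x'] H := by
    intro H
    induction H using MvPolynomial.induction_on with
    | C c => simp [dehom, ev, Polynomial.algebraMap_apply]
    | add p q hp hq => rw [map_add, map_add, map_add, hp, hq]
    | mul_X p i hp =>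
      rw [map_mul, map_mul, map_mul, hp]
      fin_cases i <;> simp [dehom, ev]
  have hev : ∀ (H : MvPolynomial (Fin 3) L) (n : ℕ), H.IsHomogeneous n →
      x ^ n * ev (dehom H) = algebraMap _ A H := by
    intro H n hH
    rw [hev', ← hH.aeval_mul]
    have e2 : (fun i => x * ![1, y * x', z * x'] i) =
        algebraMap (MvPolynomial (Fin 3) L) A ∘ X := by
      funext i
      fin_cases i
      · simp [x]
      · change x * (y * x') = y
        linear_combination y * hxx'
      · change x * (z * x') = z
        linear_combination z * hxx'
    rw [e2, aeval_algebraMap_apply, aeval_X_left_apply]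
  have hinj : Function.Injective (algebraMap (MvPolynomial (Fin 3) L) A) :=
    IsLocalization.injective A (powers_le_nonZeroDivisors_of_noZeroDivisors (X_ne_zero 0))
  obtain ⟨n, Q, hQ⟩ := IsLocalization.Away.surj (X 0 : MvPolynomial (Fin 3) L) (ev q)
  have key : X 0 ^ (n + 3) * G = E.poly * (X 0 ^ d * Q) := by
    refine hinj ?_
    rw [map_mul, map_mul, map_mul, map_pow, map_pow, ← hQ, ← hev _ _ hG,
      ← hev _ _ poly_isHomogeneous, hq, dehom_poly, map_mul]
    ring
  have hX : ¬ (X 0 : MvPolynomial (Fin 3) L) ∣ E.poly := by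
    rintro ⟨Q, hQ⟩
    have := congrArg (eval ![0, 1, 0]) hQ
    simp [eval_poly] at this
  have hprime : Prime (X 0 : MvPolynomial (Fin 3) L) := X_prime
  obtain ⟨Q', hQ'⟩ := hprime.pow_dvd_of_dvd_mul_left (n + 3) hX (Dvd.intro _ key)
  refine ⟨Q', mul_left_cancel₀ (pow_ne_zero (n + 3) hprime.ne_zero) ?_⟩
  rw [key, hQ']
  ring

lemma eval_eq_zero_of_form_eq_zero {G : MvPolynomial (Fin 3) L} {d : ℕ} (hG : G.IsHomogeneous d)
    (h : E.form G = 0) (P : E.Point) : MvPolynomial.eval P.coords G = 0 := by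
  obtain ⟨Q, rfl⟩ := poly_dvd_of_form_eq_zero hG h
  rw [map_mul]
  exact mul_eq_zero_of_left P.2 _

lemma form_ne_zero {G : MvPolynomial (Fin 3) L} {d : ℕ} (hG : G.IsHomogeneous d) {P : E.Point}
    (h : MvPolynomial.eval P.coords G ≠ 0) : E.form G ≠ 0 :=
  fun h0 => h (eval_eq_zero_of_form_eq_zero hG h0 P)

namespace HasValue

variable {f g : E.FunctionField} {P : E.Point} {v w : L}

lemma of_isCoord {a : Fin 3 → L} (ha : IsCoord P a) {G H : MvPolynomial (Fin 3) L} {d : ℕ}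
    (hG : G.IsHomogeneous d) (hH : H.IsHomogeneous d) (h : MvPolynomial.eval a H ≠ 0) :
    HasValue (E.form G / E.form H) P (MvPolynomial.eval a G / MvPolynomial.eval a H) :=
  ⟨d, G, H, hG, hH, fun h0 => h ((ha.eval_eq_zero_iff hH).2 h0), rfl, ha.eval_div_eval hG hH⟩

lemma unique (h : HasValue f P v) (h' : HasValue f P w) : v = w := by
  obtain ⟨d, G, H, hG, hH, h0, rfl, rfl⟩ := h
  obtain ⟨d', G', H', hG', hH', h0', e, rfl⟩ := h'
  rw [div_eq_div_iff (form_ne_zero hH h0) (form_ne_zero hH' h0'), ← sub_eq_zero] at e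
  have := eval_eq_zero_of_form_eq_zero (E := E) (G := G * H' - G' * H)
    ((hG.mul hH').sub (by rw [add_comm]; exact hG'.mul hH)) (by simpa using e) P
  rw [div_eq_div_iff h0 h0', ← sub_eq_zero]
  simpa using this

lemma const (c : L) (P : E.Point) : HasValue (algebraMap L E.FunctionField c) P c :=
  ⟨0, .C c, .C 1, MvPolynomial.isHomogeneous_C _ _, MvPolynomial.isHomogeneous_C _ _, by simp,
    by rw [form_C, form_C, map_one, div_one], by simp⟩

lemma mul (h : HasValue f P v) (h' : HasValue g P w) : HasValue (f * g) P (v * w) := by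
  obtain ⟨d, G, H, hG, hH, h0, rfl, rfl⟩ := h
  obtain ⟨d', G', H', hG', hH', h0', rfl, rfl⟩ := h'
  refine ⟨d + d', G * G', H * H', hG.mul hG', hH.mul hH', ?_, ?_, ?_⟩
  · rw [map_mul]; exact mul_ne_zero h0 h0'
  · rw [form_mul, form_mul, div_mul_div_comm]
  · rw [map_mul, map_mul, div_mul_div_comm]

lemma add (h : HasValue f P v) (h' : HasValue g P w) : HasValue (f + g) P (v + w) := by
  obtain ⟨d, G, H, hG, hH, h0, rfl, rfl⟩ := h
  obtain ⟨d', G', H', hG', hH', h0', rfl, rfl⟩ := h'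
  refine ⟨d + d', G * H' + H * G', H * H', (hG.mul hH').add (hH.mul hG'), hH.mul hH', ?_, ?_, ?_⟩
  · rw [map_mul]; exact mul_ne_zero h0 h0'
  · rw [form_add, form_mul, form_mul, form_mul,
      div_add_div _ _ (form_ne_zero hH h0) (form_ne_zero hH' h0')]
  · rw [map_add, map_mul, map_mul, map_mul, div_add_div _ _ h0 h0']

lemma inv (h : HasValue f P v) (hv : v ≠ 0) : HasValue f⁻¹ P v⁻¹ := by
  obtain ⟨d, G, H, hG, hH, h0, rfl, rfl⟩ := h
  exact ⟨d, H, G, hH, hG, (div_ne_zero_iff.1 hv).1, by rw [inv_div], by rw [inv_div]⟩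

lemma pow (h : HasValue f P v) (n : ℕ) : HasValue (f ^ n) P (v ^ n) := by
  induction n with
  | zero => simpa using const (E := E) 1 P
  | succ n ih => rw [pow_succ, pow_succ]; exact ih.mul h

lemma div (h : HasValue f P v) (h' : HasValue g P w) (hw : w ≠ 0) :
    HasValue (f / g) P (v / w) := by
  rw [div_eq_mul_inv, div_eq_mul_inv]
  exact h.mul (h'.inv hw)

lemma ne_zero (h : HasValue f P v) (hv : v ≠ 0) : f ≠ 0 := by
  rintro rfl
  exact hv (h.unique (by simpa using const (E := E) 0 P))

end HasValue

/-! ### Local parameters -/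

/-- The rational function `X_j / X_i`. -/
def coordRatio (E : HesseCubic L) (i j : Fin 3) : E.FunctionField :=
  E.form (.X j) / E.form (.X i)

lemma IsCoord.hasValue_coordRatio {P : E.Point} {a : Fin 3 → L} (ha : IsCoord P a) {i : Fin 3}
    (hi : a i ≠ 0) (j : Fin 3) : HasValue (E.coordRatio i j) P (a j / a i) := by
  simpa [coordRatio] using HasValue.of_isCoord ha (MvPolynomial.isHomogeneous_X L j)
    (MvPolynomial.isHomogeneous_X L i) (by simpa using hi)

lemma form_X_ne_zero (i : Fin 3) : E.form (.X i) ≠ 0 := by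
  have hX := MvPolynomial.isHomogeneous_X L i
  by_cases hi : i = 2
  · refine form_ne_zero hX (P := E.pointT) ?_
    rw [Ne, ← isCoord_pointT.eval_eq_zero_iff hX]
    simp [hi]
  · refine form_ne_zero hX (P := 0) ?_
    rw [Ne, ← isCoord_zero.eval_eq_zero_iff hX]
    fin_cases i <;> simp_all

lemma form_coordRatio (i : Fin 3) : 1 + E.coordRatio i (i + 1) ^ 3 + E.coordRatio i (i + 2) ^ 3 +
    algebraMap L _ E.lam * E.coordRatio i (i + 1) * E.coordRatio i (i + 2) = 0 := by
  have h := E.form_poly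
  have h0 := E.form_X_ne_zero i
  have : E.form (.X 0) ^ 3 + E.form (.X 1) ^ 3 + E.form (.X 2) ^ 3 +
      algebraMap L _ E.lam * E.form (.X 0) * E.form (.X 1) * E.form (.X 2) = 0 := by
    simpa [poly] using h
  simp only [coordRatio]
  field_simp
  fin_cases i
  · simp; linear_combination this
  · simp; linear_combination this
  · simp; linear_combination this

/-- Polynomials in the affine coordinates `X_j / X_i` are regular at points with `X_i ≠ 0`, and at
such a point they have their value modulo a local parameter. It suffices that this holds for the
coordinates themselves. -/
lemma exists_aeval_coordRatio_eq {P : E.Point} {a : Fin 3 → L} {i : Fin 3} {t : E.FunctionField}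
    (h : ∀ m, ∃ h v, HasValue h P v ∧ E.coordRatio i m = algebraMap L _ (a m / a i) + t * h)
    (ht : HasValue t P 0) (q : MvPolynomial (Fin 3) L) : ∃ h v, HasValue h P v ∧
      MvPolynomial.aeval (E.coordRatio i) q =
        algebraMap L _ (MvPolynomial.eval (fun m => a m / a i) q) + t * h := by
  induction q using MvPolynomial.induction_on with
  | C c => exact ⟨0, 0, by simpa using HasValue.const (E := E) 0 P, by simp⟩
  | add p q hp hq =>
    obtain ⟨h, v, hv, e⟩ := hp
    obtain ⟨h', v', hv', e'⟩ := hq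
    refine ⟨h + h', _, hv.add hv', ?_⟩
    rw [map_add, e, e', map_add, map_add]
    ring
  | mul_X p m hp =>
    obtain ⟨f, v, hv, e⟩ := hp
    obtain ⟨f', v', hv', e'⟩ := h m
    refine ⟨_, _, ((HasValue.const (MvPolynomial.eval (fun m => a m / a i) p) P).mul hv').add
      (hv.mul ((HasValue.const (a m / a i) P).add (ht.mul hv'))), ?_⟩
    rw [map_mul, e, MvPolynomial.aeval_X, e', map_mul, MvPolynomial.eval_X, map_mul]
    ring

/-- At a point where the derivative of the equation with respect to `X_k` does not vanish, the
affine coordinate `X_j / X_i`, less its value, is a local parameter. -/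
theorem IsCoord.isParameter {P : E.Point} {a : Fin 3 → L} (ha : IsCoord P a) {i j k : Fin 3}
    (hij : i ≠ j) (hik : i ≠ k) (hjk : j ≠ k) (hi : a i ≠ 0)
    (hk : 3 * a k ^ 2 + E.lam * a i * a j ≠ 0) :
    IsParameter (E.coordRatio i j - algebraMap L _ (a j / a i)) P := by
  set t := E.coordRatio i j - algebraMap L _ (a j / a i) with ht_def
  have hval := ha.hasValue_coordRatio hi
  have ht : HasValue t P 0 := by
    simpa [ht_def, sub_eq_add_neg] using (hval j).add (HasValue.const (-(a j / a i)) P)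
  have hperm : (j = i + 1 ∧ k = i + 2) ∨ (j = i + 2 ∧ k = i + 1) := by
    revert hij hik hjk
    clear * -
    revert i j k
    decide
  have hF : 1 + E.coordRatio i j ^ 3 + E.coordRatio i k ^ 3 +
      algebraMap L _ E.lam * E.coordRatio i j * E.coordRatio i k = 0 := by
    have := E.form_coordRatio i
    rcases hperm with ⟨rfl, rfl⟩ | ⟨rfl, rfl⟩
    · exact this
    · linear_combination this
  have hFa : 1 + (a j / a i) ^ 3 + (a k / a i) ^ 3 + E.lam * (a j / a i) * (a k / a i) = 0 := by
    have h : a i ^ 3 + a j ^ 3 + a k ^ 3 + E.lam * a i * a j * a k = 0 := by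
      have := ha.equation
      rcases hperm with ⟨rfl, rfl⟩ | ⟨rfl, rfl⟩ <;> fin_cases i <;> simp <;>
        linear_combination this
    field_simp
    linear_combination h
  -- the equation expresses `X_k / X_i`, less its value, as a multiple of `t`
  have hD := (((hval k).pow 2).add ((hval k).mul (HasValue.const (a k / a i) P))).add
    ((HasValue.const ((a k / a i) ^ 2) P).add (HasValue.const (E.lam * (a j / a i)) P))
  have hD0 : (a k / a i) ^ 2 + a k / a i * (a k / a i) +
      ((a k / a i) ^ 2 + E.lam * (a j / a i)) ≠ 0 := by
    intro h0
    refine hk ?_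
    field_simp at h0
    linear_combination h0
  have hN := ((((hval j).pow 2).add ((hval j).mul (HasValue.const (a j / a i) P))).add
    ((HasValue.const ((a j / a i) ^ 2) P).add ((HasValue.const E.lam P).mul (hval k)))).mul
    (HasValue.const (-1) P)
  have hcoord : ∀ m, ∃ h v, HasValue h P v ∧
      E.coordRatio i m = algebraMap L _ (a m / a i) + t * h := by
    intro m
    have hm : m = i ∨ m = j ∨ m = k := by
      revert hij hik hjk
      clear * -
      revert i j k m
      decide
    rcases hm with rfl | rfl | rfl
    · refine ⟨0, 0, by simpa using HasValue.const (E := E) 0 P, ?_⟩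
      rw [div_self hi, map_one, mul_zero, add_zero, coordRatio, div_self (form_X_ne_zero _)]
    · exact ⟨1, 1, by simpa using HasValue.const (E := E) 1 P, by rw [ht_def]; ring⟩
    · refine ⟨_, _, hN.div hD hD0, ?_⟩
      have h0 := hD.ne_zero hD0
      have hFa' := congrArg (algebraMap L E.FunctionField) hFa
      simp only [map_add, map_mul, map_pow, map_one, map_zero, map_neg] at hFa' h0 ⊢
      rw [← sub_eq_iff_eq_add', mul_div_assoc', eq_div_iff h0, ht_def]
      linear_combination hF - hFa'
  refine ⟨ht, ?_⟩
  rintro f ⟨d, G, H, hG, hH, h0, rfl, hv⟩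
  have hG0 : MvPolynomial.eval P.coords G = 0 := by
    simpa [h0] using hv.symm
  have hform : ∀ {G : MvPolynomial (Fin 3) L}, G.IsHomogeneous d →
      E.form G = E.form (.X i) ^ d * MvPolynomial.aeval (E.coordRatio i) G := by
    intro G hG
    rw [← hG.aeval_mul, form]
    congr 2
    funext m
    rw [coordRatio, mul_div_cancel₀ _ (form_X_ne_zero i), form, MvPolynomial.aeval_X]
  have hcd : IsCoord P (fun m => a m / a i) := by
    convert ha.smul (inv_ne_zero hi) using 1
    funext m
    simp [div_eq_inv_mul]
  obtain ⟨h, v, hhv, eG⟩ := E.exists_aeval_coordRatio_eq hcoord ht G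
  obtain ⟨h', v', hhv', eH⟩ := E.exists_aeval_coordRatio_eq hcoord ht H
  rw [(hcd.eval_eq_zero_iff hG).2 hG0, map_zero, zero_add] at eG
  have hHv := (HasValue.const (MvPolynomial.eval (fun m => a m / a i) H) P).add (ht.mul hhv')
  rw [← eH, zero_mul, add_zero] at hHv
  refine ⟨_, _, hhv.div hHv fun h => h0 ((hcd.eval_eq_zero_iff hH).1 h), ?_⟩
  rw [hform hG, hform hH, mul_div_mul_left _ _ (pow_ne_zero d (form_X_ne_zero i)), eG,
    mul_div_assoc]

/-- Every point has a local parameter: the cubic is smooth. -/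
theorem exists_isParameter (P : E.Point) : ∃ t, IsParameter t P := by
  have ha := isCoord_coords P
  generalize P.coords = a at ha
  have hF := ha.equation
  have key : ∀ i j k : Fin 3, i ≠ j → i ≠ k → j ≠ k →
      a i ^ 3 + a j ^ 3 + a k ^ 3 + E.lam * a i * a j * a k = 0 → a i ≠ 0 →
      ∃ t, IsParameter t P := by
    intro i j k hij hik hjk hF hi
    by_cases hk : 3 * a k ^ 2 + E.lam * a i * a j = 0
    · by_cases hj : 3 * a j ^ 2 + E.lam * a i * a k = 0
      · -- all derivatives vanish, which forces `lam³ + 27 = 0`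
        exfalso
        set p := a i * a j * a k with hp
        have ej : 3 * a j ^ 3 = -E.lam * p := by linear_combination a j * hj
        have ek : 3 * a k ^ 3 = -E.lam * p := by linear_combination a k * hk
        have ei : 3 * a i ^ 3 = -E.lam * p := by linear_combination 3 * hF - ej - ek
        have hp0 : (E.lam ^ 3 + 27) * p ^ 3 = 0 := by
          have : 27 * p ^ 3 = (3 * a i ^ 3) * (3 * a j ^ 3) * (3 * a k ^ 3) := by rw [hp]; ring
          rw [ei, ej, ek] at this
          linear_combination this
        have hp0 := (pow_eq_zero_iff (n := 3) (by norm_num)).1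
          ((mul_eq_zero.1 hp0).resolve_left E.smooth)
        rw [hp0, mul_zero] at ei
        exact mul_ne_zero E.three_ne_zero (pow_ne_zero 3 hi) ei
      · exact ⟨_, ha.isParameter hik hij hjk.symm hi hj⟩
    · exact ⟨_, ha.isParameter hij hik hjk hi hk⟩
  by_cases h0 : a 0 = 0
  · refine key 1 0 2 (by decide) (by decide) (by decide) (by linear_combination hF) fun h1 => ?_
    exact ha.eq_zero_of (by decide : (0 : Fin 3) ≠ 1) h0 h1
  · exact key 0 1 2 (by decide) (by decide) (by decide) (by linear_combination hF) h0

/-! ### Tangent lines, and divisors of the descent functions -/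

lemma isHomogeneous_linear (b c d : L) : MvPolynomial.IsHomogeneous
    (.C b * .X 0 + .C c * .X 1 + .C d * .X 2 : MvPolynomial (Fin 3) L) 1 :=
  ((MvPolynomial.isHomogeneous_C_mul_X _ _).add (MvPolynomial.isHomogeneous_C_mul_X _ _)).add
    (MvPolynomial.isHomogeneous_C_mul_X _ _)

lemma lineO_isHomogeneous : E.lineO.IsHomogeneous 1 := by
  convert isHomogeneous_linear 3 3 (-E.lam) using 1
  simp [lineO, sub_eq_add_neg]

lemma lineS_isHomogeneous : (E.lineS ζ).IsHomogeneous 1 := by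
  convert isHomogeneous_linear (3 * ζ ^ 2) (3 * ζ) (-E.lam) using 1
  simp [lineS, sub_eq_add_neg]

lemma lineT_isHomogeneous : E.lineT.IsHomogeneous 1 := by
  convert isHomogeneous_linear 3 (-E.lam) 3 using 1
  simp [lineT, sub_eq_add_neg]

@[simp] lemma eval_lineO (a : Fin 3 → L) :
    MvPolynomial.eval a E.lineO = 3 * a 0 + 3 * a 1 - E.lam * a 2 := by
  simp [lineO]

@[simp] lemma eval_lineS (a : Fin 3 → L) : MvPolynomial.eval a (E.lineS ζ) =
    3 * ζ ^ 2 * a 0 + 3 * ζ * a 1 - E.lam * a 2 := by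
  simp [lineS]

@[simp] lemma eval_lineT (a : Fin 3 → L) :
    MvPolynomial.eval a E.lineT = 3 * a 0 - E.lam * a 1 + 3 * a 2 := by
  simp [lineT]

lemma form_lineO : E.form E.lineO = 3 * E.form (.X 0) + 3 * E.form (.X 1) -
    algebraMap L _ E.lam * E.form (.X 2) := by
  simp only [lineO, form_add, form_sub, form_mul, form_C]
  simp only [map_ofNat]

lemma form_lineS : E.form (E.lineS ζ) = 3 * algebraMap L _ ζ ^ 2 * E.form (.X 0) +
    3 * algebraMap L _ ζ * E.form (.X 1) - algebraMap L _ E.lam * E.form (.X 2) := by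
  simp only [lineS, form_add, form_sub, form_mul, form_C]
  simp only [map_ofNat, map_mul, map_pow]

lemma form_lineT : E.form E.lineT = 3 * E.form (.X 0) - algebraMap L _ E.lam * E.form (.X 1) +
    3 * E.form (.X 2) := by
  simp only [lineT, form_add, form_sub, form_mul, form_C]
  simp only [map_ofNat]

/-- It suffices to compute the differential at any coordinate vector of the point. -/
lemma IsCoord.isTangentLine {P : E.Point} {a : Fin 3 → L} (ha : IsCoord P a)
    {l : MvPolynomial (Fin 3) L} {c : L} (hc : c ≠ 0)
    (hl : l = .C (c * (3 * a 0 ^ 2 + E.lam * a 1 * a 2)) * .X 0 +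
      .C (c * (3 * a 1 ^ 2 + E.lam * a 0 * a 2)) * .X 1 +
      .C (c * (3 * a 2 ^ 2 + E.lam * a 0 * a 1)) * .X 2) : E.IsTangentLine l P := by
  obtain ⟨d, hd, rfl⟩ := ha
  refine ⟨c * d ^ 2, mul_ne_zero hc (pow_ne_zero 2 hd), ?_⟩
  rw [hl, Fin.sum_univ_three]
  have e0 : MvPolynomial.eval P.coords (MvPolynomial.pderiv 0 E.poly) =
      3 * P.coords 0 ^ 2 + E.lam * P.coords 1 * P.coords 2 := by
    simp [poly, MvPolynomial.pderiv_X]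
    ring
  have e1 : MvPolynomial.eval P.coords (MvPolynomial.pderiv 1 E.poly) =
      3 * P.coords 1 ^ 2 + E.lam * P.coords 0 * P.coords 2 := by
    simp [poly, MvPolynomial.pderiv_X]
    ring
  have e2 : MvPolynomial.eval P.coords (MvPolynomial.pderiv 2 E.poly) =
      3 * P.coords 2 ^ 2 + E.lam * P.coords 0 * P.coords 1 := by
    simp [poly, MvPolynomial.pderiv_X]
  rw [e0, e1, e2]
  simp only [Pi.smul_apply, smul_eq_mul]
  congr 3
  · ring_nf
  · ring_nf
  · ring_nf

lemma isTangentLine_lineO : E.IsTangentLine E.lineO E.pointO := by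
  refine (isCoord_zero (E := E)).isTangentLine one_ne_zero ?_
  simp [lineO, sub_eq_add_neg]

lemma isTangentLine_lineS (hζ : ζ ^ 3 = 1) : E.IsTangentLine (E.lineS ζ) (E.pointS ζ hζ) := by
  have hζ0 : ζ ≠ 0 := by
    rintro rfl
    simp at hζ
  refine (isCoord_pointS ζ hζ).isTangentLine (c := ζ ^ 2) (pow_ne_zero 2 hζ0) ?_
  have e0 : ζ ^ 2 * (3 * 1 ^ 2 + E.lam * -ζ * 0) = 3 * ζ ^ 2 := by ring
  have e1 : ζ ^ 2 * (3 * (-ζ) ^ 2 + E.lam * 1 * 0) = 3 * ζ := by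
    linear_combination 3 * ζ * hζ
  have e2 : ζ ^ 2 * (3 * 0 ^ 2 + E.lam * 1 * -ζ) = -E.lam := by
    linear_combination -E.lam * hζ
  simp only [Matrix.cons_val]
  rw [e0, e1, e2, lineS, map_neg]
  ring

lemma isTangentLine_lineT : E.IsTangentLine E.lineT E.pointT := by
  refine (isCoord_pointT (E := E)).isTangentLine one_ne_zero ?_
  simp [lineT, sub_eq_add_neg]

/-- The product of the tangents at the three flexes on a side of the triangle `XYZ = 0`. -/
lemma tangent_mul {R : Type*} [CommRing R] {z : R} (hz : z ^ 2 + z + 1 = 0) (l a b c : R) :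
    (3 * a + 3 * b - l * c) * (3 * z ^ 2 * a + 3 * z * b - l * c) *
        (3 * (z ^ 2) ^ 2 * a + 3 * z ^ 2 * b - l * c) =
      27 * (a ^ 3 + b ^ 3 + c ^ 3 + l * a * b * c) - (l ^ 3 + 27) * c ^ 3 := by
  linear_combination (27 * a ^ 3 * z ^ 4 - 27 * a ^ 3 * z ^ 3 + 27 * a ^ 3 * z - 27 * a ^ 3 +
    27 * a ^ 2 * b * z ^ 4 - 9 * a ^ 2 * c * l * z ^ 4 + 9 * a ^ 2 * c * l * z ^ 3 -
    9 * a ^ 2 * c * l * z ^ 2 + 27 * a * b ^ 2 * z ^ 3 - 9 * a * b * c * l * z ^ 3 -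
    9 * a * b * c * l * z ^ 2 + 18 * a * b * c * l * z - 27 * a * b * c * l +
    3 * a * c ^ 2 * l ^ 2 * z ^ 2 - 3 * a * c ^ 2 * l ^ 2 * z + 3 * a * c ^ 2 * l ^ 2 +
    27 * b ^ 3 * z - 27 * b ^ 3 - 9 * b ^ 2 * c * l * z + 3 * b * c ^ 2 * l ^ 2) * hz

lemma form_equation : E.form (.X 0) ^ 3 + E.form (.X 1) ^ 3 + E.form (.X 2) ^ 3 +
    algebraMap L _ E.lam * E.form (.X 0) * E.form (.X 1) * E.form (.X 2) = 0 := by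
  simpa [poly] using E.form_poly

/-- The tangents at the three flexes with `Z = 0` have the product `Z³`, up to a constant. -/
lemma form_lineO_mul (hζ : IsPrimitiveRoot ζ 3) :
    E.form E.lineO * E.form (E.lineS ζ) * E.form (E.lineS (ζ ^ 2)) =
      algebraMap L _ (-(E.lam ^ 3 + 27)) * E.form (.X 2) ^ 3 := by
  have h := E.form_equation
  have hz := congrArg (algebraMap L E.FunctionField) (sq_add_self_add_one hζ)
  simp only [form_lineO, form_lineS, map_pow, map_ofNat, map_add, map_neg, map_one,
    map_zero] at hz ⊢
  linear_combination tangent_mul hz (algebraMap L E.FunctionField E.lam) (E.form (.X 0))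
    (E.form (.X 1)) (E.form (.X 2)) + 27 * h

/-- The form `3ζ²X - lam·Y + 3ζZ`, which for a cube root of unity `ζ` defines the tangent at the
flex `(1 : 0 : -ζ)`. -/
def lineT' (E : HesseCubic L) (ζ : L) : MvPolynomial (Fin 3) L :=
  .C (3 * ζ ^ 2) * .X 0 + .C (-E.lam) * .X 1 + .C (3 * ζ) * .X 2

lemma form_lineT' : E.form (E.lineT' ζ) = 3 * algebraMap L _ ζ ^ 2 * E.form (.X 0) -
    algebraMap L _ E.lam * E.form (.X 1) + 3 * algebraMap L _ ζ * E.form (.X 2) := by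
  simp only [lineT', form_add, form_mul, form_C]
  simp only [map_ofNat, map_mul, map_pow, map_neg]
  ring

/-- The tangents at the three flexes with `Y = 0` have the product `Y³`, up to a constant. -/
lemma form_lineT_mul (hζ : IsPrimitiveRoot ζ 3) :
    E.form E.lineT * E.form (E.lineT' ζ) * E.form (E.lineT' (ζ ^ 2)) =
      algebraMap L _ (-(E.lam ^ 3 + 27)) * E.form (.X 1) ^ 3 := by
  have h := E.form_equation
  have hz := congrArg (algebraMap L E.FunctionField) (sq_add_self_add_one hζ)
  simp only [form_lineT, form_lineT', map_pow, map_ofNat, map_add, map_neg, map_one,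
    map_zero] at hz ⊢
  linear_combination tangent_mul hz (algebraMap L E.FunctionField E.lam) (E.form (.X 0))
    (E.form (.X 2)) (E.form (.X 1)) + 27 * h

lemma lineT_const_ne_zero (E : HesseCubic L) : E.lam ^ 2 - 3 * E.lam + 9 ≠ 0 := fun h =>
  E.smooth (by linear_combination (E.lam + 3) * h)

/-- The tangent at the flex `S` meets the cubic only at `S`. -/
lemma IsCoord.lineS_ne_zero (hζ : IsPrimitiveRoot ζ 3) {P : E.Point} {a : Fin 3 → L}
    (ha : IsCoord P a) (hP : P ≠ E.pointS ζ hζ.pow_eq_one) :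
    3 * ζ ^ 2 * a 0 + 3 * ζ * a 1 - E.lam * a 2 ≠ 0 := by
  intro h
  have hF := ha.equation
  have ht := tangent_mul (sq_add_self_add_one hζ) E.lam (a 0) (a 1) (a 2)
  rw [h, hF] at ht
  have h2 : a 2 = 0 := (pow_eq_zero_iff (n := 3) (by norm_num)).1
    (mul_left_cancel₀ E.smooth (by linear_combination ht))
  have h1 : a 1 = -ζ * a 0 := by
    refine mul_left_cancel₀ (mul_ne_zero E.three_ne_zero (hζ.ne_zero (by norm_num))) ?_
    linear_combination h + E.lam * h2
  have h0 : a 0 ≠ 0 := fun h0 => ha.eq_zero_of (by decide : (0 : Fin 3) ≠ 2) h0 h2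
  have e : a = a 0 • ![1, -ζ, 0] := by
    funext i
    fin_cases i
    · simp
    · simp [h1]; ring
    · simp [h2]
  rw [e] at ha
  exact hP ((ha.of_smul h0).eq (isCoord_pointS ζ _))

/-- The tangent at the flex `T` meets the cubic only at `T`. -/
lemma IsCoord.lineT_ne_zero (hζ : IsPrimitiveRoot ζ 3) {P : E.Point} {a : Fin 3 → L}
    (ha : IsCoord P a) (hP : P ≠ E.pointT) : 3 * a 0 - E.lam * a 1 + 3 * a 2 ≠ 0 := by
  intro h
  have hF := ha.equation
  have ht := tangent_mul (sq_add_self_add_one hζ) E.lam (a 0) (a 2) (a 1)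
  rw [show 3 * a 0 + 3 * a 2 - E.lam * a 1 = 0 by linear_combination h] at ht
  have h2 : a 1 = 0 := (pow_eq_zero_iff (n := 3) (by norm_num)).1
    (mul_left_cancel₀ E.smooth (by linear_combination ht + 27 * hF))
  have h1 : a 2 = -a 0 := by
    refine mul_left_cancel₀ E.three_ne_zero ?_
    linear_combination h + E.lam * h2
  have h0 : a 0 ≠ 0 := fun h0 => ha.eq_zero_of (by decide : (0 : Fin 3) ≠ 1) h0 h2
  have e : a = a 0 • ![1, 0, -1] := by
    funext i
    fin_cases i <;> simp [h1, h2]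
  rw [e] at ha
  exact hP ((ha.of_smul h0).eq isCoord_pointT)

lemma IsCoord.hasValue_funS {P : E.Point} {a : Fin 3 → L} (ha : IsCoord P a) (hP : P ≠ 0) :
    HasValue (E.funS ζ) P ((E.lam ^ 3 + 27) *
      ((3 * ζ ^ 2 * a 0 + 3 * ζ * a 1 - E.lam * a 2) / (3 * a 0 + 3 * a 1 - E.lam * a 2))) := by
  have := HasValue.of_isCoord ha (E.lineS_isHomogeneous (ζ := ζ)) E.lineO_isHomogeneous
    (by simpa using ha.lineO_ne_zero hP)
  rw [eval_lineO, eval_lineS] at this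
  exact (HasValue.const _ P).mul this

lemma IsCoord.hasValue_funT {P : E.Point} {a : Fin 3 → L} (ha : IsCoord P a) (hP : P ≠ 0) :
    HasValue E.funT P ((E.lam ^ 2 - 3 * E.lam + 9) *
      ((3 * a 0 - E.lam * a 1 + 3 * a 2) / (3 * a 0 + 3 * a 1 - E.lam * a 2))) := by
  have := HasValue.of_isCoord ha E.lineT_isHomogeneous E.lineO_isHomogeneous
    (by simpa using ha.lineO_ne_zero hP)
  rw [eval_lineO, eval_lineT] at this
  exact (HasValue.const _ P).mul this

lemma isParameter_zero : IsParameter (E.coordRatio 0 2) (0 : E.Point) := by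
  have := (isCoord_zero (E := E)).isParameter (i := 0) (j := 2) (k := 1) (by decide) (by decide)
    (by decide) (by simp) (by simpa using E.three_ne_zero)
  simpa using this

lemma isParameter_pointS (hζ : ζ ^ 3 = 1) : IsParameter (E.coordRatio 0 2) (E.pointS ζ hζ) := by
  have hζ0 : ζ ≠ 0 := by
    rintro rfl
    simp at hζ
  have := (isCoord_pointS (E := E) ζ hζ).isParameter (i := 0) (j := 2) (k := 1) (by decide)
    (by decide) (by decide) (by simp) (by simpa using ⟨E.three_ne_zero, hζ0⟩)
  simpa using this

lemma isParameter_pointT : IsParameter (E.coordRatio 0 1) E.pointT := by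
  have := (isCoord_pointT (E := E)).isParameter (i := 0) (j := 1) (k := 2) (by decide)
    (by decide) (by decide) (by simp) (by simpa using E.three_ne_zero)
  simpa using this

lemma coordRatio_ne_zero (i j : Fin 3) : E.coordRatio i j ≠ 0 :=
  div_ne_zero (form_X_ne_zero j) (form_X_ne_zero i)

lemma form_lineO_ne_zero : E.form E.lineO ≠ 0 := by
  refine form_ne_zero lineO_isHomogeneous (P := E.pointT) ?_
  rw [Ne, ← isCoord_pointT.eval_eq_zero_iff lineO_isHomogeneous]
  simpa [add_comm] using E.lam_add_three_ne_zero

lemma three_mul_sub_ne_zero (E : HesseCubic L) (hζ : IsPrimitiveRoot ζ 3) :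
    3 * ζ ^ 2 - 3 * ζ ≠ 0 := by
  rw [show 3 * ζ ^ 2 - 3 * ζ = 3 * ζ * (ζ - 1) by ring]
  exact mul_ne_zero (mul_ne_zero E.three_ne_zero (hζ.ne_zero (by norm_num)))
    (sub_ne_zero.2 (hζ.ne_one (by norm_num)))

/-- By `form_lineO_mul`, `f_S = (Z/X)⁻³ u` where `u` is `-l²l'/X³`, for the tangents `l` and `l'` at
the flexes `S` and `(1 : -ζ² : 0)`. -/
lemma hasLeadingTerm_funS_zero (hζ : IsPrimitiveRoot ζ 3) :
    HasLeadingTerm (E.funS ζ) (E.coordRatio 0 2) 0 (-3) ((3 * ζ ^ 2 - 3 * ζ) ^ 3) := by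
  have hc := E.three_mul_sub_ne_zero hζ
  refine ⟨pow_ne_zero 3 hc, E.form (.C (-1) * E.lineS ζ ^ 2 * E.lineS (ζ ^ 2)) /
    E.form (.X 0 ^ 3), ?_, ?_⟩
  · have := HasValue.of_isCoord (isCoord_zero (E := E)) (d := 3)
      (G := .C (-1) * E.lineS ζ ^ 2 * E.lineS (ζ ^ 2)) (H := .X 0 ^ 3)
      (((MvPolynomial.isHomogeneous_C _ _).mul (lineS_isHomogeneous.pow 2)).mul
        lineS_isHomogeneous) ((MvPolynomial.isHomogeneous_X _ _).pow 3) (by simp)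
    convert this using 1
    simp
    linear_combination (27 * ζ * (ζ ^ 2 - ζ) ^ 2) * hζ.pow_eq_one
  · have hO := E.form_lineO_ne_zero
    have hX := E.form_X_ne_zero
    have h := form_lineO_mul (E := E) hζ
    simp only [map_neg, map_add, map_pow, map_ofNat] at h
    simp only [form_mul, form_pow, form_C]
    simp only [funS, coordRatio, map_neg, map_one, map_add, map_pow,
      map_ofNat, zpow_neg]
    have h2 := hX 2
    have h0 := hX 0
    rw [show ((3 : ℤ)) = ((3 : ℕ) : ℤ) by rfl, zpow_natCast]
    field_simp
    linear_combination E.form (E.lineS ζ) * h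

/-- The pole of `f_T` at `O` comes from the denominator, which `form_lineO_mul` expresses by `Z³` and
the tangents at the other two flexes on `Z = 0`. -/
lemma hasLeadingTerm_funT_zero (hζ : IsPrimitiveRoot ζ 3) :
    HasLeadingTerm E.funT (E.coordRatio 0 2) 0 (-3) ((-3) ^ 3) := by
  have h3 := E.three_ne_zero
  have hl := E.lam_add_three_ne_zero
  have hz := sq_add_self_add_one hζ
  refine ⟨pow_ne_zero 3 (neg_ne_zero.2 h3),
    E.form (.C (-(E.lam + 3)⁻¹) * E.lineT * E.lineS ζ * E.lineS (ζ ^ 2)) /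
    E.form (.X 0 ^ 3), ?_, ?_⟩
  · have := HasValue.of_isCoord (isCoord_zero (E := E)) (d := 3)
      (G := .C (-(E.lam + 3)⁻¹) * E.lineT * E.lineS ζ * E.lineS (ζ ^ 2)) (H := .X 0 ^ 3)
      ((((MvPolynomial.isHomogeneous_C _ _).mul lineT_isHomogeneous).mul lineS_isHomogeneous).mul
        lineS_isHomogeneous) ((MvPolynomial.isHomogeneous_X _ _).pow 3) (by simp)
    convert this using 1
    simp
    have e : (3 * ζ ^ 2 - 3 * ζ) * (3 * (ζ ^ 2) ^ 2 - 3 * ζ ^ 2) = 27 := by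
      linear_combination 9 * (ζ ^ 3 - ζ ^ 2 - ζ + 2) * hζ.pow_eq_one - 9 * hz
    have hinv : (E.lam + 3)⁻¹ * (E.lam + 3) = 1 := inv_mul_cancel₀ hl
    linear_combination -(E.lam + 3)⁻¹ * (3 + E.lam) * (-e) + 27 * hinv
  · have hO := E.form_lineO_ne_zero
    have hX := E.form_X_ne_zero
    have h := form_lineO_mul (E := E) hζ
    simp only [map_neg, map_add, map_pow, map_ofNat] at h
    simp only [form_mul, form_pow, form_C]
    have hl' := (map_ne_zero (algebraMap L E.FunctionField)).2 hl
    simp only [funT, coordRatio, map_neg, map_inv₀, map_add, map_sub, map_mul, map_pow,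
      map_ofNat, zpow_neg] at hl' ⊢
    have h2 := hX 2
    have h0 := hX 0
    rw [show ((3 : ℤ)) = ((3 : ℕ) : ℤ) by rfl, zpow_natCast]
    field_simp
    linear_combination E.form E.lineT * h

lemma hasLeadingTerm_funS_pointS (hζ : IsPrimitiveRoot ζ 3) :
    ∃ c, HasLeadingTerm (E.funS ζ) (E.coordRatio 0 2) (E.pointS ζ hζ.pow_eq_one) 3 c := by
  have hζ0 := hζ.ne_zero (by norm_num)
  have h1 : 1 - ζ ≠ 0 := sub_ne_zero.2 (hζ.ne_one (by norm_num)).symm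
  have h3 := E.three_ne_zero
  have ha := isCoord_pointS (E := E) ζ hζ.pow_eq_one
  have hH : MvPolynomial.eval ![1, -ζ, 0] (E.lineO ^ 2 * E.lineS (ζ ^ 2)) ≠ 0 := by
      have e1 : 3 + -(3 * ζ) ≠ 0 := by
        rw [show 3 + -(3 * ζ) = 3 * (1 - ζ) by ring]
        exact mul_ne_zero h3 h1
      have e2 : 3 * (ζ ^ 2) ^ 2 + -(3 * ζ ^ 2 * ζ) ≠ 0 := by
        rw [show 3 * (ζ ^ 2) ^ 2 + -(3 * ζ ^ 2 * ζ) = -(3 * ζ ^ 3 * (1 - ζ)) by ring]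
        exact neg_ne_zero.2 (mul_ne_zero (mul_ne_zero h3 (pow_ne_zero 3 hζ0)) h1)
      simpa using ⟨e1, e2⟩
  have hv := HasValue.of_isCoord ha (d := 3)
    (G := .C (-(E.lam ^ 3 + 27) ^ 2) * .X 0 ^ 3) (H := E.lineO ^ 2 * E.lineS (ζ ^ 2))
    ((MvPolynomial.isHomogeneous_C _ _).mul ((MvPolynomial.isHomogeneous_X _ _).pow 3))
    ((lineO_isHomogeneous.pow 2).mul lineS_isHomogeneous) hH
  refine ⟨_, ?_, _, hv, ?_⟩
  · refine div_ne_zero ?_ hH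
    simpa using E.smooth
  · have hO := E.form_lineO_ne_zero
    have h2 := E.form_X_ne_zero 2
    have h0 := E.form_X_ne_zero 0
    have h := form_lineO_mul (E := E) hζ
    have hH' := form_ne_zero (E := E) ((lineO_isHomogeneous.pow 2).mul lineS_isHomogeneous)
      (fun h => hH ((ha.eval_eq_zero_iff ((lineO_isHomogeneous.pow 2).mul
        lineS_isHomogeneous)).2 h))
    rw [form_mul, form_pow] at hH'
    have hS' := right_ne_zero_of_mul hH'
    simp only [form_mul, form_pow, form_C, funS, coordRatio]
    simp only [map_neg, map_add, map_pow, map_ofNat] at h ⊢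
    rw [show ((3 : ℤ)) = ((3 : ℕ) : ℤ) by rfl, zpow_natCast]
    field_simp
    linear_combination (algebraMap L E.FunctionField E.lam ^ 3 + 27) * h

lemma hasLeadingTerm_funT_pointT (hζ : IsPrimitiveRoot ζ 3) :
    ∃ c, HasLeadingTerm E.funT (E.coordRatio 0 1) E.pointT 3 c := by
  have hl := E.lam_add_three_ne_zero
  have hc := E.three_mul_sub_ne_zero hζ
  have hz := sq_add_self_add_one hζ
  have ha := isCoord_pointT (E := E)
  have hT' : ∀ z, (E.lineT' z).IsHomogeneous 1 := fun z => isHomogeneous_linear _ _ _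
  have hhom := (lineO_isHomogeneous (E := E)).mul ((hT' ζ).mul (hT' (ζ ^ 2)))
  have hH : MvPolynomial.eval ![1, 0, -1] (E.lineO * (E.lineT' ζ * E.lineT' (ζ ^ 2))) ≠ 0 := by
    have e1 : 3 + E.lam ≠ 0 := by rwa [add_comm]
    have e2 : 3 * (ζ ^ 2) ^ 2 + -(3 * ζ ^ 2) ≠ 0 := by
      rw [show 3 * (ζ ^ 2) ^ 2 + -(3 * ζ ^ 2) = -(3 * ζ ^ 2 - 3 * ζ) by
        linear_combination 3 * ζ * hζ.pow_eq_one]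
      exact neg_ne_zero.2 hc
    rw [sub_eq_add_neg] at hc
    simpa [lineT'] using ⟨e1, hc, e2⟩
  have hv := HasValue.of_isCoord ha (d := 3)
    (G := .C (-((E.lam ^ 2 - 3 * E.lam + 9) * (E.lam ^ 3 + 27))) * .X 0 ^ 3)
    (H := E.lineO * (E.lineT' ζ * E.lineT' (ζ ^ 2)))
    ((MvPolynomial.isHomogeneous_C _ _).mul ((MvPolynomial.isHomogeneous_X _ _).pow 3)) hhom hH
  refine ⟨_, ?_, _, hv, ?_⟩
  · refine div_ne_zero ?_ hH
    simpa using ⟨E.lineT_const_ne_zero, E.smooth⟩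
  · have hO := E.form_lineO_ne_zero
    have h0 := E.form_X_ne_zero 0
    have h := form_lineT_mul (E := E) hζ
    have hH' := form_ne_zero (E := E) hhom (fun h => hH ((ha.eval_eq_zero_iff hhom).2 h))
    rw [form_mul, form_mul] at hH'
    have h1' := left_ne_zero_of_mul (right_ne_zero_of_mul hH')
    have h2' := right_ne_zero_of_mul (right_ne_zero_of_mul hH')
    simp only [form_mul, form_pow, form_C, funT, coordRatio]
    simp only [map_neg, map_add, map_mul, map_sub, map_pow, map_ofNat] at h ⊢
    rw [show ((3 : ℤ)) = ((3 : ℕ) : ℤ) by rfl, zpow_natCast]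
    field_simp
    linear_combination (algebraMap L E.FunctionField E.lam ^ 2 -
      3 * algebraMap L E.FunctionField E.lam + 9) * h

namespace HasLeadingTerm

variable {f t t' : E.FunctionField} {P : E.Point}

/-- Changing the local parameter multiplies the leading coefficient of a triple pole by a cube. -/
lemma exists_cube {c : L} (h : HasLeadingTerm f t' P (-3) (c ^ 3)) (ht' : IsParameter t' P)
    (h0 : t' ≠ 0) (ht : IsParameter t P) : ∃ c, HasLeadingTerm f t P (-3) (c ^ 3) := by
  obtain ⟨hc, u, hu, rfl⟩ := h
  obtain ⟨g, v, hg, e⟩ := ht'.2 t ht.1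
  obtain ⟨g', v', hg', e'⟩ := ht.2 t' ht'.1
  have hgg : g' * g = 1 := by
    refine mul_left_cancel₀ h0 ?_
    linear_combination -e' - g' * e
  have hvv : v' * v = 1 := (hg'.mul hg).unique (by
    rw [hgg]
    simpa using HasValue.const (E := E) 1 P)
  have hv : v ≠ 0 := right_ne_zero_of_mul_eq_one hvv
  have hg0 : g ≠ 0 := right_ne_zero_of_mul_eq_one hgg
  refine ⟨v * c, ?_, g ^ 3 * u, ?_, ?_⟩
  · rw [mul_pow]; exact mul_ne_zero (pow_ne_zero 3 hv) hc
  · rw [mul_pow]; exact (hg.pow 3).mul hu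
  · rw [e, mul_zpow, ← mul_assoc, mul_assoc (t' ^ (-3 : ℤ)), zpow_neg g,
      show (3 : ℤ) = ((3 : ℕ) : ℤ) by rfl, zpow_natCast, inv_mul_cancel₀ (pow_ne_zero 3 hg0),
      mul_one]

/-- A function with a pole has no value. -/
lemma not_hasValue {c : L} (h : HasLeadingTerm f t P (-3) c) (ht : HasValue t P 0) (h0 : t ≠ 0)
    (v : L) : ¬ HasValue f P v := by
  intro hv
  obtain ⟨hc, u, hu, rfl⟩ := h
  have := (ht.pow 3).mul hv
  rw [← mul_assoc, ← zpow_natCast, ← zpow_add₀ h0] at this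
  exact hc (hu.unique (by simpa using this))

end HasLeadingTerm

lemma hasOrder_zero_of_hasValue {f : E.FunctionField} {P : E.Point} {v : L} (h : HasValue f P v)
    (hv : v ≠ 0) : HasOrder f P 0 := by
  obtain ⟨t, ht⟩ := E.exists_isParameter P
  exact ⟨t, v, ht, hv, f, h, by simp⟩

lemma pointS_ne_zero (hζ : IsPrimitiveRoot ζ 3) : E.pointS ζ hζ.pow_eq_one ≠ 0 := by
  intro h
  have ha := isCoord_pointS (E := E) ζ hζ.pow_eq_one
  rw [h] at ha
  have := ha.lineO_eq_zero
  simp at this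
  have h1 : (3 : L) * (1 - ζ) = 0 := by linear_combination this
  exact mul_ne_zero E.three_ne_zero (sub_ne_zero.2 (hζ.ne_one (by norm_num)).symm) h1

lemma pointT_ne_zero : E.pointT ≠ 0 := by
  intro h
  have ha := isCoord_pointT (E := E)
  rw [h] at ha
  have := ha.lineO_eq_zero
  simp at this
  exact E.lam_add_three_ne_zero (by linear_combination this)

theorem hasDivisor_funS (hζ : IsPrimitiveRoot ζ 3) : HasDivisor (E.funS ζ)
    (Finsupp.single (E.pointS ζ hζ.pow_eq_one) 3 - Finsupp.single 0 3) := by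
  classical
  intro P
  have hS := E.pointS_ne_zero hζ
  rw [Finsupp.sub_apply, Finsupp.single_apply, Finsupp.single_apply]
  by_cases h0 : P = 0
  · subst h0
    rw [if_neg hS, if_pos rfl]
    exact ⟨_, _, isParameter_zero, hasLeadingTerm_funS_zero hζ⟩
  by_cases h : P = E.pointS ζ hζ.pow_eq_one
  · subst h
    rw [if_pos rfl, if_neg (Ne.symm h0)]
    obtain ⟨c, hc⟩ := hasLeadingTerm_funS_pointS (E := E) hζ
    exact ⟨_, _, isParameter_pointS _, hc⟩
  · rw [if_neg (Ne.symm h), if_neg (Ne.symm h0)]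
    exact hasOrder_zero_of_hasValue ((isCoord_coords P).hasValue_funS h0)
      (mul_ne_zero E.smooth (div_ne_zero ((isCoord_coords P).lineS_ne_zero hζ h)
        ((isCoord_coords P).lineO_ne_zero h0)))

theorem hasDivisor_funT (hζ : IsPrimitiveRoot ζ 3) : HasDivisor E.funT
    (Finsupp.single E.pointT 3 - Finsupp.single 0 3) := by
  classical
  intro P
  have hS := E.pointT_ne_zero
  rw [Finsupp.sub_apply, Finsupp.single_apply, Finsupp.single_apply]
  by_cases h0 : P = 0
  · subst h0
    rw [if_neg hS, if_pos rfl]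
    exact ⟨_, _, isParameter_zero, hasLeadingTerm_funT_zero hζ⟩
  by_cases h : P = E.pointT
  · subst h
    rw [if_pos rfl, if_neg (Ne.symm h0)]
    obtain ⟨c, hc⟩ := hasLeadingTerm_funT_pointT (E := E) hζ
    exact ⟨_, _, isParameter_pointT, hc⟩
  · rw [if_neg (Ne.symm h), if_neg (Ne.symm h0)]
    exact hasOrder_zero_of_hasValue ((isCoord_coords P).hasValue_funT h0)
      (mul_ne_zero E.lineT_const_ne_zero (div_ne_zero ((isCoord_coords P).lineT_ne_zero hζ h)
        ((isCoord_coords P).lineO_ne_zero h0)))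

/-! ### Cube roots of the descent functions, and the Weil pairing -/

/-- The form `XYZ`, whose zeros on the cubic are the `3`-torsion points. -/
def formXYZ : MvPolynomial (Fin 3) L := .X 0 * .X 1 * .X 2

lemma formXYZ_isHomogeneous : (formXYZ : MvPolynomial (Fin 3) L).IsHomogeneous 3 :=
  ((MvPolynomial.isHomogeneous_X _ _).mul (MvPolynomial.isHomogeneous_X _ _)).mul
    (MvPolynomial.isHomogeneous_X _ _)

@[simp] lemma eval_formXYZ (a : Fin 3 → L) : MvPolynomial.eval a formXYZ = a 0 * a 1 * a 2 := by
  simp [formXYZ]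

lemma form_formXYZ_ne_zero : E.form formXYZ ≠ 0 := by
  rw [formXYZ, form_mul, form_mul]
  exact mul_ne_zero (mul_ne_zero (form_X_ne_zero 0) (form_X_ne_zero 1)) (form_X_ne_zero 2)

/-- The value of `N / XYZ` at a point, for a cubic form `N`. It is `0` at `3`-torsion points. -/
def ratio (N : MvPolynomial (Fin 3) L) (P : E.Point) : L :=
  MvPolynomial.eval P.coords N / MvPolynomial.eval P.coords formXYZ

lemma IsCoord.ratio_eq {P : E.Point} {a : Fin 3 → L} (ha : IsCoord P a)
    {N : MvPolynomial (Fin 3) L} (hN : N.IsHomogeneous 3) :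
    ratio N P = MvPolynomial.eval a N / (a 0 * a 1 * a 2) := by
  rw [ratio, ← ha.eval_div_eval hN formXYZ_isHomogeneous, eval_formXYZ]

lemma eval_formXYZ_eq_zero_iff (P : E.Point) :
    MvPolynomial.eval P.coords formXYZ = 0 ↔ 3 • P = 0 := by
  rw [eval_formXYZ, (isCoord_coords P).three_nsmul_eq_zero_iff]

/-- The function `f` has divisor `3 (B) - 3 (O)`, and `N / XYZ` is a cube root of `f ∘ [3]`. -/
structure IsKummer (f : E.FunctionField) (B : E.Point) (N : MvPolynomial (Fin 3) L) : Prop where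
  isHomogeneous : N.IsHomogeneous 3
  hasDivisor : HasDivisor f (Finsupp.single B 3 - Finsupp.single 0 3)
  torsion : 3 • B = 0
  hasValue : ∀ Q : E.Point, 3 • Q ≠ 0 → HasValue f (3 • Q) (ratio N Q ^ 3)
  not_hasValue : ∀ v, ¬ HasValue f 0 v
  eval_ne_zero : ∀ Q : E.Point, 3 • Q = 0 → MvPolynomial.eval Q.coords N ≠ 0

/-- Translation by `A` multiplies the function `N / XYZ` by `ξ`. -/
def IsMultiplier (N : MvPolynomial (Fin 3) L) (A : E.Point) (ξ : L) : Prop :=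
  ∀ Q : E.Point, ratio N (Q + A) = ξ * ratio N Q

namespace IsMultiplier

variable {N : MvPolynomial (Fin 3) L} {A B : E.Point} {ξ η : L}

lemma zero : IsMultiplier N (0 : E.Point) 1 := fun Q => by rw [add_zero, one_mul]

lemma add (h : IsMultiplier N A ξ) (h' : IsMultiplier N B η) :
    IsMultiplier N (A + B) (ξ * η) := fun Q => by
  rw [← add_assoc, h', h]
  ring

lemma nsmul (h : IsMultiplier N A ξ) (n : ℕ) : IsMultiplier N (n • A) (ξ ^ n) := by
  induction n with
  | zero => simpa using zero
  | succ n ih => rw [succ_nsmul, pow_succ]; exact ih.add h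

lemma unique (h : IsMultiplier N A ξ) (h' : IsMultiplier N A η) {Q : E.Point}
    (hQ : ratio N Q ≠ 0) : ξ = η := mul_right_cancel₀ hQ ((h Q).symm.trans (h' Q))

end IsMultiplier

namespace IsKummer

variable {f : E.FunctionField} {B : E.Point} {N : MvPolynomial (Fin 3) L}

lemma hasValue_div (h : IsKummer f B N) {Q : E.Point} (hQ : 3 • Q ≠ 0) :
    HasValue (E.form N / E.form formXYZ) Q (ratio N Q) :=
  ⟨3, N, formXYZ, h.isHomogeneous, formXYZ_isHomogeneous,
    fun h0 => hQ ((eval_formXYZ_eq_zero_iff Q).1 h0), rfl, rfl⟩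

/-- The function `N / XYZ` has poles at the `3`-torsion points. -/
lemma not_hasValue_div (h : IsKummer f B N) {Q : E.Point} (hQ : 3 • Q = 0) (v : L) :
    ¬ HasValue (E.form N / E.form formXYZ) Q v := by
  intro hv
  have hX : ∀ i, ((.X i : MvPolynomial (Fin 3) L) ^ 3).IsHomogeneous 3 := fun i =>
    (MvPolynomial.isHomogeneous_X L i).pow 3
  obtain ⟨i, hi⟩ : ∃ i, Q.coords i ≠ 0 := by
    by_contra! h0
    exact (isCoord_coords Q).ne_zero (funext h0)
  have hXi : MvPolynomial.eval Q.coords (.X i ^ 3) ≠ 0 := by simpa using hi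
  have h1 := HasValue.of_isCoord (isCoord_coords Q) formXYZ_isHomogeneous (hX i) hXi
  have h2 := HasValue.of_isCoord (isCoord_coords Q) h.isHomogeneous (hX i) hXi
  rw [(eval_formXYZ_eq_zero_iff Q).2 hQ, zero_div] at h1
  have h3 := hv.mul h1
  rw [div_mul_div_cancel₀ form_formXYZ_ne_zero] at h3
  have := h2.unique h3
  rw [mul_zero, div_eq_zero_iff] at this
  exact this.elim (h.eval_ne_zero Q hQ) hXi

theorem compThreeEqCube (h : IsKummer f B N) :
    CompThreeEqCube f (E.form N / E.form formXYZ) := by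
  intro Q v w hv hw
  by_cases hQ : 3 • Q = 0
  · rw [hQ] at hw
    exact (h.not_hasValue w hw).elim
  · rw [hv.unique (h.hasValue_div hQ), hw.unique (h.hasValue Q hQ)]

/-- The Weil pairing with `B` is the multiplier of `N / XYZ` under translation. -/
theorem isWeilPairing (h : IsKummer f B N) {A : E.Point} (hA : 3 • A = 0) {ξ : L}
    (hξ : IsMultiplier N A ξ) : IsWeilPairing A B ξ := by
  refine ⟨hA, h.torsion, f, _, h.hasDivisor, h.compThreeEqCube, fun Q v w hv hw => ?_⟩
  by_cases hQ : 3 • Q = 0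
  · exact (h.not_hasValue_div hQ v hv).elim
  · have hQA : 3 • (Q + A) ≠ 0 := by rwa [nsmul_add, hA, add_zero]
    rw [hv.unique (h.hasValue_div hQ), hw.unique (h.hasValue_div hQA), hξ]

end IsKummer

/-- The form `-(X³ + ζ²Y³ + ζZ³)`. -/
def numS (ζ : L) : MvPolynomial (Fin 3) L :=
  -(.X 0 ^ 3 + .C (ζ ^ 2) * .X 1 ^ 3 + .C ζ * .X 2 ^ 3)

/-- The form `XY² + YZ² + ZX²`. -/
def numT : MvPolynomial (Fin 3) L :=
  .X 1 ^ 2 * .X 0 + .X 2 ^ 2 * .X 1 + .X 0 ^ 2 * .X 2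

lemma numS_isHomogeneous : (numS ζ).IsHomogeneous 3 := by
  have h := fun i => (MvPolynomial.isHomogeneous_X L (i : Fin 3)).pow 3
  exact (((h 0).add ((h 1).C_mul _)).add ((h 2).C_mul _)).neg

lemma numT_isHomogeneous : (numT : MvPolynomial (Fin 3) L).IsHomogeneous 3 := by
  have h := fun i j => ((MvPolynomial.isHomogeneous_X L (i : Fin 3)).pow 2).mul
    (MvPolynomial.isHomogeneous_X L (j : Fin 3))
  exact ((h 1 0).add (h 2 1)).add (h 0 2)

@[simp] lemma eval_numS (a : Fin 3 → L) : MvPolynomial.eval a (numS ζ) =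
    -(a 0 ^ 3 + ζ ^ 2 * a 1 ^ 3 + ζ * a 2 ^ 3) := by
  simp [numS]

@[simp] lemma eval_numT (a : Fin 3 → L) : MvPolynomial.eval a numT =
    a 1 ^ 2 * a 0 + a 2 ^ 2 * a 1 + a 0 ^ 2 * a 2 := by
  simp [numT]

theorem isKummer_funS (hζ : IsPrimitiveRoot ζ 3) :
    IsKummer (E.funS ζ) (E.pointS ζ hζ.pow_eq_one) (numS ζ) where
  isHomogeneous := numS_isHomogeneous
  hasDivisor := hasDivisor_funS hζ
  torsion := three_nsmul_pointS _
  hasValue Q hQ := by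
    have ha := isCoord_coords Q
    have h := ha.three_nsmul.hasValue_funS (ζ := ζ) hQ
    rw [ha.lineS_triVec hζ, ha.lineO_triVec] at h
    have ht : Q.coords 0 * Q.coords 1 * Q.coords 2 ≠ 0 := fun h0 =>
      hQ (ha.three_nsmul_eq_zero_iff.2 h0)
    convert h using 1
    rw [ratio, eval_numS, eval_formXYZ]
    have hs := E.smooth
    rw [div_pow, mul_div_assoc', div_eq_div_iff (pow_ne_zero 3 ht)
      (mul_ne_zero (neg_ne_zero.2 hs) (pow_ne_zero 3 ht))]
    ring
  not_hasValue := (hasLeadingTerm_funS_zero hζ).not_hasValue isParameter_zero.1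
    (coordRatio_ne_zero 0 2)
  eval_ne_zero Q hQ := by
    have ha := isCoord_coords Q
    have hF := ha.equation
    have hζ0 := hζ.ne_zero (by norm_num)
    have hζ1 := sub_ne_zero.2 (hζ.ne_one (by norm_num))
    have h2 : ζ ^ 2 - 1 ≠ 0 := by
      intro h
      exact hζ1 (by linear_combination hζ.pow_eq_one - ζ * h)
    have n01 := fun h h' => ha.eq_zero_of (by decide : (0 : Fin 3) ≠ 1) h h'
    have n02 := fun h h' => ha.eq_zero_of (by decide : (0 : Fin 3) ≠ 2) h h'
    have n12 := fun h h' => ha.eq_zero_of (by decide : (1 : Fin 3) ≠ 2) h h'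
    rw [eval_numS, neg_ne_zero]
    rcases mul_eq_zero.1 (ha.three_nsmul_eq_zero_iff.1 hQ) with h | hz
    · rcases mul_eq_zero.1 h with hz | hz
      · rw [hz] at hF
        rw [hz, show (0 : L) ^ 3 + ζ ^ 2 * Q.coords 1 ^ 3 + ζ * Q.coords 2 ^ 3 =
          ζ * (ζ - 1) * Q.coords 1 ^ 3 by linear_combination ζ * hF]
        exact mul_ne_zero (mul_ne_zero hζ0 hζ1) (pow_ne_zero 3 (n01 hz))
      · rw [hz] at hF
        rw [hz, show Q.coords 0 ^ 3 + ζ ^ 2 * 0 ^ 3 + ζ * Q.coords 2 ^ 3 =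
          (ζ - 1) * Q.coords 2 ^ 3 by linear_combination hF]
        exact mul_ne_zero hζ1 (pow_ne_zero 3 (n12 hz))
    · rw [hz] at hF
      rw [hz, show Q.coords 0 ^ 3 + ζ ^ 2 * Q.coords 1 ^ 3 + ζ * 0 ^ 3 =
          (ζ ^ 2 - 1) * Q.coords 1 ^ 3 by linear_combination hF]
      exact mul_ne_zero h2 (pow_ne_zero 3 fun h => n12 h hz)

theorem isKummer_funT (hζ : IsPrimitiveRoot ζ 3) :
    IsKummer E.funT E.pointT numT where
  isHomogeneous := numT_isHomogeneous
  hasDivisor := hasDivisor_funT hζ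
  torsion := three_nsmul_pointT
  hasValue Q hQ := by
    have ha := isCoord_coords Q
    have h := ha.three_nsmul.hasValue_funT hQ
    rw [ha.lineT_triVec, ha.lineO_triVec] at h
    have ht : Q.coords 0 * Q.coords 1 * Q.coords 2 ≠ 0 := fun h0 =>
      hQ (ha.three_nsmul_eq_zero_iff.2 h0)
    convert h using 1
    rw [ratio, eval_numT, eval_formXYZ]
    have hs := E.smooth
    rw [div_pow, mul_div_assoc', div_eq_div_iff (pow_ne_zero 3 ht)
      (mul_ne_zero (neg_ne_zero.2 hs) (pow_ne_zero 3 ht))]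
    ring
  not_hasValue := (hasLeadingTerm_funT_zero hζ).not_hasValue isParameter_zero.1
    (coordRatio_ne_zero 0 2)
  eval_ne_zero Q hQ := by
    have ha := isCoord_coords Q
    have n01 := fun h h' => ha.eq_zero_of (by decide : (0 : Fin 3) ≠ 1) h h'
    have n02 := fun h h' => ha.eq_zero_of (by decide : (0 : Fin 3) ≠ 2) h h'
    have n12 := fun h h' => ha.eq_zero_of (by decide : (1 : Fin 3) ≠ 2) h h'
    rw [eval_numT]
    rcases mul_eq_zero.1 (ha.three_nsmul_eq_zero_iff.1 hQ) with h | hz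
    · rcases mul_eq_zero.1 h with hz | hz
      · simpa [hz] using ⟨n02 hz, n01 hz⟩
      · simpa [hz] using ⟨fun h => n01 h hz, n12 hz⟩
    · simpa [hz] using ⟨fun h => n12 h hz, fun h => n02 h hz⟩

lemma isMultiplier_numS_pointS (hζ : ζ ^ 3 = 1) :
    IsMultiplier (numS ζ) (E.pointS ζ hζ) 1 := by
  intro Q
  have ha := isCoord_coords Q
  rw [ha.ratio_eq numS_isHomogeneous, (ha.add_pointS hζ).ratio_eq numS_isHomogeneous, one_mul]
  congr 1
  · simp
    linear_combination (-ζ ^ 2 * Q.coords 1 ^ 3 - ζ * Q.coords 2 ^ 3 * (ζ ^ 3 + 1)) * hζ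
  · simp
    linear_combination (Q.coords 0 * Q.coords 1 * Q.coords 2) * hζ

lemma isMultiplier_numS_pointT (hζ : ζ ^ 3 = 1) :
    IsMultiplier (numS ζ) E.pointT ζ := by
  intro Q
  have ha := isCoord_coords Q
  rw [ha.ratio_eq numS_isHomogeneous, ha.add_pointT.ratio_eq numS_isHomogeneous, ← mul_div_assoc]
  congr 1
  · simp
    linear_combination Q.coords 1 ^ 3 * hζ
  · simp
    ring

lemma isMultiplier_numT_pointS (hζ : ζ ^ 3 = 1) :
    IsMultiplier numT (E.pointS ζ hζ) (ζ ^ 2) := by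
  intro Q
  have ha := isCoord_coords Q
  rw [ha.ratio_eq numT_isHomogeneous, (ha.add_pointS hζ).ratio_eq numT_isHomogeneous,
    ← mul_div_assoc]
  congr 1
  · simp
    linear_combination ζ ^ 2 * Q.coords 2 ^ 2 * Q.coords 1 * hζ
  · simp
    linear_combination (Q.coords 0 * Q.coords 1 * Q.coords 2) * hζ

lemma isMultiplier_numT_pointT : IsMultiplier numT E.pointT 1 := by
  intro Q
  have ha := isCoord_coords Q
  rw [ha.ratio_eq numT_isHomogeneous, ha.add_pointT.ratio_eq numT_isHomogeneous, one_mul]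
  congr 1
  · simp
    ring
  · simp
    ring

lemma IsMultiplier.neg {N : MvPolynomial (Fin 3) L} {A : E.Point} {ξ : L}
    (h : IsMultiplier N A ξ) (hξ : ξ ≠ 0) : IsMultiplier N (-A) ξ⁻¹ :=
  fun Q => by
  have := h (Q + -A)
  rw [neg_add_cancel_right] at this
  rw [this, inv_mul_cancel_left₀ hξ]

/-- The multiplier of `m S + n T` for the function belonging to `S`. -/
lemma isMultiplier_numS (hζ : ζ ^ 3 = 1) (m n : ℕ) :
    IsMultiplier (numS ζ) (m • E.pointS ζ hζ + n • E.pointT) (ζ ^ n) := by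
  simpa using ((isMultiplier_numS_pointS hζ).nsmul m).add ((isMultiplier_numS_pointT hζ).nsmul n)

/-- The multiplier of `m S + n T` for the function belonging to `T`. -/
lemma isMultiplier_numT (hζ : ζ ^ 3 = 1) (m n : ℕ) :
    IsMultiplier numT (m • E.pointS ζ hζ + n • E.pointT) ((ζ ^ 2) ^ m) := by
  simpa using ((isMultiplier_numT_pointS hζ).nsmul m).add (isMultiplier_numT_pointT.nsmul n)

/-! ### Change of field -/

lemma isCoord_map {M : Type*} [Field M] {E' : HesseCubic M} (φ : L →+* M) (h : φ E.lam = E'.lam)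
    {P : E.Point} {a : Fin 3 → L} (ha : IsCoord P a) : IsCoord (P.map φ h) (fun i => φ (a i)) := by
  obtain ⟨c, hc, rfl⟩ := ha
  have h1 : IsCoord (P.map φ h) (fun i => φ (P.coords i)) := isCoord_mk _ _
  convert h1.smul ((map_ne_zero φ).2 hc) using 1
  funext i
  simp

lemma map_k {M : Type*} [Field M] {E' : HesseCubic M} (φ : L →+* M) (h : φ E.lam = E'.lam) :
    φ E.k = E'.k := by
  simp only [k, map_div₀, map_add, map_pow, map_ofNat, h]

lemma map_weierstrass {M : Type*} [Field M] {E' : HesseCubic M} (φ : L →+* M)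
    (h : φ E.lam = E'.lam) : E.weierstrass.map φ = E'.weierstrass := by
  ext <;> simp only [weierstrass, WeierstrassCurve.map, map_div₀, map_neg, map_mul, map_pow,
    map_ofNat, h, map_k φ h]

lemma nonsingular_map {M : Type*} [Field M] {E' : HesseCubic M} (φ : L →+* M)
    (h : φ E.lam = E'.lam) {x y : L} (hxy : E.weierstrass.Nonsingular x y) :
    E'.weierstrass.Nonsingular (φ x) (φ y) := by
  rw [← map_weierstrass φ h]
  exact (WeierstrassCurve.Affine.map_nonsingular _ φ.injective _ _).2 hxy

namespace Point

variable {M : Type*} [Field M] {E' : HesseCubic M} (φ : L →+* M) (h : φ E.lam = E'.lam)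

@[simp] lemma map_zero : (0 : E.Point).map φ h = 0 := by
  refine (isCoord_map φ h isCoord_zero).eq ?_
  convert isCoord_zero (E := E') using 1
  funext i
  fin_cases i <;> simp

lemma map_ofWeierstrass {x y : L} (hxy : E.weierstrass.Nonsingular x y) :
    (E.ofWeierstrass (.some x y hxy)).map φ h =
      E'.ofWeierstrass (.some (φ x) (φ y) (nonsingular_map φ h hxy)) := by
  refine (isCoord_map φ h (isCoord_ofWeierstrass (.some x y hxy))).eq ?_
  convert isCoord_ofWeierstrass (E := E') _ using 1
  funext i
  fin_cases i <;> simp [weierstrassCoords, affineCoords, h, map_k φ h, map_ofNat φ 3]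

/-- The group law is given by formulas with coefficients in the prime field and `lam`. -/
theorem map_add (P Q : E.Point) : (P + Q).map φ h = P.map φ h + Q.map φ h := by
  classical
  obtain ⟨p, rfl⟩ := E.ofWeierstrass_bijective.2 P
  obtain ⟨q, rfl⟩ := E.ofWeierstrass_bijective.2 Q
  rcases p with _ | ⟨x, y, hp⟩
  · change (0 + E.ofWeierstrass q).map φ h = (0 : E.Point).map φ h + _
    rw [zero_add, map_zero, zero_add]
  rcases q with _ | ⟨x', y', hq⟩
  · change (_ + 0 : E.Point).map φ h = _ + (0 : E.Point).map φ h
    rw [add_zero, map_zero, add_zero]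
  rw [map_ofWeierstrass, map_ofWeierstrass, ← ofWeierstrass_add, ← ofWeierstrass_add]
  have hW := map_weierstrass φ h
  by_cases hxy : x = x' ∧ y = E.weierstrass.negY x' y'
  · rw [WeierstrassCurve.Affine.Point.add_of_Y_eq hxy.1 hxy.2,
      WeierstrassCurve.Affine.Point.add_of_Y_eq (congrArg φ hxy.1)]
    · exact map_zero φ h
    · rw [hxy.2, ← hW, WeierstrassCurve.Affine.map_negY]
  · rw [WeierstrassCurve.Affine.Point.add_some hxy, map_ofWeierstrass,
      WeierstrassCurve.Affine.Point.add_some]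
    · congr 2
      · rw [← hW, WeierstrassCurve.Affine.map_slope, WeierstrassCurve.Affine.map_addX]
      · rw [← hW, WeierstrassCurve.Affine.map_slope, WeierstrassCurve.Affine.map_addY]
    · rw [← hW, WeierstrassCurve.Affine.map_negY]
      exact fun h' => hxy ⟨φ.injective h'.1, φ.injective h'.2⟩

/-- A field homomorphism applied to the coordinates, as a homomorphism of groups. -/
def mapHom : E.Point →+ E'.Point where
  toFun P := P.map φ h
  map_zero' := map_zero φ h
  map_add' := map_add φ h

lemma map_injective : Function.Injective (fun P : E.Point => P.map φ h) := by
  refine (injective_iff_map_eq_zero (mapHom φ h)).2 fun P hP => ?_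
  have ha := isCoord_coords P
  have h1 : IsCoord (P.map φ h) _ := isCoord_map φ h ha
  have h2 : P.map φ h = 0 := hP
  rw [h2] at h1
  refine ha.eq_zero_of_lineO ?_
  have h3 := h1.lineO_eq_zero
  apply φ.injective
  simpa [← h, map_ofNat φ 3] using h3

end Point

end

variable {K : Type*} [Field K] {E : HesseCubic K} {ζ : K}

/-! ### Galois action -/

variable (E) in
/-- The inclusion of `E(K)` in the group of geometric points. -/
def toGeomHom : E.Point →+ E.geom.Point :=
  Point.mapHom (E' := E.geom) (algebraMap K (AlgebraicClosure K)) rfl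

variable (E) in
/-- The action of a Galois automorphism on the group of geometric points. -/
def galoisHom (σ : AlgebraicClosure K ≃ₐ[K] AlgebraicClosure K) : E.geom.Point →+ E.geom.Point :=
  Point.mapHom (E := E.geom) (E' := E.geom) (RingHomClass.toRingHom σ) (σ.commutes E.lam)

lemma toGeom_eq (P : E.Point) : E.toGeom P = E.toGeomHom P := rfl

lemma toGeom_injective : Function.Injective E.toGeomHom :=
  Point.map_injective (E' := E.geom) _ rfl

lemma IsCoord.toGeom {P : E.Point} {a : Fin 3 → K} (ha : IsCoord P a) :
    IsCoord (E.toGeomHom P) (fun i => algebraMap K (AlgebraicClosure K) (a i)) :=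
  isCoord_map (E' := E.geom) _ rfl ha

lemma IsCoord.galois (σ : AlgebraicClosure K ≃ₐ[K] AlgebraicClosure K) {Q : E.geom.Point}
    {a : Fin 3 → AlgebraicClosure K} (ha : IsCoord Q a) :
    IsCoord (E.galoisHom σ Q) (fun i => σ (a i)) :=
  isCoord_map (E := E.geom) (E' := E.geom) _ (σ.commutes E.lam) ha

lemma galois_toGeom (σ : AlgebraicClosure K ≃ₐ[K] AlgebraicClosure K) (P : E.Point) :
    E.galoisHom σ (E.toGeomHom P) = E.toGeomHom P := by
  have ha := (isCoord_coords P).toGeom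
  refine (ha.galois σ).eq ?_
  simpa using ha

lemma toGeom_pointS (hζ : ζ ^ 3 = 1) : E.toGeomHom (E.pointS ζ hζ) =
    E.geom.pointS (algebraMap K _ ζ) (by rw [← map_pow, hζ, map_one]) := by
  refine (isCoord_pointS ζ hζ).toGeom.eq ?_
  convert isCoord_pointS (E := E.geom) _ _ using 1
  funext i
  fin_cases i <;> simp

lemma toGeom_pointT : E.toGeomHom E.pointT = E.geom.pointT := by
  refine isCoord_pointT.toGeom.eq ?_
  convert isCoord_pointT (E := E.geom) using 1
  funext i
  fin_cases i <;> simp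

/-! ### Descent of fixed points -/

/-- In characteristic different from `3` a cube root of an element of `K` is separable over `K`,
so it lies in `K` if all automorphisms fix it. -/
lemma mem_range_of_fixed (h3 : (3 : K) ≠ 0) {y : AlgebraicClosure K} {k : K}
    (hy : y ^ 3 = algebraMap K _ k)
    (hfix : ∀ σ : AlgebraicClosure K ≃ₐ[K] AlgebraicClosure K, σ y = y) :
    ∃ m : K, algebraMap K _ m = y := by
  by_cases hk : k = 0
  · refine ⟨0, ?_⟩
    rw [hk, map_zero] at hy
    rw [map_zero, (pow_eq_zero_iff (by norm_num)).1 hy]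
  have hsep : IsSeparable K y := by
    refine (Polynomial.separable_X_pow_sub_C (n := 3) k (by exact_mod_cast h3) hk).of_dvd
      (minpoly.dvd K y ?_)
    simp [hy]
  by_contra hm
  have hmem : y ∉ (⊥ : Subalgebra K (AlgebraicClosure K)) := by
    rwa [Algebra.mem_bot]
  obtain ⟨z, hz, hc⟩ := (notMem_iff_exists_ne_and_isConjRoot hsep
    (IsAlgClosed.splits _)).1 hmem
  obtain ⟨σ, hσ⟩ := isConjRoot_iff_exists_algEquiv.1 hc.symm
  exact hz (by rw [← hσ, hfix])

/-- A vector with Galois-fixed ratios, whose cubes are proportional to a vector over `K`, is itself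
proportional to a vector over `K`. -/
lemma exists_smul_of_fixed (h3 : (3 : K) ≠ 0) {z : Fin 3 → AlgebraicClosure K} (hz : z ≠ 0)
    (hfix : ∀ σ : AlgebraicClosure K ≃ₐ[K] AlgebraicClosure K, ∃ c, ∀ i, σ (z i) = c * z i)
    {c : AlgebraicClosure K} {k : Fin 3 → K} (hk : ∀ i, z i ^ 3 = c * algebraMap K _ (k i)) :
    ∃ (d : AlgebraicClosure K) (m : Fin 3 → K), ∀ i, z i = d * algebraMap K _ (m i) := by
  obtain ⟨j, hj⟩ : ∃ j, z j ≠ 0 := by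
    by_contra! h
    exact hz (funext h)
  have hkj : c * algebraMap K (AlgebraicClosure K) (k j) ≠ 0 := by
    rw [← hk]
    exact pow_ne_zero 3 hj
  have hm : ∀ i, ∃ m : K, algebraMap K _ m = z i / z j := by
    intro i
    refine mem_range_of_fixed h3 (k := k i / k j) ?_ fun σ => ?_
    · rw [div_pow, hk, hk, mul_div_mul_left _ _ (left_ne_zero_of_mul hkj), map_div₀]
    · obtain ⟨c', hc'⟩ := hfix σ
      have h0 : c' * z j ≠ 0 := by
        rw [← hc']
        exact (map_ne_zero σ).2 hj
      rw [map_div₀, hc', hc', mul_div_mul_left _ _ (left_ne_zero_of_mul h0)]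
  choose m hm using hm
  exact ⟨z j, m, fun i => by rw [hm, mul_div_cancel₀ _ hj]⟩

/-- If `3Q` is rational and all automorphisms fix `Q`, then `Q` is rational. The field fixed by the
automorphisms may be a purely inseparable extension of `K`; coordinates of `Q` in `K` are obtained
by extracting cube roots twice, because the linear forms of the tangents at `O`, `S` and `-S` take
at `3Q` values which are cubes of forms in the coordinates of `Q`. -/
theorem exists_toGeom_eq_of_fixed (hζ : IsPrimitiveRoot ζ 3) {P : E.Point} {Q : E.geom.Point}
    (hQ : 3 • Q = E.toGeomHom P)
    (hfix : ∀ σ : AlgebraicClosure K ≃ₐ[K] AlgebraicClosure K, E.galoisHom σ Q = Q) :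
    ∃ Q₀ : E.Point, E.toGeomHom Q₀ = Q := by
  have h3 := E.three_ne_zero
  have hζ' : IsPrimitiveRoot (algebraMap K (AlgebraicClosure K) ζ) 3 :=
    hζ.map_of_injective (algebraMap K _).injective
  have hv := isCoord_coords Q
  set v := Q.coords with hvdef
  set w := algebraMap K (AlgebraicClosure K) ζ with hw
  set l := algebraMap K (AlgebraicClosure K) E.lam with hl
  have hz := sq_add_self_add_one hζ'
  have hw3 := hζ'.pow_eq_one
  have hσ : ∀ σ : AlgebraicClosure K ≃ₐ[K] AlgebraicClosure K, ∃ c, ∀ i, σ (v i) = c * v i := by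
    intro σ
    have h1 := hv.galois σ
    rw [hfix] at h1
    obtain ⟨c, -, hc⟩ := hv.exists_smul h1
    exact ⟨c, fun i => congrFun hc i⟩
  -- the values of the three tangents at `3Q`
  obtain ⟨c, -, hc⟩ := (isCoord_coords P).toGeom.exists_smul (hQ ▸ hv.three_nsmul)
  set p := P.coords
  have hc' : ∀ i, triVec v i = c * algebraMap K _ (p i) := fun i => congrFun hc i
  have hO := hv.lineO_triVec
  have hS := hv.lineS_triVec hζ'
  have hS' := hv.lineS_triVec (hζ'.pow_of_coprime 2 (by norm_num))
  rw [show (w ^ 2) ^ 2 = w by linear_combination w * hw3] at hS'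
  have hF := hv.equation
  change v 0 ^ 3 + v 1 ^ 3 + v 2 ^ 3 + l * v 0 * v 1 * v 2 = 0 at hF
  change 3 * triVec v 0 + 3 * triVec v 1 - l * triVec v 2 = -(l ^ 3 + 27) * _ at hO
  change _ - l * triVec v 2 = _ at hS hS'
  rw [hc', hc', hc'] at hO hS hS'
  have hs : l ^ 3 + 27 ≠ 0 := E.geom.smooth
  have h3' : (3 : AlgebraicClosure K) ≠ 0 := E.geom.three_ne_zero
  have m3 : algebraMap K (AlgebraicClosure K) 3 = 3 := map_ofNat _ 3
  have m27 : algebraMap K (AlgebraicClosure K) 27 = 27 := map_ofNat _ 27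
  -- the forms whose cubes these values are; the cubes of the coordinates are combinations of them
  set z : Fin 3 → AlgebraicClosure K := ![v 0 * v 1 * v 2,
    v 0 ^ 3 + w ^ 2 * v 1 ^ 3 + w * v 2 ^ 3, v 0 ^ 3 + w * v 1 ^ 3 + w ^ 2 * v 2 ^ 3] with hzdef
  have e0 : 3 * v 0 ^ 3 = -l * z 0 + z 1 + z 2 := by
    simp only [hzdef, Matrix.cons_val]
    linear_combination hF - (v 1 ^ 3 + v 2 ^ 3) * hz
  have e1 : 3 * v 1 ^ 3 = -l * z 0 + w * z 1 + w ^ 2 * z 2 := by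
    simp only [hzdef, Matrix.cons_val]
    linear_combination hF - (v 0 ^ 3 + v 2 ^ 3) * hz - (2 * v 1 ^ 3 + w * v 2 ^ 3) * hw3
  have e2 : 3 * v 2 ^ 3 = -l * z 0 + w ^ 2 * z 1 + w * z 2 := by
    simp only [hzdef, Matrix.cons_val]
    linear_combination hF - (v 0 ^ 3 + v 1 ^ 3) * hz - (2 * v 2 ^ 3 + w * v 1 ^ 3) * hw3
  have hz0 : z ≠ 0 := by
    intro h0
    rw [h0] at e0 e1 e2
    simp only [Pi.zero_apply, mul_zero, add_zero, mul_eq_zero, h3', false_or] at e0 e1 e2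
    refine hv.ne_zero (funext fun i => ?_)
    fin_cases i
    · exact (pow_eq_zero_iff (by norm_num)).1 e0
    · exact (pow_eq_zero_iff (by norm_num)).1 e1
    · exact (pow_eq_zero_iff (by norm_num)).1 e2
  -- first extraction: `XYZ` and the two sums of cubes are proportional to a vector over `K`
  obtain ⟨d, m, hm⟩ := exists_smul_of_fixed h3 hz0 (c := c)
    (k := ![-(3 * p 0 + 3 * p 1 - E.lam * p 2) / (E.lam ^ 3 + 27),
      3 * ζ ^ 2 * p 0 + 3 * ζ * p 1 - E.lam * p 2, 3 * ζ * p 0 + 3 * ζ ^ 2 * p 1 - E.lam * p 2])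
    (fun σ => by
      obtain ⟨c, hc⟩ := hσ σ
      refine ⟨c ^ 3, fun i => ?_⟩
      have hσw : σ w = w := σ.commutes ζ
      fin_cases i <;> simp [hzdef, hc, hσw] <;> ring)
    (fun i => by
      fin_cases i
      · simp only [hzdef, Fin.zero_eta, Matrix.cons_val, map_div₀, map_neg, map_sub, map_add,
          map_mul, map_pow, m3, m27, ← hl]
        rw [mul_div_assoc', eq_div_iff hs]
        linear_combination hO
      · simp only [hzdef, Fin.mk_one, Matrix.cons_val, map_sub, map_add, map_mul, map_pow, m3, ← hl,
          ← hw]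
        linear_combination -hS
      · simp only [hzdef, Fin.reduceFinMk, Matrix.cons_val, map_sub, map_add, map_mul, map_pow, m3,
          ← hl, ← hw]
        linear_combination -hS')
  -- second extraction: hence so are the cubes of the coordinates of `Q`
  obtain ⟨d', m', hm'⟩ := exists_smul_of_fixed h3 hv.ne_zero hσ (c := d)
    (k := ![(-E.lam * m 0 + m 1 + m 2) / 3, (-E.lam * m 0 + ζ * m 1 + ζ ^ 2 * m 2) / 3,
      (-E.lam * m 0 + ζ ^ 2 * m 1 + ζ * m 2) / 3])
    (fun i => by
      rw [hm, hm, hm] at e0 e1 e2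
      refine mul_left_cancel₀ h3' ?_
      fin_cases i
      · simp only [Fin.zero_eta, Matrix.cons_val, map_div₀, map_neg, map_add, map_mul, m3, ← hl]
        rw [e0]
        field_simp
      · simp only [Fin.mk_one, Matrix.cons_val, map_div₀, map_neg, map_add, map_mul, map_pow, m3,
          ← hl, ← hw]
        rw [e1]
        field_simp
      · simp only [Fin.reduceFinMk, Matrix.cons_val, map_div₀, map_neg, map_add, map_mul, map_pow,
          m3, ← hl, ← hw]
        rw [e2]
        field_simp)
  -- `m'` is a vector of coordinates of `Q` over `K`
  have hd' : d' ≠ 0 := by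
    rintro rfl
    exact hv.ne_zero (funext fun i => by rw [hm', zero_mul]; rfl)
  have hm0 : m' ≠ 0 := by
    rintro rfl
    exact hv.ne_zero (funext fun i => by rw [hm']; simp)
  have hE : m' 0 ^ 3 + m' 1 ^ 3 + m' 2 ^ 3 + E.lam * m' 0 * m' 1 * m' 2 = 0 := by
    apply (algebraMap K (AlgebraicClosure K)).injective
    rw [hm', hm', hm'] at hF
    simp only [map_add, map_mul, map_pow, map_zero]
    refine mul_left_cancel₀ (pow_ne_zero 3 hd') ?_
    linear_combination hF
  refine ⟨Point.mk m' hm0 hE, ?_⟩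
  have h1 := ((isCoord_mk hm0 hE).toGeom).smul hd'
  refine h1.eq ?_
  convert hv using 1
  funext i
  exact (hm' i).symm

/-! ### Geometric torsion -/

lemma isPrimitiveRoot_algebraMap (hζ : IsPrimitiveRoot ζ 3) :
    IsPrimitiveRoot (algebraMap K (AlgebraicClosure K) ζ) 3 :=
  hζ.map_of_injective (algebraMap K _).injective

lemma exists_of_geom_torsion (hζ : IsPrimitiveRoot ζ 3) {A : E.geom.Point} (hA : 3 • A = 0) :
    ∃ m < 3, ∃ n < 3, A = E.toGeomHom (m • E.pointS ζ hζ.pow_eq_one + n • E.pointT) := by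
  obtain ⟨m, hm, n, hn, h⟩ := exists_of_three_nsmul_eq_zero (isPrimitiveRoot_algebraMap hζ) hA
  refine ⟨m, hm, n, hn, ?_⟩
  rw [h, map_add, map_nsmul, map_nsmul, toGeom_pointS, toGeom_pointT]

/-- The torsion `E[3]` is rational, because `ζ ∈ K`. -/
lemma galois_of_torsion (hζ : IsPrimitiveRoot ζ 3) {A : E.geom.Point} (hA : 3 • A = 0)
    (σ : AlgebraicClosure K ≃ₐ[K] AlgebraicClosure K) : E.galoisHom σ A = A := by
  obtain ⟨m, -, n, -, rfl⟩ := exists_of_geom_torsion hζ hA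
  exact galois_toGeom σ _

lemma three_nsmul_galois_sub {P : E.Point} {Q : E.geom.Point} (hQ : 3 • Q = E.toGeomHom P)
    (σ : AlgebraicClosure K ≃ₐ[K] AlgebraicClosure K) : 3 • (E.galoisHom σ Q - Q) = 0 := by
  rw [nsmul_sub, ← map_nsmul, hQ, galois_toGeom, sub_self]

/-! ### One component of the descent map -/

/-- What the descent argument uses of the function `f` with divisor `3 (B) - 3 (O)` and of the cube
root `N / XYZ` of `f ∘ [3]`: rationality of `N`, the multipliers under translation by `3`-torsion,
and the values at rational points. -/
structure IsDescent (f : E.FunctionField) (B : E.Point) (N : MvPolynomial (Fin 3)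
    (AlgebraicClosure K)) : Prop where
  galois : ∀ (σ : AlgebraicClosure K ≃ₐ[K] AlgebraicClosure K) (Q : E.geom.Point),
    ratio N (E.galoisHom σ Q) = σ (ratio N Q)
  multiplier : ∀ A : E.geom.Point, 3 • A = 0 → ∃ ξ, IsMultiplier N A ξ
  torsion : 3 • B = 0
  ne_zero : B ≠ 0
  exists_value : ∀ P : E.Point, P ≠ 0 → P ≠ B → ∃ u : Kˣ, HasValue f P u
  value : ∀ (P : E.Point) (u : Kˣ), HasValue f P u →
    ∀ Q : E.geom.Point, 3 • Q = E.toGeomHom P → ratio N Q ^ 3 = algebraMap K _ (u : K)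

/-- For some `Q` with `3Q = P`, the Kummer cocycle `σ ↦ σ(α) / α` of a cube root `α` of `a` is the
multiplier of `N / XYZ` under translation by `σQ - Q`. -/
def IsKummerClass (N : MvPolynomial (Fin 3) (AlgebraicClosure K)) (P : E.Point) (a : Kˣ) : Prop :=
  ∃ (Q : E.geom.Point) (α : AlgebraicClosure K), 3 • Q = E.toGeomHom P ∧
    α ^ 3 = algebraMap K _ (a : K) ∧
    ∀ σ : AlgebraicClosure K ≃ₐ[K] AlgebraicClosure K,
      IsMultiplier N (E.galoisHom σ Q - Q) (σ α / α)

lemma cubeRoot_ne_zero {a : Kˣ} {α : AlgebraicClosure K} (h : α ^ 3 = algebraMap K _ (a : K)) :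
    α ≠ 0 := by
  rintro rfl
  have : algebraMap K (AlgebraicClosure K) (a : K) ≠ 0 := (map_ne_zero _).2 a.ne_zero
  exact this (by rw [← h]; norm_num)

lemma cubeClass_mul (a b : Kˣ) : cubeClass (a * b) = cubeClass a * cubeClass b :=
  QuotientGroup.mk_mul _ a b

lemma cubeClass_one : cubeClass (1 : Kˣ) = 1 := QuotientGroup.mk_one _

namespace IsKummerClass

variable {N : MvPolynomial (Fin 3) (AlgebraicClosure K)} {P P' : E.Point} {a b : Kˣ}

/-- The choice of `Q` is immaterial, because `E[3]` is rational. -/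
lemma of_eq (hζ : IsPrimitiveRoot ζ 3) (h : IsKummerClass N P a) {Q : E.geom.Point}
    (hQ : 3 • Q = E.toGeomHom P) :
    ∃ α : AlgebraicClosure K, α ^ 3 = algebraMap K _ (a : K) ∧
      ∀ σ : AlgebraicClosure K ≃ₐ[K] AlgebraicClosure K,
        IsMultiplier N (E.galoisHom σ Q - Q) (σ α / α) := by
  obtain ⟨Q', α, hQ', hα, h⟩ := h
  refine ⟨α, hα, fun σ => ?_⟩
  have h0 : E.galoisHom σ (Q - Q') = Q - Q' :=
    galois_of_torsion hζ (by rw [nsmul_sub, hQ, hQ', sub_self]) σ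
  rw [map_sub] at h0
  rw [show E.galoisHom σ Q - Q = E.galoisHom σ Q' - Q' by
    rw [sub_eq_sub_iff_sub_eq_sub, h0]]
  exact h σ

lemma mul (h : IsKummerClass N P a) (h' : IsKummerClass N P' b) :
    IsKummerClass N (P + P') (a * b) := by
  obtain ⟨Q, α, hQ, hα, h⟩ := h
  obtain ⟨Q', β, hQ', hβ, h'⟩ := h'
  refine ⟨Q + Q', α * β, by rw [nsmul_add, hQ, hQ', map_add],
    by rw [mul_pow, hα, hβ, Units.val_mul, map_mul], fun σ => ?_⟩
  rw [map_add, map_mul, add_sub_add_comm, mul_div_mul_comm]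
  exact (h σ).add (h' σ)

lemma inv (h : IsKummerClass N P a) : IsKummerClass N (-P) a⁻¹ := by
  obtain ⟨Q, α, hQ, hα, h⟩ := h
  have hα0 := cubeRoot_ne_zero hα
  refine ⟨-Q, α⁻¹, by rw [smul_neg, hQ, map_neg], by rw [inv_pow, hα, Units.val_inv_eq_inv_val,
    map_inv₀], fun σ => ?_⟩
  rw [map_neg, map_inv₀, ← neg_sub', ← inv_div_inv, inv_inv, inv_inv]
  have := (h σ).neg (div_ne_zero ((map_ne_zero σ).2 hα0) hα0)
  rwa [inv_div] at this

/-- A cube is the class of a point of `3E(K)`. -/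
lemma pow_three (N : MvPolynomial (Fin 3) (AlgebraicClosure K)) (P : E.Point) (c : Kˣ) :
    IsKummerClass N (3 • P) (c ^ 3) := by
  refine ⟨E.toGeomHom P, algebraMap K _ (c : K), by rw [map_nsmul],
    by rw [Units.val_pow_eq_pow_val, map_pow], fun σ => ?_⟩
  rw [galois_toGeom, sub_self, σ.commutes, div_self ((map_ne_zero _).2 c.ne_zero)]
  exact .zero

lemma of_cubeClass_eq (ha : IsKummerClass N P a) (hab : cubeClass a = cubeClass b) :
    IsKummerClass N P b := by
  obtain ⟨c, hc⟩ := (QuotientGroup.eq (s := (powMonoidHom 3 : Kˣ →* Kˣ).range)).1 hab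
  have := ha.mul (IsKummerClass.pow_three N (0 : E.Point) c)
  rw [nsmul_zero, add_zero] at this
  convert this
  rw [show c ^ 3 = a⁻¹ * b from hc, mul_inv_cancel_left]

end IsKummerClass

namespace IsDescent

variable {f : E.FunctionField} {B : E.Point} {N : MvPolynomial (Fin 3) (AlgebraicClosure K)}
  {P : E.Point} {a b : Kˣ}

lemma neg_ne_zero (h : IsDescent f B N) : -B ≠ 0 := _root_.neg_ne_zero.2 h.ne_zero

lemma neg_ne (h : IsDescent f B N) : -B ≠ B := by
  intro h'
  apply h.ne_zero
  have := h.torsion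
  rw [show 3 • B = B - -B + B by abel, h', sub_self, zero_add] at this
  exact this

/-- The value of `f` at `3Q` is the cube of the value of `N / XYZ` at `Q`. -/
lemma isKummerClass_of_hasValue (h : IsDescent f B N) (hζ : IsPrimitiveRoot ζ 3) {u : Kˣ}
    (hu : HasValue f P u) : IsKummerClass N P u := by
  obtain ⟨Q, hQ⟩ := exists_three_nsmul_eq (isPrimitiveRoot_algebraMap hζ) (E.toGeomHom P)
  have hα := h.value P u hu Q hQ
  refine ⟨Q, ratio N Q, hQ, hα, fun σ => ?_⟩
  obtain ⟨ξ, hξ⟩ := h.multiplier _ (three_nsmul_galois_sub hQ σ)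
  have h1 := hξ Q
  rw [add_sub_cancel, h.galois] at h1
  rwa [h1, mul_div_cancel_right₀ _ (cubeRoot_ne_zero hα)]

lemma exists_ratio_ne_zero (h : IsDescent f B N) (hζ : IsPrimitiveRoot ζ 3) :
    ∃ Q : E.geom.Point, ratio N Q ≠ 0 := by
  obtain ⟨u, hu⟩ := h.exists_value (-B) h.neg_ne_zero h.neg_ne
  obtain ⟨Q, hQ⟩ := exists_three_nsmul_eq (isPrimitiveRoot_algebraMap hζ) (E.toGeomHom (-B))
  exact ⟨Q, cubeRoot_ne_zero (h.value _ u hu Q hQ)⟩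

lemma exists_isKummerClass (h : IsDescent f B N) (hζ : IsPrimitiveRoot ζ 3) (P : E.Point) :
    ∃ a : Kˣ, IsKummerClass N P a := by
  by_cases h0 : P = 0
  · exact ⟨1 ^ 3, by simpa [h0] using IsKummerClass.pow_three N (0 : E.Point) 1⟩
  by_cases hB : P = B
  · obtain ⟨u, hu⟩ := h.exists_value (-B) h.neg_ne_zero h.neg_ne
    refine ⟨u⁻¹, ?_⟩
    rw [hB, ← neg_neg B]
    exact (h.isKummerClass_of_hasValue hζ hu).inv
  · obtain ⟨u, hu⟩ := h.exists_value P h0 hB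
    exact ⟨u, h.isKummerClass_of_hasValue hζ hu⟩

/-- If the Kummer cocycle of `a` is trivial, then `a` is a cube. -/
lemma cubeClass_eq (h : IsDescent f B N) (hζ : IsPrimitiveRoot ζ 3)
    (ha : IsKummerClass N P a) (hb : IsKummerClass N P b) : cubeClass a = cubeClass b := by
  have hab := ha.inv.mul hb
  rw [neg_add_cancel] at hab
  obtain ⟨α, hα, hσ⟩ := hab.of_eq hζ (Q := 0) (by rw [nsmul_zero, map_zero])
  obtain ⟨Q, hQ⟩ := h.exists_ratio_ne_zero hζ
  have hα0 := cubeRoot_ne_zero hα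
  obtain ⟨c, hc⟩ := mem_range_of_fixed E.three_ne_zero hα fun σ => by
    have h1 := hσ σ
    rw [map_zero, sub_zero] at h1
    exact (div_eq_one_iff_eq hα0).1 (h1.unique .zero hQ)
  have hc0 : c ≠ 0 := by
    rintro rfl
    exact hα0 (by rw [← hc, map_zero])
  refine (QuotientGroup.eq (s := (powMonoidHom 3 : Kˣ →* Kˣ).range)).2 ⟨Units.mk0 c hc0, ?_⟩
  apply Units.ext
  apply (algebraMap K (AlgebraicClosure K)).injective
  rw [← hα, ← hc]
  simp

/-- The values of `f` determine a homomorphism: a point where `f` has no value in `K*` is `O` or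
`B`, and `f` has a value at `-B`. -/
lemma hom_eq (h : IsDescent f B N) {ψ ψ' : E.Point →+ Additive (CubeClasses K)}
    (hψ : ∀ (P : E.Point) (u : Kˣ), HasValue f P u → (ψ P).toMul = cubeClass u)
    (hψ' : ∀ (P : E.Point) (u : Kˣ), HasValue f P u → (ψ' P).toMul = cubeClass u) :
    ψ = ψ' := by
  have key : ∀ P : E.Point, P ≠ 0 → P ≠ B → ψ P = ψ' P := by
    intro P h0 hB
    obtain ⟨u, hu⟩ := h.exists_value P h0 hB
    exact Additive.toMul.injective ((hψ P u hu).trans (hψ' P u hu).symm)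
  ext1 P
  by_cases h0 : P = 0
  · rw [h0, map_zero, map_zero]
  by_cases hB : P = B
  · have := key (-B) h.neg_ne_zero h.neg_ne
    rw [map_neg, map_neg] at this
    rw [hB]
    exact neg_injective this
  · exact key P h0 hB

end IsDescent

/-! ### The descent map -/

section DescentMap

variable {f₁ f₂ : E.FunctionField} {B₁ B₂ : E.Point}
  {N₁ N₂ : MvPolynomial (Fin 3) (AlgebraicClosure K)}

/-- Two maps that are multiplicative and trivial on multiples of `3` define a homomorphism on the
quotient. -/
lemma exists_hom_mod_three {A C : Type*} [AddCommGroup A] [CommGroup C] {a b : A → C}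
    (ha : ∀ P Q, a (P + Q) = a P * a Q) (hb : ∀ P Q, b (P + Q) = b P * b Q)
    (ha3 : ∀ P, a (3 • P) = 1) (hb3 : ∀ P, b (3 • P) = 1) :
    ∃ Φ : A ⧸ (zsmulAddGroupHom 3 : A →+ A).range →+ Additive (C × C),
      ∀ P : A, Φ (QuotientAddGroup.mk P) = Additive.ofMul (a P, b P) := by
  let φ : A →+ Additive (C × C) := AddMonoidHom.mk' (fun P => Additive.ofMul (a P, b P)) (by
    intro P P'
    rw [ha, hb, ← ofMul_mul, Prod.mk_mul_mk])
  refine ⟨QuotientAddGroup.lift _ φ ?_, fun _ => rfl⟩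
  rintro _ ⟨P, rfl⟩
  have e : (zsmulAddGroupHom 3 : A →+ A) P = 3 • P := ofNat_zsmul P 3
  have e' : φ (3 • P) = Additive.ofMul (a (3 • P), b (3 • P)) := rfl
  rw [e, AddMonoidHom.mem_ker, e', ha3, hb3, Prod.mk_one_one, ofMul_one]

/-- The Kummer classes for two descent data are the components of a homomorphism on
`E(K)/3E(K)`. -/
theorem exists_descentMap (hζ : IsPrimitiveRoot ζ 3) (h₁ : IsDescent f₁ B₁ N₁)
    (h₂ : IsDescent f₂ B₂ N₂) :
    ∃ Φ : E.ModThree →+ Additive (CubeClasses K × CubeClasses K), ∀ (P : E.Point) (a b : Kˣ),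
      Φ (E.modThree P) = Additive.ofMul (cubeClass a, cubeClass b) ↔
        IsKummerClass N₁ P a ∧ IsKummerClass N₂ P b := by
  choose a ha using h₁.exists_isKummerClass hζ
  choose b hb using h₂.exists_isKummerClass hζ
  obtain ⟨Φ, hΦ⟩ : ∃ Φ : E.ModThree →+ Additive (CubeClasses K × CubeClasses K),
      ∀ P : E.Point, Φ (E.modThree P) = Additive.ofMul (cubeClass (a P), cubeClass (b P)) := by
    refine exists_hom_mod_three (a := fun P => cubeClass (a P)) (b := fun P => cubeClass (b P))
      ?_ ?_ ?_ ?_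
    · intro P Q
      rw [← cubeClass_mul]
      exact h₁.cubeClass_eq hζ (ha (P + Q)) ((ha P).mul (ha Q))
    · intro P Q
      rw [← cubeClass_mul]
      exact h₂.cubeClass_eq hζ (hb (P + Q)) ((hb P).mul (hb Q))
    · intro P
      rw [h₁.cubeClass_eq hζ (ha (3 • P)) (.pow_three N₁ P 1), one_pow, cubeClass_one]
    · intro P
      rw [h₂.cubeClass_eq hζ (hb (3 • P)) (.pow_three N₂ P 1), one_pow, cubeClass_one]
  refine ⟨Φ, fun P a' b' => ?_⟩
  rw [hΦ, Additive.ofMul.injective.eq_iff, Prod.mk_inj]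
  constructor
  · rintro ⟨h1, h2⟩
    exact ⟨(ha P).of_cubeClass_eq h1, (hb P).of_cubeClass_eq h2⟩
  · rintro ⟨h1, h2⟩
    exact ⟨h₁.cubeClass_eq hζ (ha P) h1, h₂.cubeClass_eq hζ (hb P) h2⟩

end DescentMap

/-! ### The two descent functions -/

lemma isMultiplier_numS_geom (hζ : ζ ^ 3 = 1) (m n : ℕ) :
    IsMultiplier (numS (algebraMap K (AlgebraicClosure K) ζ))
      (E.toGeomHom (m • E.pointS ζ hζ + n • E.pointT)) (algebraMap K _ ζ ^ n) := by
  rw [map_add, map_nsmul, map_nsmul, toGeom_pointS, toGeom_pointT]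
  exact isMultiplier_numS _ m n

lemma isMultiplier_numT_geom (hζ : ζ ^ 3 = 1) (m n : ℕ) :
    IsMultiplier (numT : MvPolynomial (Fin 3) (AlgebraicClosure K))
      (E.toGeomHom (m • E.pointS ζ hζ + n • E.pointT)) ((algebraMap K _ ζ ^ 2) ^ m) := by
  rw [map_add, map_nsmul, map_nsmul, toGeom_pointS, toGeom_pointT]
  exact isMultiplier_numT _ m n

lemma toGeom_ne_zero {P : E.Point} (hP : P ≠ 0) : E.toGeomHom P ≠ 0 :=
  (map_ne_zero_iff _ toGeom_injective).2 hP

theorem isDescent_funS (hζ : IsPrimitiveRoot ζ 3) :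
    IsDescent (E.funS ζ) (E.pointS ζ hζ.pow_eq_one)
      (numS (algebraMap K (AlgebraicClosure K) ζ)) where
  galois σ Q := by
    have ha := isCoord_coords Q
    rw [(ha.galois σ).ratio_eq numS_isHomogeneous, ha.ratio_eq numS_isHomogeneous]
    simp
  multiplier A hA := by
    obtain ⟨m, -, n, -, rfl⟩ := exists_of_geom_torsion hζ hA
    exact ⟨_, isMultiplier_numS_geom _ m n⟩
  torsion := three_nsmul_pointS _
  ne_zero := pointS_ne_zero hζ
  exists_value P h0 hB := by
    have ha := isCoord_coords P
    exact ⟨Units.mk0 _ (mul_ne_zero E.smooth (div_ne_zero (ha.lineS_ne_zero hζ hB)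
      (ha.lineO_ne_zero h0))), ha.hasValue_funS h0⟩
  value P u hu Q hQ := by
    have hP : P ≠ 0 := by
      rintro rfl
      exact (isKummer_funS hζ).not_hasValue _ hu
    have ha := isCoord_coords P
    have h1 := (isKummer_funS (isPrimitiveRoot_algebraMap hζ)).hasValue Q
      (hQ ▸ toGeom_ne_zero hP)
    rw [hQ] at h1
    rw [h1.unique (ha.toGeom.hasValue_funS (toGeom_ne_zero hP)), hu.unique (ha.hasValue_funS hP)]
    simp [baseChange, map_ofNat (algebraMap K (AlgebraicClosure K)) 3,
      map_ofNat (algebraMap K (AlgebraicClosure K)) 27]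

theorem isDescent_funT (hζ : IsPrimitiveRoot ζ 3) :
    IsDescent E.funT E.pointT (numT : MvPolynomial (Fin 3) (AlgebraicClosure K)) where
  galois σ Q := by
    have ha := isCoord_coords Q
    rw [(ha.galois σ).ratio_eq numT_isHomogeneous, ha.ratio_eq numT_isHomogeneous]
    simp
  multiplier A hA := by
    obtain ⟨m, -, n, -, rfl⟩ := exists_of_geom_torsion hζ hA
    exact ⟨_, isMultiplier_numT_geom _ m n⟩
  torsion := three_nsmul_pointT
  ne_zero := pointT_ne_zero
  exists_value P h0 hB := by
    have ha := isCoord_coords P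
    exact ⟨Units.mk0 _ (mul_ne_zero E.lineT_const_ne_zero (div_ne_zero (ha.lineT_ne_zero hζ hB)
      (ha.lineO_ne_zero h0))), ha.hasValue_funT h0⟩
  value P u hu Q hQ := by
    have hP : P ≠ 0 := by
      rintro rfl
      exact (isKummer_funT hζ).not_hasValue _ hu
    have ha := isCoord_coords P
    have h1 := (isKummer_funT (isPrimitiveRoot_algebraMap hζ)).hasValue Q
      (hQ ▸ toGeom_ne_zero hP)
    rw [hQ] at h1
    rw [h1.unique (ha.toGeom.hasValue_funT (toGeom_ne_zero hP)), hu.unique (ha.hasValue_funT hP)]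
    simp [baseChange, map_ofNat (algebraMap K (AlgebraicClosure K)) 3,
      map_ofNat (algebraMap K (AlgebraicClosure K)) 9]

lemma eq_of_multiplier_eq (hζ : IsPrimitiveRoot ζ 3) {m m' n n' : ℕ} (hm : m < 3) (hm' : m' < 3)
    (hn : n < 3) (hn' : n' < 3)
    (hS : (algebraMap K (AlgebraicClosure K) ζ) ^ n = algebraMap K _ ζ ^ n')
    (hT : (algebraMap K (AlgebraicClosure K) ζ ^ 2) ^ m = (algebraMap K _ ζ ^ 2) ^ m') :
    m = m' ∧ n = n' := by
  have hw := isPrimitiveRoot_algebraMap hζ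
  exact ⟨(hw.pow_of_coprime 2 (by norm_num)).pow_inj hm hm' hT, hw.pow_inj hn hn' hS⟩

/-- The multipliers of the two functions are different for different coefficients. -/
lemma nsmul_pointS_add_nsmul_pointT_injective (hζ : IsPrimitiveRoot ζ 3) {m m' n n' : ℕ}
    (hm : m < 3) (hm' : m' < 3) (hn : n < 3) (hn' : n' < 3)
    (h : m • E.pointS ζ hζ.pow_eq_one + n • E.pointT =
      m' • E.pointS ζ hζ.pow_eq_one + n' • E.pointT) : m = m' ∧ n = n' := by
  obtain ⟨Q, hQ⟩ := (isDescent_funS (E := E) hζ).exists_ratio_ne_zero hζ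
  obtain ⟨Q', hQ'⟩ := (isDescent_funT (E := E) hζ).exists_ratio_ne_zero hζ
  exact eq_of_multiplier_eq hζ hm hm' hn hn'
    ((isMultiplier_numS_geom _ m n).unique (h ▸ isMultiplier_numS_geom _ m' n') hQ)
    ((isMultiplier_numT_geom _ m n).unique (h ▸ isMultiplier_numT_geom _ m' n') hQ')

/-- The Weil pairing is nondegenerate. -/
lemma eq_zero_of_isMultiplier_one (hζ : IsPrimitiveRoot ζ 3) {A : E.geom.Point} (hA : 3 • A = 0)
    (hS : IsMultiplier (numS (algebraMap K (AlgebraicClosure K) ζ)) A 1)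
    (hT : IsMultiplier numT A 1) : A = 0 := by
  obtain ⟨m, hm, n, hn, rfl⟩ := exists_of_geom_torsion hζ hA
  obtain ⟨Q, hQ⟩ := (isDescent_funS (E := E) hζ).exists_ratio_ne_zero hζ
  obtain ⟨Q', hQ'⟩ := (isDescent_funT (E := E) hζ).exists_ratio_ne_zero hζ
  obtain ⟨rfl, rfl⟩ := eq_of_multiplier_eq hζ hm (by norm_num : 0 < 3) hn (by norm_num : 0 < 3)
    (by rw [pow_zero]; exact (isMultiplier_numS_geom _ m n).unique hS hQ)
    (by rw [pow_zero]; exact (isMultiplier_numT_geom _ m n).unique hT hQ')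
  simp

/-- The cube roots of unity lie in `K`. -/
lemma fixed_of_pow_three_eq_one (hζ : IsPrimitiveRoot ζ 3) {α : AlgebraicClosure K}
    (hα : α ^ 3 = 1) (σ : AlgebraicClosure K ≃ₐ[K] AlgebraicClosure K) : σ α = α := by
  obtain ⟨i, -, rfl⟩ := (isPrimitiveRoot_algebraMap hζ).eq_pow_of_pow_eq_one hα
  rw [← map_pow, σ.commutes]

/-- A point whose Kummer classes are trivial is divisible by `3`: the cocycle `σQ - Q` is zero, so
`Q` is rational. -/
theorem exists_three_nsmul_eq_of_isKummerClass_one (hζ : IsPrimitiveRoot ζ 3) {P : E.Point}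
    (hS : IsKummerClass (numS (algebraMap K (AlgebraicClosure K) ζ)) P 1)
    (hT : IsKummerClass numT P 1) : ∃ Q : E.Point, 3 • Q = P := by
  obtain ⟨Q, hQ⟩ := exists_three_nsmul_eq (isPrimitiveRoot_algebraMap hζ) (E.toGeomHom P)
  obtain ⟨α, hα, hS⟩ := hS.of_eq hζ hQ
  obtain ⟨β, hβ, hT⟩ := hT.of_eq hζ hQ
  obtain ⟨Q₀, rfl⟩ := exists_toGeom_eq_of_fixed hζ hQ fun σ => by
    refine sub_eq_zero.1 (eq_zero_of_isMultiplier_one hζ (three_nsmul_galois_sub hQ σ) ?_ ?_)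
    · have := hS σ
      rwa [fixed_of_pow_three_eq_one hζ (by simpa using hα), div_self (cubeRoot_ne_zero hα)] at this
    · have := hT σ
      rwa [fixed_of_pow_three_eq_one hζ (by simpa using hβ), div_self (cubeRoot_ne_zero hβ)] at this
  exact ⟨Q₀, toGeom_injective (by rw [map_nsmul, hQ])⟩

lemma map_formXYZ (φ : K →+* AlgebraicClosure K) : (formXYZ : MvPolynomial (Fin 3) K).map φ =
    formXYZ := by
  simp [formXYZ]

lemma isDefinedOver_div_formXYZ {N : MvPolynomial (Fin 3) K} (hN : N.IsHomogeneous 3) :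
    E.IsDefinedOver (E.geom.form (N.map (algebraMap K _)) / E.geom.form formXYZ) :=
  ⟨3, N, formXYZ, hN, formXYZ_isHomogeneous, by
    rw [map_formXYZ]; exact form_formXYZ_ne_zero, by rw [map_formXYZ]⟩

lemma isDefinedOver_numS : E.IsDefinedOver
    (E.geom.form (numS (algebraMap K _ ζ)) / E.geom.form formXYZ) := by
  convert isDefinedOver_div_formXYZ (E := E) (numS_isHomogeneous (ζ := ζ)) using 3
  simp [numS]

lemma isDefinedOver_numT : E.IsDefinedOver (E.geom.form numT / E.geom.form formXYZ) := by
  convert isDefinedOver_div_formXYZ (E := E) numT_isHomogeneous using 3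
  simp [numT]

lemma isKummer_funS_geom (hζ : IsPrimitiveRoot ζ 3) :
    IsKummer (E.geom.funS (algebraMap K _ ζ)) (E.toGeomHom (E.pointS ζ hζ.pow_eq_one))
      (numS (algebraMap K _ ζ)) := by
  rw [toGeom_pointS]
  exact isKummer_funS (isPrimitiveRoot_algebraMap hζ)

lemma isKummer_funT_geom (hζ : IsPrimitiveRoot ζ 3) :
    IsKummer E.geom.funT (E.toGeomHom E.pointT) numT := by
  rw [toGeom_pointT]
  exact isKummer_funT (isPrimitiveRoot_algebraMap hζ)

lemma isEvaluation_unique (hζ : IsPrimitiveRoot ζ 3)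
    {Φ Ψ : E.ModThree →+ Additive (CubeClasses K × CubeClasses K)}
    (hΦ : E.IsEvaluation ζ Φ) (hΨ : E.IsEvaluation ζ Ψ) : Ψ = Φ := by
  have h1 := (isDescent_funS (E := E) hζ).hom_eq
    (ψ := ((MonoidHom.fst _ _).toAdditive.comp Ψ).comp (QuotientAddGroup.mk' _))
    (ψ' := ((MonoidHom.fst _ _).toAdditive.comp Φ).comp (QuotientAddGroup.mk' _)) hΨ.1 hΦ.1
  have h2 := (isDescent_funT (E := E) hζ).hom_eq
    (ψ := ((MonoidHom.snd _ _).toAdditive.comp Ψ).comp (QuotientAddGroup.mk' _))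
    (ψ' := ((MonoidHom.snd _ _).toAdditive.comp Φ).comp (QuotientAddGroup.mk' _)) hΨ.2 hΦ.2
  refine AddMonoidHom.ext fun x => ?_
  induction x using QuotientAddGroup.induction_on with
  | H P => exact Additive.toMul.injective (Prod.ext (DFunLike.congr_fun h1 P)
      (DFunLike.congr_fun h2 P))

end

end HesseCubic

theorem mainTheorem5 {K : Type*} [Field K] (ζ : K) (hζ : IsPrimitiveRoot ζ 3) (E : HesseCubic K) :
    -- `S, T` is a basis of the `3`-torsion
    (3 • E.toGeom (E.pointS ζ hζ.pow_eq_one) = 0 ∧ 3 • E.toGeom E.pointT = 0 ∧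
      ∀ A : E.geom.Point, 3 • A = 0 → ∃! m : Fin 3 × Fin 3,
        A = (m.1 : ℕ) • E.toGeom (E.pointS ζ hζ.pow_eq_one) + (m.2 : ℕ) • E.toGeom E.pointT) ∧
    -- the linear forms in `f_S` and `f_T` define tangent lines
    (E.IsTangentLine E.lineO E.pointO ∧
      E.IsTangentLine (E.lineS ζ) (E.pointS ζ hζ.pow_eq_one) ∧
      E.IsTangentLine E.lineT E.pointT) ∧
    -- `div f_S = 3 (S) - 3 (O)` and `div f_T = 3 (T) - 3 (O)`
    (HesseCubic.HasDivisor (E.geom.funS (algebraMap K _ ζ))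
        (Finsupp.single (E.toGeom (E.pointS ζ hζ.pow_eq_one)) 3 - Finsupp.single 0 3) ∧
      HesseCubic.HasDivisor E.geom.funT
        (Finsupp.single (E.toGeom E.pointT) 3 - Finsupp.single 0 3)) ∧
    -- the leading coefficients at `O` are cubes
    ((∃ t : E.FunctionField, HesseCubic.IsParameter t E.pointO) ∧
      ∀ t : E.FunctionField, HesseCubic.IsParameter t E.pointO →
        (∃ c : K, HesseCubic.HasLeadingTerm (E.funS ζ) t E.pointO (-3) (c ^ 3)) ∧
        (∃ c : K, HesseCubic.HasLeadingTerm E.funT t E.pointO (-3) (c ^ 3))) ∧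
    -- `f_S ∘ [3]` and `f_T ∘ [3]` are cubes of rational functions defined over `K`
    ((∃ g : E.geom.FunctionField, E.IsDefinedOver g ∧
        HesseCubic.CompThreeEqCube (E.geom.funS (algebraMap K _ ζ)) g) ∧
      (∃ g : E.geom.FunctionField, E.IsDefinedOver g ∧
        HesseCubic.CompThreeEqCube E.geom.funT g)) ∧
    -- evaluation is possible away from `O` and `S`, respectively `T`
    ((∀ P : E.Point, P ≠ E.pointO → P ≠ E.pointS ζ hζ.pow_eq_one →
        ∃ u : Kˣ, HesseCubic.HasValue (E.funS ζ) P u) ∧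
      (∀ P : E.Point, P ≠ E.pointO → P ≠ E.pointT →
        ∃ u : Kˣ, HesseCubic.HasValue E.funT P u)) ∧
    -- evaluation gives exactly one homomorphism on `E(K)/3E(K)`; it is injective, and it is the
    -- connecting homomorphism to `H¹(K, E[3])`, identified with `K*/K*³ × K*/K*³`
    (∃ Φ : E.ModThree →+ Additive (CubeClasses K × CubeClasses K),
      E.IsEvaluation ζ Φ ∧ (∀ Ψ, E.IsEvaluation ζ Ψ → Ψ = Φ) ∧ Function.Injective Φ ∧
      ∀ P : E.Point, (∃ Q : E.geom.Point, 3 • Q = E.toGeom P) ∧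
        ∀ Q : E.geom.Point, 3 • Q = E.toGeom P →
          ∀ a b : Kˣ, Φ (E.modThree P) = Additive.ofMul (cubeClass a, cubeClass b) →
            E.CocycleCorresponds (E.toGeom (E.pointS ζ hζ.pow_eq_one)) (E.toGeom E.pointT)
              (fun σ => E.galois σ Q - Q) a b) := by
  have hw := hζ.pow_eq_one
  refine ⟨⟨?_, ?_, fun A hA => ?_⟩, ⟨E.isTangentLine_lineO, E.isTangentLine_lineS hw,
    E.isTangentLine_lineT⟩, ⟨(HesseCubic.isKummer_funS_geom hζ).hasDivisor,
    (HesseCubic.isKummer_funT_geom hζ).hasDivisor⟩, ⟨⟨_, HesseCubic.isParameter_zero⟩,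
    fun t ht => ⟨?_, ?_⟩⟩, ⟨⟨_, HesseCubic.isDefinedOver_numS,
    (HesseCubic.isKummer_funS_geom hζ).compThreeEqCube⟩, ⟨_, HesseCubic.isDefinedOver_numT,
    (HesseCubic.isKummer_funT_geom hζ).compThreeEqCube⟩⟩,
    ⟨(HesseCubic.isDescent_funS hζ).exists_value, (HesseCubic.isDescent_funT hζ).exists_value⟩, ?_⟩
  · exact (HesseCubic.isKummer_funS_geom hζ).torsion
  · exact (HesseCubic.isKummer_funT_geom hζ).torsion
  · simp only [HesseCubic.toGeom_eq, ← map_nsmul, ← map_add]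
    obtain ⟨m, hm, n, hn, rfl⟩ := HesseCubic.exists_of_geom_torsion hζ hA
    refine ⟨(⟨m, hm⟩, ⟨n, hn⟩), rfl, ?_⟩
    rintro ⟨⟨m', hm'⟩, ⟨n', hn'⟩⟩ h
    obtain ⟨rfl, rfl⟩ := HesseCubic.nsmul_pointS_add_nsmul_pointT_injective hζ hm hm' hn hn'
      (HesseCubic.toGeom_injective h)
    rfl
  · exact (HesseCubic.hasLeadingTerm_funS_zero hζ).exists_cube HesseCubic.isParameter_zero
      (HesseCubic.coordRatio_ne_zero 0 2) ht
  · exact (HesseCubic.hasLeadingTerm_funT_zero hζ).exists_cube HesseCubic.isParameter_zero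
      (HesseCubic.coordRatio_ne_zero 0 2) ht
  · have hS := HesseCubic.isDescent_funS (E := E) hζ
    have hT := HesseCubic.isDescent_funT (E := E) hζ
    obtain ⟨Φ, hΦ⟩ := HesseCubic.exists_descentMap hζ hS hT
    have hev : E.IsEvaluation ζ Φ := by
      constructor
      · intro P u hu
        obtain ⟨b, hb⟩ := hT.exists_isKummerClass hζ P
        rw [(hΦ P u b).2 ⟨hS.isKummerClass_of_hasValue hζ hu, hb⟩]
        rfl
      · intro P u hu
        obtain ⟨a, ha⟩ := hS.exists_isKummerClass hζ P
        rw [(hΦ P a u).2 ⟨ha, hT.isKummerClass_of_hasValue hζ hu⟩]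
        rfl
    refine ⟨Φ, hev, fun Ψ hΨ => HesseCubic.isEvaluation_unique hζ hev hΨ, ?_, fun P => ⟨
      HesseCubic.exists_three_nsmul_eq (HesseCubic.isPrimitiveRoot_algebraMap hζ) _,
      fun Q hQ a b hab => ?_⟩⟩
    · refine (injective_iff_map_eq_zero Φ).2 fun x hx => ?_
      induction x using QuotientAddGroup.induction_on with
      | H P =>
        obtain ⟨h1, h2⟩ := (hΦ P 1 1).1 hx
        obtain ⟨Q, rfl⟩ := HesseCubic.exists_three_nsmul_eq_of_isKummerClass_one hζ h1 h2
        exact (QuotientAddGroup.eq_zero_iff _).2 ⟨Q, ofNat_zsmul Q 3⟩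
    · obtain ⟨h1, h2⟩ := (hΦ P a b).1 hab
      obtain ⟨α, hα, h1⟩ := h1.of_eq hζ hQ
      obtain ⟨β, hβ, h2⟩ := h2.of_eq hζ hQ
      refine ⟨α, β, hα, hβ, fun σ => ?_⟩
      have h0 := HesseCubic.three_nsmul_galois_sub hQ σ
      exact ⟨(HesseCubic.isKummer_funS_geom hζ).isWeilPairing h0 (h1 σ),
        (HesseCubic.isKummer_funT_geom hζ).isWeilPairing h0 (h2 σ)⟩
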